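/- Write $\{0,1\}^n=\mathbb F_2^n$, and let $k\text{-Linear}^*$ be the class of functions $f:\{0,1\}^n\to\{0,1\}$ that are the sum over $\mathbb F_2$ of at most $k$ coordinates. For a distribution $\mathcal D$ on $\{0,1\}^n$, a function $f$ is $\epsilon$-far from a class $C$ if $\Pr_{x\sim\mathcal D}[f(x)\ne g(x)]\ge\epsilon$ for every $g\in C$. A tester is a randomized algorithm with oracle access to $f$ and to samples from an unknown $\mathcal D$. It is a distribution-free one-sided $\epsilon$-tester for $C$ if it always accepts when $f\in C$ and, for every $\mathcal D$, rejects with probability at least $2/3$ whenever $f$ is $\epsilon$-far from $C$. It is non-adaptive if its queries to $f$ depend only on its random coins and on the sample, not on the answers. **The algorithm Test-Linear$^*_k$.** Let $c_2>0$ be a constant and, for all $N,K$, let $H(N,K)$ be a deterministic non-adaptive algorithm which, for $N\ge 2$ and $K\ge 1$, exactly learns $K\text{-Linear}^*$ over $N$ coordinates from at most $c_2K\log_2N$ queries. Put $r=256k^2$ and $\epsilon'=1/\bigl(12(16k+8c_2k\log_2 r)\bigr)$, and let $g(x)$ stand for $f(x+z)+f(z)$ with a fresh uniform $z\in\{0,1\}^n$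 at each evaluation. 1. Repeat $\lceil 2/\epsilon'\rceil$ times: for uniform independent $x,y\in\{0,1\}^n$, reject if $f(x)+f(y)\neq f(x+y)$. 2. (a) Choose a uniform random partition $X_1,\dots,X_{16k}$ of $[n]$ (each coordinate is put independently into a uniform part) and a uniform $z\in\{0,1\}^n$; reject if $g(z_{X_i}\circ 0_{\overline{X_i}})=1$ for more than $k$ indices $i$, where $z_{X_i}\circ 0_{\overline{X_i}}$ agrees with $z$ on $X_i$ and is $0$ elsewhere. (b) Choose a uniform random partition $X_1,\dots,X_r$ of $[n]$ and run $H(r,8k)$ on the function $F(y_1,\dots,y_r)=g(w)$, where $w_v=y_i$ for every $v\in X_i$; reject if the output is not in $k\text{-Linear}^*$. 3. Draw $\lceil 4/\epsilon\rceil$ independent samples $x\sim\mathcal D$; reject if $f(x)\ne g(x)$ for one of them. Accept if no step rejects. (Checking in 2(b) for sums of exactly $k$ coordinates gives the two-sided tester for $k$-Linear.) **Theorem.** (i) There are $c_2$ and algorithms $H(N,K)$ as above, and a constant $C$, such that for all $n$, all $k\ge 12$ and all real $\epsilon>0$, Test-Linear$^*_k$ is a non-adaptive distribution-free one-sided $\epsilon$-tester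 for $k\text{-Linear}^*$ that makes at most $C\,(k\log k+1/\epsilon)$ queries. (ii) There are one program (for a random access machine with unit-cost addition, truncated subtraction, indirect addressing, fair coins, and the two oracles at cost $n+1$ per call) and constants $C,d$ such that for all $n,k\ge 0$ and all real $\epsilon>0$, the program, on input $n$, $k$ and natural numbers $a,b$ with $\epsilon/2\le a/b\le\epsilon$ (for rational $\epsilon$ one may take $a/b=\epsilon$), is a non-adaptive distribution-free one-sided $\epsilon$-tester for $k\text{-Linear}^*$. For every $f$ and every outcome of the coins and samples, it runs in time at most $C(n+k+1/\epsilon+1)^d$, and its queries and samples together number at most $C\,(k\log k+1/\epsilon)$ (where $0\log 0=0$). -/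

import Mathlib

open Finset MeasureTheory

/-- The cube `{0,1}^n`, with coordinatewise addition over the field with two elements. -/
abbrev Pt (n : ℕ) : Type := Fin n → ZMod 2

/-- Boolean functions `{0,1}^n → {0,1}`. -/
abbrev BoolFn (n : ℕ) : Type := Pt n → ZMod 2

/-- `k`-Linear*: the functions that are the sum (mod 2) of at most `k` coordinates. -/
def kLinearStar (n k : ℕ) : Set (BoolFn n) :=
  {f | ∃ S : Finset (Fin n), S.card ≤ k ∧ ∀ x, f x = ∑ i ∈ S, x i}

/-- `f` is `ε`-far from every member of the class `C` with respect to the distribution `D`. -/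
def IsFarFrom {n : ℕ} (D : PMF (Pt n)) (ε : ℝ) (f : BoolFn n) (C : Set (BoolFn n)) : Prop :=
  ∀ g ∈ C, ε ≤ D.toMeasure.real {x | f x ≠ g x}

section NonAdaptive

/-- A non-adaptive tester that draws `numSamples` points from the unknown distribution and a
uniformly random `Seed`. All the queries (indexed by `Q`) are a function of the seed and of the
sample only; the verdict is a function of the seed, the sample and the answers. -/
structure NonAdaptiveTester (n : ℕ) where
  Seed : Type
  [fintypeSeed : Fintype Seed]
  Q : Type
  [fintypeQ : Fintype Q]
  numSamples : ℕ
  query : Seed → (Fin numSamples → Pt n) → Q → Pt n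
  verdict : Seed → (Fin numSamples → Pt n) → (Q → ZMod 2) → Prop

attribute [instance] NonAdaptiveTester.fintypeSeed NonAdaptiveTester.fintypeQ

namespace NonAdaptiveTester

variable {n : ℕ}

/-- The number of queries. -/
def queryComplexity (T : NonAdaptiveTester n) : ℕ := Fintype.card T.Q

/-- The tester accepts `f` on the given seed and sample. -/
def Accepts (T : NonAdaptiveTester n) (f : BoolFn n) (s : T.Seed)
    (xs : Fin T.numSamples → Pt n) : Prop :=
  T.verdict s xs (fun j => f (T.query s xs j))

open Classical in
/-- The probability of rejecting `f`, over a uniform seed and an i.i.d. sample from `D`. -/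
noncomputable def rejectProb (T : NonAdaptiveTester n) (D : PMF (Pt n)) (f : BoolFn n) : ℝ :=
  ∑ s : T.Seed, ∑ xs : Fin T.numSamples → Pt n,
    (1 / (Fintype.card T.Seed : ℝ)) * (∏ i, (D (xs i)).toReal) *
      (if T.Accepts f s xs then 0 else 1)

/-- `T` is a distribution-free one-sided `ε`-tester for `C`: it always accepts members of `C`, and
for every distribution it rejects with probability at least `2/3` every function that is `ε`-far
from `C`. -/
def IsOneSidedTester (T : NonAdaptiveTester n) (ε : ℝ) (C : Set (BoolFn n)) : Prop :=
  (∀ f ∈ C, ∀ s xs, T.Accepts f s xs) ∧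
  (∀ (D : PMF (Pt n)) (f : BoolFn n), IsFarFrom D ε f C → 2 / 3 ≤ T.rejectProb D f)

end NonAdaptiveTester

/-- A deterministic non-adaptive learning algorithm for Boolean functions on `N` coordinates. -/
structure Learner (N : ℕ) where
  Q : Type
  [fintypeQ : Fintype Q]
  query : Q → Pt N
  output : (Q → ZMod 2) → BoolFn N

attribute [instance] Learner.fintypeQ

/-- The learner identifies every member of `C` exactly. -/
def Learner.ExactlyLearns {N : ℕ} (L : Learner N) (C : Set (BoolFn N)) : Prop :=
  ∀ F ∈ C, L.output (fun j => F (L.query j)) = F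

/-- The distance parameter at which the linearity test is run: `1 / (12 q)`, where
`q = 16 k + c₂ (8 k) log₂ (256 k²)` bounds the number of values of the self-corrected function
that are asked for in the second stage. -/
noncomputable def blrDistance (c₂ : ℝ) (k : ℕ) : ℝ :=
  1 / (12 * (16 * k + c₂ * (8 * k) * Real.logb 2 (256 * (k : ℝ) ^ 2)))

/-- The number of repetitions of the basic test `f x + f y = f (x + y)`. -/
noncomputable def blrRounds (c₂ : ℝ) (k : ℕ) : ℕ := ⌈2 / blrDistance c₂ k⌉₊

/-- The size of the sample in the consistency test. -/
noncomputable def sampleSize (ε : ℝ) : ℕ := ⌈4 / ε⌉₊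

/-- The random choices of Test-Linear*: the pairs of the linearity test; a partition of the
coordinates into `16 k` parts, a point `z` and a self-correction shift for each part; a partition
into `256 k²` parts and a self-correction shift for each query of the learner; a self-correction
shift for each sample point. A partition is given by the map from coordinates to parts. -/
abbrev TestSeed (n k m t : ℕ) (Q : Type) : Type :=
  (Fin m → Pt n × Pt n) ×
  ((Fin n → Fin (16 * k)) × Pt n × (Fin (16 * k) → Pt n)) ×
  ((Fin n → Fin (256 * k ^ 2)) × (Q → Pt n)) ×
  (Fin t → Pt n)

/-- The queries of Test-Linear*: three per round of the linearity test, two per value of the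
self-corrected function in the second stage, three per sample point. -/
abbrev TestQuery (k m t : ℕ) (Q : Type) : Type :=
  (Fin m × Fin 3) ⊕ (Fin (16 * k) × Bool) ⊕ (Q × Bool) ⊕ (Fin t × Fin 3)

/-- The query strings. The self-corrected value at `w` with shift `z` is `f (w + z) + f z`; the flag
`true` stands for the query `w + z` and `false` for the query `z`. -/
def testQueries {n k m t : ℕ} (L : Learner (256 * k ^ 2)) (s : TestSeed n k m t L.Q)
    (xs : Fin t → Pt n) : TestQuery k m t L.Q → Pt n
  | .inl (i, j) => ![(s.1 i).1, (s.1 i).2, (s.1 i).1 + (s.1 i).2] j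
  | .inr (.inl (i, b)) =>
      -- the point that agrees with `z` on part `i` and vanishes elsewhere
      let w : Pt n := fun v => if s.2.1.1 v = i then s.2.1.2.1 v else 0
      let z := s.2.1.2.2 i
      if b then w + z else z
  | .inr (.inr (.inl (q, b))) =>
      -- the learner's query, each of its coordinates copied to the corresponding part
      let w : Pt n := fun v => L.query q (s.2.2.1.1 v)
      let z := s.2.2.1.2 q
      if b then w + z else z
  | .inr (.inr (.inr (i, j))) => ![xs i, xs i + s.2.2.2 i, s.2.2.2 i] j

/-- The verdict from the answers `a`: the linearity test passes; at most `k` parts of the first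
partition give the value `1`; the learned projected function lies in `final`; the function agrees
with its self-correction on the sample. -/
def testVerdict {k m t : ℕ} (L : Learner (256 * k ^ 2)) (final : Set (BoolFn (256 * k ^ 2)))
    (a : TestQuery k m t L.Q → ZMod 2) : Prop :=
  (∀ i, a (.inl (i, 0)) + a (.inl (i, 1)) = a (.inl (i, 2))) ∧
  (univ.filter fun i : Fin (16 * k) =>
    a (.inr (.inl (i, true))) + a (.inr (.inl (i, false))) = 1).card ≤ k ∧
  L.output (fun q => a (.inr (.inr (.inl (q, true)))) + a (.inr (.inr (.inl (q, false))))) ∈ final ∧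
  (∀ i, a (.inr (.inr (.inr (i, 0)))) =
    a (.inr (.inr (.inr (i, 1)))) + a (.inr (.inr (.inr (i, 2)))))

open Classical in
/-- The common algorithm, with the class `final` against which the learned projected function is
checked as a parameter. -/
noncomputable def testWithFinalCheck (c₂ : ℝ) (n k : ℕ) (ε : ℝ) (L : Learner (256 * k ^ 2))
    (final : Set (BoolFn (256 * k ^ 2))) : NonAdaptiveTester n where
  Seed := TestSeed n k (blrRounds c₂ k) (sampleSize ε) L.Q
  Q := TestQuery k (blrRounds c₂ k) (sampleSize ε) L.Q
  numSamples := sampleSize ε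
  query := testQueries L
  verdict := fun _ _ a => testVerdict L final a

/-- Test-Linear*: the final check is membership in `k`-Linear*. (With the functions that are sums
of exactly `k` coordinates instead, one gets the two-sided tester for `k`-Linear.) -/
noncomputable def testLinearStar (c₂ : ℝ) (n k : ℕ) (ε : ℝ) (L : Learner (256 * k ^ 2)) :
    NonAdaptiveTester n :=
  testWithFinalCheck c₂ n k ε L (kLinearStar (256 * k ^ 2) k)

end NonAdaptive

section Machine

/-- Programs of a random access machine with registers and an addressable memory, both holding
natural numbers, with access to fair coins, to a source of samples and to a black-box function.
There is no multiplication, so that unit cost is polynomially equivalent to bit cost. -/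
inductive Prog : Type
  /-- `R[r] := c` -/
  | const (r c : ℕ)
  /-- `R[r] := R[u] + R[v]` -/
  | add (r u v : ℕ)
  /-- `R[r] := max (R[u] - R[v]) 0` -/
  | sub (r u v : ℕ)
  /-- `R[r] := M[R[u]]` -/
  | load (r u : ℕ)
  /-- `M[R[r]] := R[u]` -/
  | store (r u : ℕ)
  /-- `R[r] :=` a fair coin -/
  | coin (r : ℕ)
  /-- `M[R[r]], …, M[R[r] + n - 1] :=` a fresh sample from the distribution -/
  | sample (r : ℕ)
  /-- `R[r] := f (M[R[u]], …, M[R[u] + n - 1])` -/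
  | query (r u : ℕ)
  | seq (p q : Prog)
  /-- `if R[r] ≠ 0 then p else q` -/
  | ite (r : ℕ) (p q : Prog)
  /-- `while R[r] ≠ 0 do p` -/
  | loop (r : ℕ) (p : Prog)

/-- The random tapes: an infinite sequence of coins and an infinite sequence of samples. -/
abbrev Tape (n : ℕ) : Type := (ℕ → Bool) × (ℕ → Pt n)

/-- Independent fair coins and independent samples from `D`. -/
noncomputable def tapeMeasure {n : ℕ} (D : PMF (Pt n)) : Measure (Tape n) :=
  (Measure.infinitePi fun _ : ℕ => (PMF.uniformOfFintype Bool).toMeasure).prod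
    (Measure.infinitePi fun _ : ℕ => D.toMeasure)

/-- Machine states: registers, memory, the numbers of coins and samples consumed so far, and the
list of the queries made so far. -/
structure MState (n : ℕ) where
  reg : ℕ → ℕ
  mem : ℕ → ℕ
  coins : ℕ
  samples : ℕ
  queries : List (Pt n)

namespace MState

variable {n : ℕ}

def setReg (s : MState n) (r c : ℕ) : MState n := { s with reg := Function.update s.reg r c }

def setMem (s : MState n) (j c : ℕ) : MState n := { s with mem := Function.update s.mem j c }

/-- The point stored in the `n` memory cells from address `j` on. -/
def readPt (s : MState n) (j : ℕ) : Pt n := fun i => if s.mem (j + i) = 0 then 0 else 1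

/-- Write the point `x` into the `n` memory cells from address `j` on. -/
def writePt (s : MState n) (j : ℕ) (x : Pt n) : MState n :=
  { s with mem := fun l => if h : j ≤ l ∧ l - j < n then (x ⟨l - j, h.2⟩).val else s.mem l }

/-- Initially registers 0, 1, 2, 3 hold the inputs `n, k, a, b` and everything else is zero. -/
def init (n k a b : ℕ) : MState n where
  reg := fun r => if r = 0 then n else if r = 1 then k else if r = 2 then a else
    if r = 3 then b else 0
  mem := fun _ => 0
  coins := 0
  samples := 0
  queries := []

end MState

/-- `Exec f ω p s t s'`: with oracle `f` and random tapes `ω`, the program `p` started in state `s`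
halts in state `s'` after time `t`. Oracle calls cost `n + 1`, everything else costs `1`. -/
inductive Exec {n : ℕ} (f : BoolFn n) (ω : Tape n) : Prog → MState n → ℕ → MState n → Prop
  | const (r c : ℕ) (s : MState n) : Exec f ω (.const r c) s 1 (s.setReg r c)
  | add (r u v : ℕ) (s : MState n) :
      Exec f ω (.add r u v) s 1 (s.setReg r (s.reg u + s.reg v))
  | sub (r u v : ℕ) (s : MState n) :
      Exec f ω (.sub r u v) s 1 (s.setReg r (s.reg u - s.reg v))
  | load (r u : ℕ) (s : MState n) : Exec f ω (.load r u) s 1 (s.setReg r (s.mem (s.reg u)))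
  | store (r u : ℕ) (s : MState n) : Exec f ω (.store r u) s 1 (s.setMem (s.reg r) (s.reg u))
  | coin (r : ℕ) (s : MState n) :
      Exec f ω (.coin r) s 1
        { s.setReg r (if ω.1 s.coins then 1 else 0) with coins := s.coins + 1 }
  | sample (r : ℕ) (s : MState n) :
      Exec f ω (.sample r) s (n + 1)
        { s.writePt (s.reg r) (ω.2 s.samples) with samples := s.samples + 1 }
  | query (r u : ℕ) (s : MState n) :
      Exec f ω (.query r u) s (n + 1)
        { s.setReg r (f (s.readPt (s.reg u))).val with
          queries := s.queries ++ [s.readPt (s.reg u)] }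
  | seq {p q : Prog} {s s' s'' : MState n} {t t' : ℕ} :
      Exec f ω p s t s' → Exec f ω q s' t' s'' → Exec f ω (.seq p q) s (t + t') s''
  | ite_true {r : ℕ} {p q : Prog} {s s' : MState n} {t : ℕ} :
      s.reg r ≠ 0 → Exec f ω p s t s' → Exec f ω (.ite r p q) s (t + 1) s'
  | ite_false {r : ℕ} {p q : Prog} {s s' : MState n} {t : ℕ} :
      s.reg r = 0 → Exec f ω q s t s' → Exec f ω (.ite r p q) s (t + 1) s'
  | loop_stop {r : ℕ} {p : Prog} {s : MState n} :
      s.reg r = 0 → Exec f ω (.loop r p) s 1 s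
  | loop_step {r : ℕ} {p : Prog} {s s' s'' : MState n} {t t' : ℕ} :
      s.reg r ≠ 0 → Exec f ω p s t s' → Exec f ω (.loop r p) s' t' s'' →
      Exec f ω (.loop r p) s (t + t' + 1) s''

/-- For fixed oracle and tapes the outcome of a run is unique. -/
theorem Exec.deterministic {n : ℕ} {f : BoolFn n} {ω : Tape n} {p : Prog} {s s₁ s₂ : MState n}
    {t₁ t₂ : ℕ} (h₁ : Exec f ω p s t₁ s₁) (h₂ : Exec f ω p s t₂ s₂) : t₁ = t₂ ∧ s₁ = s₂ := by
  induction h₁ generalizing t₂ s₂ with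
  | seq _ _ ih ih' =>
    cases h₂ with
    | seq a b =>
      obtain ⟨rfl, rfl⟩ := ih a
      obtain ⟨rfl, rfl⟩ := ih' b
      exact ⟨rfl, rfl⟩
  | ite_true h _ ih =>
    cases h₂ with
    | ite_true _ a =>
      obtain ⟨rfl, rfl⟩ := ih a
      exact ⟨rfl, rfl⟩
    | ite_false h' _ => exact absurd h' h
  | ite_false h _ ih =>
    cases h₂ with
    | ite_true h' _ => exact absurd h h'
    | ite_false _ a =>
      obtain ⟨rfl, rfl⟩ := ih a
      exact ⟨rfl, rfl⟩
  | loop_stop h =>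
    cases h₂ with
    | loop_stop _ => exact ⟨rfl, rfl⟩
    | loop_step h' _ _ => exact absurd h h'
  | loop_step h _ _ ih ih' =>
    cases h₂ with
    | loop_stop h' => exact absurd h' h
    | loop_step _ a b =>
      obtain ⟨rfl, rfl⟩ := ih a
      obtain ⟨rfl, rfl⟩ := ih' b
      exact ⟨rfl, rfl⟩
  | _ => cases h₂; exact ⟨rfl, rfl⟩

namespace Prog

variable (P : Prog) (n k a b : ℕ)

/-- On the inputs `n, k, a, b` the program halts after time `t` in state `s`. -/
def HaltsIn (f : BoolFn n) (ω : Tape n) (t : ℕ) (s : MState n) : Prop :=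
  Exec f ω P (MState.init n k a b) t s

/-- The program halts and accepts: register 0 holds a nonzero number. -/
def Accepts (f : BoolFn n) (ω : Tape n) : Prop := ∃ t s, P.HaltsIn n k a b f ω t s ∧ s.reg 0 ≠ 0

/-- The program halts and rejects: register 0 holds zero. -/
def Rejects (f : BoolFn n) (ω : Tape n) : Prop := ∃ t s, P.HaltsIn n k a b f ω t s ∧ s.reg 0 = 0

/-- On every function and all random tapes, the program halts within the given time bound, and the
number of queries and the number of samples are together within the given query bound. -/
def RunsWithin (timeBound queryBound : ℝ) : Prop :=
  ∀ (f : BoolFn n) (ω : Tape n), ∃ t s, P.HaltsIn n k a b f ω t s ∧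
    (t : ℝ) ≤ timeBound ∧ (s.queries.length : ℝ) + s.samples ≤ queryBound

/-- The queries depend on the random tapes only, and not on the answers. -/
def IsNonAdaptive : Prop :=
  ∀ (ω : Tape n) (f f' : BoolFn n) (t t' : ℕ) (s s' : MState n),
    P.HaltsIn n k a b f ω t s → P.HaltsIn n k a b f' ω t' s' → s.queries = s'.queries

/-- Distribution-free one-sided `ε`-testing of `C`. -/
def IsOneSidedTester (ε : ℝ) (C : Set (BoolFn n)) : Prop :=
  (∀ f ∈ C, ∀ ω, P.Accepts n k a b f ω) ∧
  (∀ (D : PMF (Pt n)) (f : BoolFn n), IsFarFrom D ε f C →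
    2 / 3 ≤ (tapeMeasure D).real {ω | P.Rejects n k a b f ω})

end Prog

end Machine

/-! ### Uniform probability on finite types -/

section UniformProbability

/-! Both testers are instances of one scheme (`SchemeAccepts`): a linearity test, a test of the
number of relevant coordinates that sees only values of the self-corrected function, and a
comparison of `f` with its self-correction on the sample. Completeness is pointwise: a parity passes
every linearity check, and its self-correction is exact for every shift.

Soundness is `sampleProb_schemeAccepts_le`. Fourier analysis (`exists_linDist_le`) gives a parity on
a set `S` such that one round of the linearity test rejects with probability at least the distance δ
from `f` to it. If δ > 1/(12q), where q is the number of self-corrected values in the middle stage,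
then 24q rounds reject. Otherwise each self-corrected value is wrong with probability at most 2δ, so
all q values agree with the parity on `S` except with probability 1/6. If |S| > k, it remains that
the middle stage accepts an exact parity on `S` with probability at most 1/6. If |S| ≤ k, the parity
is in the class, hence `f` differs from it with probability at least ε under the unknown
distribution, and each sample exposes this with probability at least 5ε/6.

For Test-Linear* the middle stage splits at |S| = 8k. Above it, a second moment computation shows
that more than k of the 16k random parts have odd parity on a random point. Below it, a random
partition into 256k² parts is injective on `S` by the birthday bound, so the learner returns a
parity on exactly |S| > k parts. The learner exists because random points separate sparse parities,
but it decodes by unrestricted search.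

The machine therefore uses a different middle stage, the rank test. Coordinates are hashed into
2^lam groups, and for each group the parity is evaluated at the coordinatewise products of random
points `A i` and `B j` cut down to the group. The resulting matrix factors through the members of
`S` in the group, so the ranks add up to at most |S|. Conversely, for k + 1 chosen members of `S`,
with high probability the columns of `A` indexed by the chosen members in each group are linearly
independent and `B` loses no rank, so the ranks add up to at least k + 1
(`unifProb_rankVerdict_le`). With κ of order log k, matrices of size 4κ by 6κ and about k/κ groups,
this takes O(k log k) values, and the ranks are found by Gaussian elimination.

On the machine all three stages have the same shape: query `u`, `z` and `u + z`. All coins, samples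
and points are written to memory before the first query, so the query list is an explicit function
of the tapes; this gives non-adaptivity. Correctness and running time are proved by weakest
preconditions with explicit memory contents, and the law of the tapes is reduced to a finite uniform
seed and a finite sample by `tapeMeasure_real_eq`. -/

open Classical in
/-- The probability of `p` under the uniform distribution on a finite type. -/
noncomputable def unifProb {α : Type*} [Fintype α] (p : α → Prop) : ℝ :=
  (∑ x, if p x then (1 : ℝ) else 0) / Fintype.card α

variable {α β γ : Type*} [Fintype α] [Fintype β] [Fintype γ]

open Classical in
theorem unifProb_eq_card (p : α → Prop) :
    unifProb p = ((univ.filter p).card : ℝ) / Fintype.card α := by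
  simp [unifProb]

theorem unifProb_nonneg (p : α → Prop) : 0 ≤ unifProb p := by
  classical
  rw [unifProb_eq_card]; positivity

theorem unifProb_mono {p q : α → Prop} (h : ∀ x, p x → q x) : unifProb p ≤ unifProb q := by
  classical
  rw [unifProb_eq_card, unifProb_eq_card]
  gcongr with x
  exact h x

theorem unifProb_le_one (p : α → Prop) : unifProb p ≤ 1 := by
  classical
  rw [unifProb_eq_card]
  apply div_le_one_of_le₀ _ (by positivity)
  exact_mod_cast card_le_univ _

theorem unifProb_or_le (p q : α → Prop) :
    unifProb (fun x => p x ∨ q x) ≤ unifProb p + unifProb q := by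
  classical
  rw [unifProb, unifProb, unifProb, ← add_div, ← sum_add_distrib]
  gcongr with x
  by_cases h : p x <;> by_cases h' : q x <;> simp [h, h']

theorem unifProb_exists_le {ι : Type*} (s : Finset ι) (p : ι → α → Prop) :
    unifProb (fun x => ∃ i ∈ s, p i x) ≤ ∑ i ∈ s, unifProb (p i) := by
  classical
  induction s using Finset.induction_on with
  | empty => simp [unifProb]
  | insert i s hi ih =>
    rw [sum_insert hi]
    refine le_trans (unifProb_mono (q := fun x => p i x ∨ ∃ j ∈ s, p j x) ?_)
      ((unifProb_or_le _ _).trans (by gcongr))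
    rintro x ⟨j, hj, hx⟩
    rcases mem_insert.1 hj with rfl | hj
    · exact Or.inl hx
    · exact Or.inr ⟨j, hj, hx⟩

theorem unifProb_not [Nonempty α] (p : α → Prop) : unifProb (fun x => ¬ p x) = 1 - unifProb p := by
  classical
  have hc : (Fintype.card α : ℝ) ≠ 0 := by simp
  rw [unifProb, unifProb, eq_sub_iff_add_eq, ← add_div, ← sum_add_distrib, div_eq_one_iff_eq hc]
  rw [← card_univ, ← nsmul_one, ← sum_const]
  refine sum_congr rfl fun x _ => ?_
  by_cases h : p x <;> simp [h]

theorem unifProb_equiv (e : α ≃ β) (p : β → Prop) : unifProb (fun x => p (e x)) = unifProb p := by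
  classical
  rw [unifProb, unifProb, Fintype.card_congr e, ← e.sum_comp]

theorem unifProb_prod (p : α × β → Prop) :
    unifProb p = (∑ a, unifProb fun b => p (a, b)) / Fintype.card α := by
  classical
  simp only [unifProb, Fintype.sum_prod_type, Fintype.card_prod, Nat.cast_mul]
  rw [← sum_div, div_div, mul_comm]

/-- Conditioning on the first component: bad values are charged to `q`, all others contribute at
most `c`. -/
theorem unifProb_prod_le {p : α × β → Prop} {q : α → Prop} {c : ℝ} (hc : 0 ≤ c)
    (h : ∀ a, ¬ q a → unifProb (fun b => p (a, b)) ≤ c) : unifProb p ≤ unifProb q + c := by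
  classical
  have key : ∀ a, unifProb (fun b => p (a, b)) ≤ (if q a then 1 else 0) + c := fun a => by
    by_cases ha : q a
    · simpa [ha] using (unifProb_le_one _).trans (by linarith)
    · simpa [ha] using h a ha
  rcases isEmpty_or_nonempty α with hα | hα
  · simp [unifProb, hc]
  · have h0 : (0 : ℝ) < Fintype.card α := by exact_mod_cast Fintype.card_pos
    rw [unifProb_prod, div_le_iff₀ h0, add_mul]
    refine (sum_le_sum fun a _ => key a).trans ?_
    rw [sum_add_distrib, unifProb, div_mul_cancel₀ _ h0.ne']
    simp [mul_comm]

theorem unifProb_and (p : α → Prop) (q : β → Prop) :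
    unifProb (fun x : α × β => p x.1 ∧ q x.2) = unifProb p * unifProb q := by
  classical
  simp only [unifProb, Fintype.sum_prod_type, Fintype.card_prod, Nat.cast_mul]
  rw [div_mul_div_comm, sum_mul_sum]
  congr 1
  refine sum_congr rfl fun a _ => sum_congr rfl fun b _ => ?_
  by_cases h : p a <;> simp [h]

theorem unifProb_fst [Nonempty β] (p : α → Prop) : unifProb (fun x : α × β => p x.1) = unifProb p := by
  have := unifProb_and p (fun _ : β => True)
  simp only [and_true] at this
  rw [this]; simp [unifProb]

theorem unifProb_snd [Nonempty α] (p : β → Prop) : unifProb (fun x : α × β => p x.2) = unifProb p := by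
  have := unifProb_and (fun _ : α => True) p
  simp only [true_and] at this
  rw [this]; simp [unifProb]

theorem unifProb_pi {ι : Type*} [Fintype ι] [DecidableEq ι] (p : ι → α → Prop) :
    unifProb (fun x : ι → α => ∀ i, p i (x i)) = ∏ i, unifProb (p i) := by
  classical
  simp only [unifProb, prod_div_distrib, Fintype.card_pi, Nat.cast_prod]
  congr 1
  rw [Finset.prod_univ_sum, Fintype.piFinset_univ]
  refine sum_congr rfl fun x _ => ?_
  rw [Fintype.prod_ite_zero]
  simp

theorem unifProb_pi_const {ι : Type*} [Fintype ι] [DecidableEq ι] (p : α → Prop) :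
    unifProb (fun x : ι → α => ∀ i, p (x i)) = unifProb p ^ Fintype.card ι := by
  rw [unifProb_pi fun _ => p, prod_const, card_univ]

theorem unifProb_eval {ι : Type*} [Fintype ι] [DecidableEq ι] [Nonempty α] (i : ι) (p : α → Prop) :
    unifProb (fun x : ι → α => p (x i)) = unifProb p := by
  have h := unifProb_pi (α := α) (fun j : ι => fun a => j = i → p a)
  have : ∀ x : ι → α, (∀ j, j = i → p (x j)) ↔ p (x i) := fun x => by simp
  simp only [this] at h
  rw [h, prod_eq_single i]
  · simp
  · intro j _ hj; simp [hj, unifProb]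
  · simp

end UniformProbability

/-! ### Parities and signs -/

section Parity

variable {n : ℕ}

/-- The sum of the coordinates in `S`. -/
def parity (S : Finset (Fin n)) (x : Pt n) : ZMod 2 := ∑ i ∈ S, x i

theorem parity_add (S : Finset (Fin n)) (x y : Pt n) :
    parity S (x + y) = parity S x + parity S y := by
  simp [parity, sum_add_distrib]

theorem parity_mem_kLinearStar {S : Finset (Fin n)} {k : ℕ} (h : S.card ≤ k) :
    parity S ∈ kLinearStar n k := ⟨S, h, fun _ => rfl⟩

/-- The sign `(-1)^a`. -/
def sgn (a : ZMod 2) : ℝ := if a = 0 then 1 else -1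

theorem ZMod.two_cases (a : ZMod 2) : a = 0 ∨ a = 1 := by
  revert a; decide

theorem sgn_add (a b : ZMod 2) : sgn (a + b) = sgn a * sgn b := by
  have h : (1 + 1 : ZMod 2) = 0 := by decide
  rcases ZMod.two_cases a with rfl | rfl <;> rcases ZMod.two_cases b with rfl | rfl <;>
    simp [sgn, h]

theorem sgn_mul_self (a : ZMod 2) : sgn a * sgn a = 1 := by
  unfold sgn; split_ifs <;> norm_num

theorem sgn_sum {ι : Type*} (S : Finset ι) (x : ι → ZMod 2) :
    sgn (∑ i ∈ S, x i) = ∏ i ∈ S, sgn (x i) := by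
  classical
  induction S using Finset.induction_on with
  | empty => simp [sgn]
  | insert i s hi ih => rw [sum_insert hi, prod_insert hi, sgn_add, ih]

/-- Orthogonality of characters: the sum is the expansion of ∏ (1 + sgn (x i)), and a coordinate
equal to 1 makes its factor vanish. -/
theorem sum_sgn_parity (x : Pt n) :
    ∑ S : Finset (Fin n), sgn (parity S x) = if x = 0 then (2 : ℝ) ^ n else 0 := by
  have h : ∑ S : Finset (Fin n), sgn (parity S x) = ∏ i, (1 + sgn (x i)) := by
    rw [Finset.prod_one_add, Finset.powerset_univ]
    exact sum_congr rfl fun S _ => sgn_sum S x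
  rw [h]
  split_ifs with hx
  · subst hx; norm_num [sgn]
  · obtain ⟨i, hi⟩ := Function.ne_iff.1 hx
    refine prod_eq_zero (mem_univ i) ?_
    simp only [Pi.zero_apply] at hi
    simp [sgn, hi]

theorem card_Pt : (Fintype.card (Pt n) : ℝ) = 2 ^ n := by
  simp

theorem Pt.add_eq_zero_iff (x y : Pt n) : x + y = 0 ↔ x = y := by
  simp only [funext_iff, Pi.add_apply, Pi.zero_apply, CharTwo.add_eq_zero]

/-- Flipping one coordinate of `S` exchanges the two values. -/
theorem parity_eq_half {S : Finset (Fin n)} (hS : S.Nonempty) (a : ZMod 2) :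
    unifProb (fun x : Pt n => parity S x = a) = 1 / 2 := by
  classical
  obtain ⟨i, hi⟩ := hS
  have hflip : unifProb (fun x : Pt n => parity S x = a + 1) =
      unifProb (fun x : Pt n => parity S x = a) := by
    rw [← unifProb_equiv (Equiv.addRight (Pi.single i 1 : Pt n))]
    congr 1; funext x
    have : parity S (Pi.single i 1 : Pt n) = 1 := by simp [parity, Pi.single_apply, hi]
    simp only [Equiv.coe_addRight, parity_add, this, add_left_inj]
  have hnot : unifProb (fun x : Pt n => parity S x = a + 1) =
      1 - unifProb (fun x : Pt n => parity S x = a) := by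
    rw [← unifProb_not]
    congr 1; funext x
    have : ∀ b a : ZMod 2, (b = a + 1) = ¬ b = a := by decide
    exact this _ _
  linarith

end Parity

/-! ### Fourier analysis of the linearity test -/

section LinearityTest

variable {n : ℕ}

/-- The distance from `f` to the sum of the coordinates in `S`. -/
noncomputable def linDist (f : BoolFn n) (S : Finset (Fin n)) : ℝ :=
  unifProb fun x => f x ≠ parity S x

/-- The unnormalized Walsh coefficient. -/
noncomputable def walsh (f : BoolFn n) (S : Finset (Fin n)) : ℝ :=
  ∑ x, sgn (f x) * sgn (parity S x)

theorem walsh_eq (f : BoolFn n) (S : Finset (Fin n)) :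
    walsh f S = 2 ^ n * (1 - 2 * linDist f S) := by
  classical
  have h : ∀ x, sgn (f x) * sgn (parity S x) = 1 - 2 * (if f x ≠ parity S x then 1 else 0) := by
    intro x
    rcases ZMod.two_cases (f x) with h | h <;> rcases ZMod.two_cases (parity S x) with h' | h' <;>
      norm_num [sgn, h, h']
  have h2 : (2 : ℝ) ^ n ≠ 0 := by positivity
  simp only [walsh, h, sum_sub_distrib, ← mul_sum, linDist, unifProb]
  rw [card_Pt, sum_const, card_univ, nsmul_one, card_Pt]
  field_simp
  congr!

/-- Parseval's identity: summing over `S` first leaves only the diagonal x = y. -/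
theorem sum_walsh_sq (f : BoolFn n) : ∑ S, walsh f S ^ 2 = (2 : ℝ) ^ n * 2 ^ n := by
  have h : ∀ S, walsh f S ^ 2 = ∑ x, ∑ y, sgn (f x) * sgn (f y) * sgn (parity S (x + y)) := by
    intro S
    rw [walsh, sq, sum_mul_sum]
    refine sum_congr rfl fun x _ => sum_congr rfl fun y _ => ?_
    rw [parity_add, sgn_add]; ring
  simp only [h]
  rw [sum_comm]
  have : ∀ x : Pt n, ∑ S : Finset (Fin n), ∑ y, sgn (f x) * sgn (f y) * sgn (parity S (x + y)) =
      2 ^ n := by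
    intro x
    rw [sum_comm]
    simp only [← mul_sum, sum_sgn_parity, Pt.add_eq_zero_iff]
    rw [sum_eq_single x]
    · simp [sgn_mul_self]
    · intro y _ hy; simp [hy.symm]
    · simp
  simp only [this, sum_const, card_univ, nsmul_eq_mul, card_Pt]

/-- In the triple sum over points, summing over `S` forces z = x + y, which turns the cubes into the
bias of the linearity test. -/
theorem sum_walsh_cube (f : BoolFn n) :
    ∑ S, walsh f S ^ 3 = 2 ^ n * ∑ x, ∑ y, sgn (f x) * sgn (f y) * sgn (f (x + y)) := by
  have h : ∀ S, walsh f S ^ 3 = ∑ x, ∑ y, ∑ z,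
      sgn (f x) * sgn (f y) * sgn (f z) * sgn (parity S (x + y + z)) := by
    intro S
    rw [walsh, pow_succ, sq, sum_mul_sum, sum_mul]
    refine sum_congr rfl fun x _ => ?_
    rw [sum_mul]
    refine sum_congr rfl fun y _ => ?_
    rw [mul_sum]
    refine sum_congr rfl fun z _ => ?_
    simp only [parity_add, sgn_add]; ring
  simp only [h]
  rw [sum_comm, mul_sum]
  refine sum_congr rfl fun x _ => ?_
  rw [sum_comm, mul_sum]
  refine sum_congr rfl fun y _ => ?_
  rw [sum_comm]
  simp only [← mul_sum, sum_sgn_parity, Pt.add_eq_zero_iff]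
  rw [sum_eq_single (x + y)]
  · simp; ring
  · intro z _ hz; simp [hz.symm]
  · simp

/-- The linearity test accepts with probability at most one minus the distance to linearity. -/
theorem exists_linDist_le (f : BoolFn n) : ∃ S : Finset (Fin n),
    unifProb (fun p : Pt n × Pt n => f p.1 + f p.2 = f (p.1 + p.2)) ≤ 1 - linDist f S := by
  classical
  -- The largest signed coefficient belongs to the closest parity. Bounding one factor of each cube
  -- by it leaves the squares, which Parseval evaluates.
  obtain ⟨S, -, hS⟩ := exists_max_image (univ : Finset (Finset (Fin n))) (walsh f) univ_nonempty
  refine ⟨S, ?_⟩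
  have h1 : ∑ T, walsh f T ^ 3 ≤ walsh f S * ∑ T, walsh f T ^ 2 := by
    rw [mul_sum]
    refine sum_le_sum fun T hT => ?_
    rw [pow_succ, mul_comm]
    exact mul_le_mul_of_nonneg_right (hS T hT) (sq_nonneg _)
  rw [sum_walsh_cube, sum_walsh_sq, walsh_eq] at h1
  have hp : (0 : ℝ) < 2 ^ n := by positivity
  have h3 : ∀ p : Pt n × Pt n, (if f p.1 + f p.2 = f (p.1 + p.2) then (1 : ℝ) else 0) =
      (1 + sgn (f p.1) * sgn (f p.2) * sgn (f (p.1 + p.2))) / 2 := by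
    intro p
    have h : (1 + 1 : ZMod 2) = 0 := by decide
    rcases ZMod.two_cases (f p.1) with h1 | h1 <;> rcases ZMod.two_cases (f p.2) with h2 | h2 <;>
    rcases ZMod.two_cases (f (p.1 + p.2)) with h3 | h3 <;> norm_num [h1, h2, h3, sgn, h]
  rw [unifProb, sum_congr rfl fun p _ => (by convert h3 p)]
  rw [← sum_div, sum_add_distrib, Fintype.sum_prod_type (f := fun p : Pt n × Pt n =>
    sgn (f p.1) * sgn (f p.2) * sgn (f (p.1 + p.2))), sum_const, card_univ, nsmul_one,
    Fintype.card_prod, Nat.cast_mul, card_Pt]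
  have h4 : ∑ x, ∑ y, sgn (f x) * sgn (f y) * sgn (f (x + y)) ≤
      2 ^ n * (1 - 2 * linDist f S) * 2 ^ n := by
    have : (2 : ℝ) ^ n * ∑ x, ∑ y, sgn (f x) * sgn (f y) * sgn (f (x + y)) ≤
      2 ^ n * (2 ^ n * (1 - 2 * linDist f S) * 2 ^ n) := by linarith
    exact le_of_mul_le_mul_left this hp
  rw [div_le_iff₀ (by positivity), div_le_iff₀ (by positivity)]
  nlinarith

/-- Each value of the self-corrected function is wrong with probability at most `2 δ`. -/
theorem selfCorrect_le (f : BoolFn n) (S : Finset (Fin n)) (w : Pt n) :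
    unifProb (fun z => f (w + z) + f z ≠ parity S w) ≤ 2 * linDist f S := by
  have h1 : unifProb (fun z => f (w + z) ≠ parity S (w + z)) = linDist f S :=
    unifProb_equiv (Equiv.addLeft w) fun x => f x ≠ parity S x
  rw [two_mul]
  nth_rewrite 1 [← h1]
  refine le_trans (unifProb_mono ?_) (unifProb_or_le _ _)
  intro z hz
  by_contra! h
  refine hz ?_
  rw [h.1, h.2, parity_add, add_assoc, CharTwo.add_self_eq_zero, add_zero]

end LinearityTest

/-! ### Probability over a uniform seed and an i.i.d. sample -/

section SampleProb

variable {n t : ℕ}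

theorem measurableSet_Pt (s : Set (Pt n)) : MeasurableSet s := s.toFinite.measurableSet

open Classical in
theorem PMF.toMeasure_real_eq_sum (D : PMF (Pt n)) (p : Pt n → Prop) :
    D.toMeasure.real {x | p x} = ∑ x, (D x).toReal * (if p x then 1 else 0) := by
  rw [Measure.real, D.toMeasure_apply_fintype,
    ENNReal.toReal_sum fun x _ => ?_]
  · refine sum_congr rfl fun x _ => ?_
    by_cases h : p x <;> simp [h]
  · by_cases h : p x <;> simp [h, D.apply_ne_top]

theorem PMF.sum_toReal (D : PMF (Pt n)) : ∑ x, (D x).toReal = 1 := by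
  rw [← ENNReal.toReal_sum fun x _ => D.apply_ne_top x, ← tsum_fintype (L := .unconditional _),
    D.tsum_coe, ENNReal.toReal_one]

theorem sum_prod_sample (D : PMF (Pt n)) (g : Fin t → Pt n → ℝ) :
    ∑ xs : Fin t → Pt n, ∏ i, ((D (xs i)).toReal * g i (xs i)) =
      ∏ i, ∑ x, (D x).toReal * g i x := by
  rw [Finset.prod_univ_sum, Fintype.piFinset_univ]

theorem sum_prod_sample_one (D : PMF (Pt n)) :
    ∑ xs : Fin t → Pt n, ∏ i, (D (xs i)).toReal = 1 := by
  have := sum_prod_sample (t := t) D (fun _ _ => 1)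
  simpa [PMF.sum_toReal] using this

variable {σ τ : Type*} [Fintype σ] [Fintype τ]

open Classical in
/-- The probability of `A` over a uniform seed and an i.i.d. sample. -/
noncomputable def sampleProb (D : PMF (Pt n)) (A : σ → (Fin t → Pt n) → Prop) : ℝ :=
  ∑ s : σ, ∑ xs : Fin t → Pt n,
    (1 / (Fintype.card σ : ℝ)) * (∏ i, (D (xs i)).toReal) * (if A s xs then 1 else 0)

theorem sampleProb_equiv (D : PMF (Pt n)) (e : σ ≃ τ) (A : τ → (Fin t → Pt n) → Prop) :
    sampleProb D (fun s xs => A (e s) xs) = sampleProb D A := by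
  classical
  rw [sampleProb, sampleProb, Fintype.card_congr e, ← e.sum_comp]

theorem sampleProb_not [Nonempty σ] (D : PMF (Pt n)) (A : σ → (Fin t → Pt n) → Prop) :
    sampleProb D (fun s xs => ¬ A s xs) = 1 - sampleProb D A := by
  classical
  have hc : (Fintype.card σ : ℝ) ≠ 0 := by simp
  rw [eq_sub_iff_add_eq, sampleProb, sampleProb, ← sum_add_distrib]
  have : ∀ s : σ, (∑ xs : Fin t → Pt n, (1 / (Fintype.card σ : ℝ)) * (∏ i, (D (xs i)).toReal) *
      (if ¬ A s xs then (1 : ℝ) else 0)) + (∑ xs : Fin t → Pt n, (1 / (Fintype.card σ : ℝ)) *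
      (∏ i, (D (xs i)).toReal) * (if A s xs then 1 else 0)) = 1 / (Fintype.card σ : ℝ) := by
    intro s
    rw [← sum_add_distrib]
    have h : ∀ xs : Fin t → Pt n, (1 / (Fintype.card σ : ℝ)) * (∏ i, (D (xs i)).toReal) *
      (if ¬ A s xs then (1 : ℝ) else 0) + (1 / (Fintype.card σ : ℝ)) *
      (∏ i, (D (xs i)).toReal) * (if A s xs then 1 else 0) =
      (1 / (Fintype.card σ : ℝ)) * (∏ i, (D (xs i)).toReal) := by
      intro xs; by_cases h : A s xs <;> simp [h]
    rw [sum_congr rfl fun xs _ => h xs, ← mul_sum, sum_prod_sample_one, mul_one]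
  rw [sum_congr rfl fun s _ => (by convert this s), sum_const, card_univ, nsmul_eq_mul]
  field_simp

/-- Independent components of the seed multiply; applied twice, this makes the acceptance
probability of the scheme a product of three factors. -/
theorem sampleProb_and_seed (D : PMF (Pt n)) (p : σ → Prop) (A : τ → (Fin t → Pt n) → Prop) :
    sampleProb D (fun (s : σ × τ) xs => p s.1 ∧ A s.2 xs) = unifProb p * sampleProb D A := by
  classical
  unfold sampleProb unifProb
  rw [Fintype.sum_prod_type, sum_div, sum_mul]
  refine sum_congr rfl fun s _ => ?_
  rw [mul_sum]
  refine sum_congr rfl fun s' _ => ?_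
  rw [mul_sum]
  refine sum_congr rfl fun xs _ => ?_
  rw [Fintype.card_prod, Nat.cast_mul]
  by_cases h : p s <;> by_cases h' : A s' xs <;> (simp [h, h']; try field_simp)

theorem sampleProb_nonneg (D : PMF (Pt n)) (A : σ → (Fin t → Pt n) → Prop) :
    0 ≤ sampleProb D A := by
  unfold sampleProb
  refine sum_nonneg fun s _ => sum_nonneg fun xs _ => ?_
  have : 0 ≤ ∏ i, (D (xs i)).toReal := prod_nonneg fun _ _ => ENNReal.toReal_nonneg
  split_ifs
  · positivity
  · simp

theorem sampleProb_le_one (D : PMF (Pt n)) (A : σ → (Fin t → Pt n) → Prop) :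
    sampleProb D A ≤ 1 := by
  rcases isEmpty_or_nonempty σ
  · simp [sampleProb]
  · have := sampleProb_not D A
    have := sampleProb_nonneg D fun s xs => ¬ A s xs
    linarith

/-- The pairs of a shift and a sample point are independent and identically distributed, so the
probability is the power of that of a single pair. -/
theorem sampleProb_forall (D : PMF (Pt n)) (A : Pt n → Pt n → Prop) :
    sampleProb D (fun (z : Fin t → Pt n) xs => ∀ i, A (z i) (xs i)) =
      (∑ x, (D x).toReal * unifProb fun z => A z x) ^ t := by
  classical
  have h : ∀ xs : Fin t → Pt n, unifProb (fun z : Fin t → Pt n => ∀ i, A (z i) (xs i)) =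
      ∏ i, unifProb fun z => A z (xs i) := fun xs => unifProb_pi fun i z => A z (xs i)
  rw [sampleProb, sum_comm]
  have h2 : ∀ xs : Fin t → Pt n, ∑ z : Fin t → Pt n, (1 / (Fintype.card (Fin t → Pt n) : ℝ)) *
      (∏ i, (D (xs i)).toReal) * (if ∀ i, A (z i) (xs i) then 1 else 0) =
      ∏ i, ((D (xs i)).toReal * unifProb fun z => A z (xs i)) := by
    intro xs
    rw [prod_mul_distrib, ← h, ← mul_sum, unifProb]
    ring_nf
  rw [sum_congr rfl fun xs _ => (by convert h2 xs), sum_prod_sample D fun _ x => unifProb fun z => A z x]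
  simp

end SampleProb

/-! ### Soundness of the common scheme -/

section CoreTester

variable {n m t k : ℕ} {Ω Q : Type*} [Fintype Ω] [Fintype Q] [DecidableEq Q]

/-- The common scheme of the testers: linearity test, a test of `k`-linearity that asks for
values of the self-corrected function, consistency test on the sample. -/
def SchemeAccepts (w : Ω → Q → Pt n) (V : Ω → (Q → ZMod 2) → Prop) (f : BoolFn n)
    (s : (Fin m → Pt n × Pt n) × (Ω × (Q → Pt n)) × (Fin t → Pt n)) (xs : Fin t → Pt n) : Prop :=
  (∀ i, f (s.1 i).1 + f (s.1 i).2 = f ((s.1 i).1 + (s.1 i).2)) ∧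
  V s.2.1.1 (fun q => f (w s.2.1.1 q + s.2.1.2 q) + f (s.2.1.2 q)) ∧
  (∀ i, f (xs i) = f (xs i + s.2.2 i) + f (s.2.2 i))

theorem one_sub_pow_le_exp {x : ℝ} (hx : x ≤ 1) (r : ℕ) : (1 - x) ^ r ≤ Real.exp (-(x * r)) := by
  have h : 1 - x ≤ Real.exp (-x) := by linarith [Real.add_one_le_exp (-x)]
  calc (1 - x) ^ r ≤ Real.exp (-x) ^ r := by gcongr
    _ = _ := by rw [← Real.exp_nat_mul]; ring_nf

/-- The threshold 5/3 is the exponent 2 · 5/6 reached by the consistency test; the linearity test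
reaches 2. -/
theorem exp_neg_le_third {x : ℝ} (hx : 5 / 3 ≤ x) : Real.exp (-x) ≤ 1 / 3 := by
  have h : (3 : ℝ) ≤ Real.exp x := by
    have := Real.quadratic_le_exp_of_nonneg (show 0 ≤ x by linarith)
    nlinarith
  rw [Real.exp_neg, ← one_div]
  exact one_div_le_one_div_of_le (by norm_num) h

theorem linDist_nonneg (f : BoolFn n) (S : Finset (Fin n)) : 0 ≤ linDist f S := unifProb_nonneg _

theorem linDist_le_one (f : BoolFn n) (S : Finset (Fin n)) : linDist f S ≤ 1 := unifProb_le_one _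

/-- The points are fixed by the choice in `Ω` and the shifts are independent of it. Hence, when `V`
refuses the exact parities, acceptance needs one wrong self-corrected value, and a union bound over
`Q` applies. -/
theorem unifProb_selfCorrected_le (w : Ω → Q → Pt n) (V : Ω → (Q → ZMod 2) → Prop) (f : BoolFn n)
    (S : Finset (Fin n)) :
    unifProb (fun s : Ω × (Q → Pt n) => V s.1 (fun q => f (w s.1 q + s.2 q) + f (s.2 q))) ≤
      unifProb (fun o => V o (fun q => parity S (w o q))) + Fintype.card Q * (2 * linDist f S) := by
  classical
  have h0 := linDist_nonneg f S
  refine unifProb_prod_le (by positivity) fun o ho => ?_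
  refine (unifProb_mono (q := fun z : Q → Pt n => ∃ q ∈ univ, f (w o q + z q) + f (z q) ≠
    parity S (w o q)) fun z hz => ?_).trans ((unifProb_exists_le univ _).trans ?_)
  · by_contra! h
    exact ho (by simpa [h] using hz)
  · rw [← nsmul_eq_mul, ← card_univ, ← sum_const]
    refine sum_le_sum fun q _ => ?_
    rw [unifProb_eval q fun z => f (w o q + z) + f z ≠ parity S (w o q)]
    exact selfCorrect_le f S _

/-- Where `f` differs from the parity, it can agree with its self-correction only if the latter is
wrong; elsewhere the trivial bound 1 is enough. -/
theorem sum_consistent_le (D : PMF (Pt n)) (f : BoolFn n) (S : Finset (Fin n)) :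
    ∑ x, (D x).toReal * unifProb (fun z => f x = f (x + z) + f z) ≤
      1 - D.toMeasure.real {x | f x ≠ parity S x} * (1 - 2 * linDist f S) := by
  classical
  rw [PMF.toMeasure_real_eq_sum, sum_mul]
  refine le_of_le_of_eq ?_ (congrArg (· - _) D.sum_toReal)
  rw [← sum_sub_distrib]
  refine sum_le_sum fun x _ => ?_
  have hD : 0 ≤ (D x).toReal := ENNReal.toReal_nonneg
  by_cases h : f x = parity S x
  · simpa [h] using mul_le_mul_of_nonneg_left (unifProb_le_one _) hD
  · have : unifProb (fun z => f x = f (x + z) + f z) ≤ 2 * linDist f S :=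
      (unifProb_mono fun z hz h' => h (Eq.trans hz h')).trans (selfCorrect_le f S x)
    have := mul_le_mul_of_nonneg_left this hD
    simp only [ne_eq, h, not_false_eq_true, if_true]
    linarith

/-- The middle stage enters only through `hV`, its soundness on exact parities, so the lemma serves
both Test-Linear* and the machine. -/
theorem sampleProb_schemeAccepts_le (w : Ω → Q → Pt n) (V : Ω → (Q → ZMod 2) → Prop)
    (hV : ∀ S : Finset (Fin n), k < S.card →
      unifProb (fun o => V o (fun q => parity S (w o q))) ≤ 1 / 6)
    (hQ : 1 ≤ Fintype.card Q) (hm : 24 * Fintype.card Q ≤ m) {ε : ℝ} (hε : 0 < ε)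
    (ht : 2 ≤ ε * t) (D : PMF (Pt n)) (f : BoolFn n) (hf : IsFarFrom D ε f (kLinearStar n k)) :
    sampleProb D (SchemeAccepts (m := m) (t := t) w V f) ≤ 1 / 3 := by
  classical
  obtain ⟨S, hS⟩ := exists_linDist_le f
  have hd0 := linDist_nonneg f S
  have hd1 := linDist_le_one f S
  have hq : (1 : ℝ) ≤ Fintype.card Q := by exact_mod_cast hQ
  have hm' : (24 : ℝ) * Fintype.card Q ≤ m := by exact_mod_cast hm
  have hprod : sampleProb D (SchemeAccepts (m := m) (t := t) w V f) =
      unifProb (fun s : Fin m → Pt n × Pt n => ∀ i, f (s i).1 + f (s i).2 = f ((s i).1 + (s i).2)) *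
      (unifProb (fun s : Ω × (Q → Pt n) => V s.1 (fun q => f (w s.1 q + s.2 q) + f (s.2 q))) *
      sampleProb D (fun (z : Fin t → Pt n) xs => ∀ i, f (xs i) = f (xs i + z i) + f (z i))) := by
    rw [← sampleProb_and_seed, ← sampleProb_and_seed]; rfl
  rw [hprod]
  set p₁ := unifProb (fun s : Fin m → Pt n × Pt n =>
    ∀ i, f (s i).1 + f (s i).2 = f ((s i).1 + (s i).2))
  set p₂ := unifProb (fun s : Ω × (Q → Pt n) => V s.1 (fun q => f (w s.1 q + s.2 q) + f (s.2 q)))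
  set p₃ := sampleProb D (fun (z : Fin t → Pt n) xs => ∀ i, f (xs i) = f (xs i + z i) + f (z i))
  have a₁ : 0 ≤ p₁ := unifProb_nonneg _
  have a₂ : 0 ≤ p₂ := unifProb_nonneg _
  have a₃ : 0 ≤ p₃ := sampleProb_nonneg _ _
  have b₁ : p₁ ≤ 1 := unifProb_le_one _
  have b₂ : p₂ ≤ 1 := unifProb_le_one _
  have b₃ : p₃ ≤ 1 := sampleProb_le_one _ _
  -- In each case one of the three factors is at most 1/3. At large distance the linearity test has
  -- exponent 24q/(12q) = 2; for a close parity on more than k coordinates the second factor is at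
  -- most 1/6 + q · 2/(12q); for a close parity in the class the consistency test has exponent 2 ·
  -- 5/6.
  rcases lt_or_ge (1 / (12 * Fintype.card Q : ℝ)) (linDist f S) with hd | hd
  · have : p₁ ≤ 1 / 3 := by
      have e : p₁ = unifProb (fun p : Pt n × Pt n => f p.1 + f p.2 = f (p.1 + p.2)) ^ m := by
        simpa using unifProb_pi_const (ι := Fin m)
          (fun p : Pt n × Pt n => f p.1 + f p.2 = f (p.1 + p.2))
      rw [e]
      refine (pow_le_pow_left₀ (unifProb_nonneg _) hS m).trans
        ((one_sub_pow_le_exp hd1 m).trans (exp_neg_le_third ?_))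
      rw [div_lt_iff₀ (by positivity)] at hd
      nlinarith
    have : p₂ * p₃ ≤ 1 := mul_le_one₀ b₂ a₃ b₃
    nlinarith [mul_nonneg a₂ a₃]
  · rw [le_div_iff₀ (by positivity)] at hd
    rcases lt_or_ge k S.card with hk | hk
    · have : p₂ ≤ 1 / 3 := by
        refine (unifProb_selfCorrected_le w V f S).trans ?_
        have := hV S hk
        linarith
      nlinarith [mul_nonneg a₂ a₃]
    · have : p₃ ≤ 1 / 3 := by
        have e : p₃ = _ := sampleProb_forall D fun z x => f x = f (x + z) + f z
        have hfar : ε ≤ D.toMeasure.real {x | f x ≠ parity S x} := hf _ (parity_mem_kLinearStar hk)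
        have h1 : D.toMeasure.real {x | f x ≠ parity S x} ≤ 1 := measureReal_le_one
        have h12 : linDist f S ≤ 1 / 12 := by nlinarith
        have h3 : ∑ x, (D x).toReal * unifProb (fun z => f x = f (x + z) + f z) ≤
            1 - 5 / 6 * ε := by
          refine (sum_consistent_le D f S).trans ?_
          nlinarith
        rw [e]
        have h0 : 0 ≤ ∑ x, (D x).toReal * unifProb (fun z => f x = f (x + z) + f z) :=
          sum_nonneg fun x _ => mul_nonneg ENNReal.toReal_nonneg (unifProb_nonneg _)
        refine (pow_le_pow_left₀ h0 h3 t).trans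
          ((one_sub_pow_le_exp (by linarith) t).trans (exp_neg_le_third ?_))
        linarith
      have : p₁ * p₂ ≤ 1 := mul_le_one₀ b₁ a₂ b₂
      nlinarith [mul_nonneg a₁ a₂]

theorem NonAdaptiveTester.rejectProb_eq (T : NonAdaptiveTester n) [Nonempty T.Seed] (D : PMF (Pt n))
    (f : BoolFn n) : T.rejectProb D f = 1 - sampleProb D (T.Accepts f) := by
  classical
  rw [← sampleProb_not, rejectProb, sampleProb]
  refine sum_congr rfl fun s _ => sum_congr rfl fun xs _ => ?_
  by_cases h : T.Accepts f s xs <;> simp [h]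

end CoreTester

/-! ### Symmetric differences and identified coordinates -/

section Parity

variable {n : ℕ}

theorem unifProb_pi_finset {ι α : Type*} [Fintype ι] [DecidableEq ι] [Fintype α] [Nonempty α]
    (U : Finset ι) (p : ι → α → Prop) :
    unifProb (fun x : ι → α => ∀ i ∈ U, p i (x i)) = ∏ i ∈ U, unifProb (p i) := by
  have h := unifProb_pi (α := α) (fun i : ι => fun a => i ∈ U → p i a)
  rw [h, ← prod_subset (subset_univ U)]
  · refine prod_congr rfl fun i hi => ?_
    simp [hi]
  · intro i _ hi
    simp [hi, unifProb]

theorem unifProb_eq_const {α : Type*} [Fintype α] (a : α) :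
    unifProb (fun x : α => x = a) = 1 / Fintype.card α := by
  classical
  simp [unifProb]

theorem parity_symmDiff (S T : Finset (Fin n)) (x : Pt n) :
    parity (symmDiff S T) x = parity S x + parity T x := by
  classical
  have h1 := sum_sdiff (inter_subset_left (s₁ := S) (s₂ := T)) (f := x)
  have h2 := sum_sdiff (inter_subset_right (s₁ := S) (s₂ := T)) (f := x)
  have h3 : ∑ i ∈ symmDiff S T, x i = ∑ i ∈ S \ (S ∩ T), x i + ∑ i ∈ T \ (S ∩ T), x i := by
    rw [← sum_union]
    · refine sum_congr ?_ fun _ _ => rfl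
      ext i; simp only [mem_symmDiff, mem_union, mem_sdiff, mem_inter]; tauto
    · rw [disjoint_left]
      intro i; simp only [mem_sdiff, mem_inter]; tauto
  unfold parity
  rw [h3, ← h1, ← h2]
  have : ∀ a b c : ZMod 2, a + b = a + c + (b + c) := by decide
  exact this _ _ _

theorem card_symmDiff_le (S T : Finset (Fin n)) : (symmDiff S T).card ≤ S.card + T.card := by
  classical
  refine (card_le_card (t := S ∪ T) fun i => ?_).trans (card_union_le _ _)
  simp only [mem_symmDiff, mem_union]; tauto

theorem parity_injective {S T : Finset (Fin n)} (h : parity S = parity T) : S = T := by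
  classical
  ext i
  have := congrFun h (Pi.single i 1)
  simp only [parity, Pi.single_apply, sum_ite_eq'] at this
  by_cases h1 : i ∈ S <;> by_cases h2 : i ∈ T <;> simp_all

theorem mem_kLinearStar_iff {k : ℕ} {f : BoolFn n} :
    f ∈ kLinearStar n k ↔ ∃ S : Finset (Fin n), S.card ≤ k ∧ f = parity S :=
  ⟨fun ⟨S, h, h'⟩ => ⟨S, h, funext h'⟩, fun ⟨S, h, h'⟩ => ⟨S, h, fun x => by rw [h']; rfl⟩⟩

/-- Identifying coordinates turns a sum of at most `k` coordinates into one of the same kind. -/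
theorem exists_parity_comp {r : ℕ} (S : Finset (Fin n)) (h : Fin n → Fin r) :
    ∃ T : Finset (Fin r), T.card ≤ S.card ∧ ∀ y : Pt r, parity S (fun v => y (h v)) = parity T y := by
  classical
  induction S using Finset.induction_on with
  | empty => exact ⟨∅, le_rfl, fun y => by simp [parity]⟩
  | insert v S hv ih =>
    obtain ⟨T, hT, hy⟩ := ih
    refine ⟨symmDiff T {h v}, ?_, fun y => ?_⟩
    · rw [card_insert_of_notMem hv]
      refine (card_symmDiff_le _ _).trans ?_
      simpa using hT
    · rw [parity_symmDiff, ← hy, parity, sum_insert hv, add_comm]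
      simp [parity]

end Parity

/-! ### Existence of a non-adaptive exact learner -/

section Learning

/-- Each binomial coefficient is at most the corresponding term of the binomial expansion of (N +
1)^r. -/
theorem card_filter_card_le (N r : ℕ) :
    ((univ : Finset (Finset (Fin N))).filter fun U => U.card ≤ r).card ≤ (N + 1) ^ r := by
  classical
  have h : ((univ : Finset (Finset (Fin N))).filter fun U => U.card ≤ r) ⊆
      (range (r + 1)).biUnion fun i => powersetCard i univ := by
    intro U hU
    simp only [mem_filter, mem_univ, true_and] at hU
    simp only [mem_biUnion, mem_range, mem_powersetCard, subset_univ, true_and]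
    exact ⟨U.card, by omega, rfl⟩
  refine (card_le_card h).trans (card_biUnion_le.trans ?_)
  rw [add_pow]
  refine sum_le_sum fun i hi => ?_
  have hi' : i ≤ r := by simpa [Nat.lt_succ_iff] using hi
  rw [card_powersetCard, card_univ, Fintype.card_fin, one_pow, mul_one]
  exact (Nat.choose_le_pow N i).trans (Nat.le_mul_of_pos_right _ (Nat.choose_pos hi'))

/-- Few points suffice to separate the sums of at most `K` coordinates. -/
theorem exists_separating_points (N r m : ℕ) (hm : (N + 1) ^ r < 2 ^ m) :
    ∃ q : Fin m → Pt N, ∀ U : Finset (Fin N), U.Nonempty → U.card ≤ r →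
      ∃ j, parity U (q j) ≠ 0 := by
  classical
  -- Probabilistic method: were every choice of points bad, the union bound would give 1 ≤ (number
  -- of sets) / 2^m.
  by_contra! hcon
  set s := (univ : Finset (Finset (Fin N))).filter fun U => U.card ≤ r with hs
  have h1 : unifProb (fun q : Fin m → Pt N => ∃ U ∈ s, U.Nonempty ∧ ∀ j, parity U (q j) = 0) = 1 := by
    have : ∀ q : Fin m → Pt N, (∃ U ∈ s, U.Nonempty ∧ ∀ j, parity U (q j) = 0) ↔ True := fun q => by
      obtain ⟨U, a, b, c⟩ := hcon q
      simp only [iff_true]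
      exact ⟨U, by simp [hs, b], a, c⟩
    simp [this, unifProb]
  have h2 := unifProb_exists_le s fun U (q : Fin m → Pt N) => U.Nonempty ∧ ∀ j, parity U (q j) = 0
  rw [h1] at h2
  have h3 : ∀ U ∈ s, unifProb (fun q : Fin m → Pt N => U.Nonempty ∧ ∀ j, parity U (q j) = 0) ≤
      (1 / 2) ^ m := by
    intro U _
    rcases U.eq_empty_or_nonempty with rfl | hU
    · simp [unifProb]
    · simp only [hU, true_and]
      rw [unifProb_pi_const fun x : Pt N => parity U x = 0, parity_eq_half hU, Fintype.card_fin]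
  have h4 := h2.trans (sum_le_sum h3)
  rw [sum_const, nsmul_eq_mul, one_div, inv_pow, ← div_eq_mul_inv, le_div_iff₀ (by positivity),
    one_mul] at h4
  have h5 : 2 ^ m ≤ s.card := by exact_mod_cast h4
  have h6 : s.card ≤ (N + 1) ^ r := card_filter_card_le N r
  omega

-- Two sums of at most `K` coordinates differ by a sum over at most `2K` coordinates, so points that
-- detect every nonempty such sum determine the function. The output is found by choice among the
-- consistent members; no efficiency is claimed.
open Classical in
theorem exists_learner (N K : ℕ) (hN : 2 ≤ N) (hK : 1 ≤ K) :
    ∃ L : Learner N, L.ExactlyLearns (kLinearStar N K) ∧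
      (Fintype.card L.Q : ℝ) ≤ 5 * K * Real.logb 2 N := by
  set c := Nat.clog 2 (N + 1) with hc
  have hc1 : N + 1 ≤ 2 ^ c := Nat.le_pow_clog (by norm_num) _
  have hc2 : 2 ^ (c - 1) ≤ N := Nat.lt_succ_iff.1 (Nat.pow_pred_clog_lt_self (by norm_num) (by omega))
  -- One point beyond `2Kc` makes the inequality strict.
  have hlt : (N + 1) ^ (2 * K) < 2 ^ (2 * K * c + 1) := by
    calc (N + 1) ^ (2 * K) ≤ (2 ^ c) ^ (2 * K) := by gcongr
      _ = 2 ^ (2 * K * c) := by rw [← pow_mul, mul_comm]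
      _ < _ := by gcongr <;> norm_num
  obtain ⟨q, hq⟩ := exists_separating_points N (2 * K) (2 * K * c + 1) hlt
  let L : Learner N := {
    Q := Fin (2 * K * c + 1)
    query := q
    output := fun a => if h : ∃ F ∈ kLinearStar N K, ∀ j, F (q j) = a j then h.choose else 0 }
  refine ⟨L, fun F hF => ?_, ?_⟩
  · have hex : ∃ G ∈ kLinearStar N K, ∀ j, G (q j) = F (q j) := ⟨F, hF, fun _ => rfl⟩
    have hout : L.output (fun j => F (L.query j)) = hex.choose := dif_pos hex
    obtain ⟨hG, hj⟩ := hex.choose_spec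
    rw [hout]
    generalize hex.choose = G at hG hj
    obtain ⟨S, hS, rfl⟩ := mem_kLinearStar_iff.1 hF
    obtain ⟨T, hT, rfl⟩ := mem_kLinearStar_iff.1 hG
    by_contra hne
    have hU : (symmDiff T S).Nonempty := by
      rw [nonempty_iff_ne_empty, ← bot_eq_empty, Ne, symmDiff_eq_bot]
      rintro rfl; exact hne rfl
    obtain ⟨j, hj'⟩ := hq _ hU ((card_symmDiff_le _ _).trans (by omega))
    rw [parity_symmDiff, hj j, CharTwo.add_self_eq_zero] at hj'
    exact hj' rfl
  · have h1 : Fintype.card L.Q = 2 * K * c + 1 := Fintype.card_fin _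
    rw [h1]
    have hN1 : (1 : ℝ) ≤ Real.logb 2 N := by
      rw [Real.le_logb_iff_rpow_le (by norm_num) (by positivity)]
      simpa using (by exact_mod_cast hN : (2 : ℝ) ≤ N)
    have hc3 : ((c - 1 : ℕ) : ℝ) ≤ Real.logb 2 N := by
      rw [Real.le_logb_iff_rpow_le (by norm_num) (by positivity), Real.rpow_natCast]
      exact_mod_cast hc2
    have hc4 : (c : ℝ) ≤ ((c - 1 : ℕ) : ℝ) + 1 := by
      exact_mod_cast (by omega : c ≤ c - 1 + 1)
    -- Since log₂ N ≥ 1, rounding up at most doubles it; the remaining +1 is paid for by a further K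
    -- log₂ N, hence the constant 5.
    have hc5 : (c : ℝ) ≤ 2 * Real.logb 2 N := by linarith
    have hK' : (1 : ℝ) ≤ K := by exact_mod_cast hK
    push_cast
    nlinarith [mul_le_mul_of_nonneg_left hc5 (by linarith : (0 : ℝ) ≤ 2 * K)]

end Learning

/-! ### Random partitions: second moment and birthday bounds -/

section Partition

variable {n M : ℕ}

/-- The point that agrees with `z` on part `i` and vanishes elsewhere. -/
def restrictPart (h : Fin n → Fin M) (z : Pt n) (i : Fin M) : Pt n :=
  fun v => if h v = i then z v else 0

/-- The sign is a product of factors each depending on one coordinate only, so sums over partitions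
and points factor by `sum_partition_prod`. -/
theorem sgn_parity_restrictPart (S : Finset (Fin n)) (h : Fin n → Fin M) (z : Pt n) (i : Fin M) :
    sgn (parity S (restrictPart h z i)) =
      ∏ v, if v ∈ S ∧ h v = i then sgn (z v) else 1 := by
  classical
  rw [parity, sgn_sum, ← prod_subset (subset_univ S)]
  · refine prod_congr rfl fun v hv => ?_
    by_cases hi : h v = i <;> simp [restrictPart, hi, hv, sgn]
  · intro v _ hv; simp [hv]

theorem sum_partition_prod (g : Fin n → Fin M → ZMod 2 → ℝ) :
    ∑ h : Fin n → Fin M, ∑ z : Pt n, ∏ v, g v (h v) (z v) = ∏ v, ∑ c, ∑ b, g v c b := by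
  rw [Finset.prod_univ_sum, Fintype.piFinset_univ]
  refine sum_congr rfl fun h _ => ?_
  rw [Finset.prod_univ_sum, Fintype.piFinset_univ]

theorem sum_sgn : ∑ b : ZMod 2, sgn b = 0 := by
  have : (univ : Finset (ZMod 2)) = {0, 1} := rfl
  rw [this]; simp [sgn]

theorem prod_ite_mem_const (S : Finset (Fin n)) (a b : ℝ) (f : Fin n → ℝ)
    (hf : ∀ v, f v = if v ∈ S then b * a else a) : ∏ v, f v = a ^ n * b ^ S.card := by
  classical
  have : ∀ v, f v = a * if v ∈ S then b else 1 := fun v => by rw [hf]; split_ifs <;> ring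
  simp only [this, prod_mul_distrib, prod_const, card_univ, Fintype.card_fin]
  rw [prod_ite_mem, univ_inter, prod_const]

/-- A coordinate of `S` falls into part `i` with probability 1/M, and then its average sign is zero;
otherwise its factor is 1. -/
theorem sum_part_sign (hM : 0 < M) (S : Finset (Fin n)) (i : Fin M) :
    ∑ h : Fin n → Fin M, ∑ z : Pt n, sgn (parity S (restrictPart h z i)) =
      ((M : ℝ) * 2) ^ n * (1 - 1 / M) ^ S.card := by
  classical
  simp only [sgn_parity_restrictPart]
  rw [sum_partition_prod fun v c b => if v ∈ S ∧ c = i then sgn b else 1]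
  refine prod_ite_mem_const S _ _ _ fun v => ?_
  have hM' : (M : ℝ) ≠ 0 := by positivity
  by_cases hv : v ∈ S
  · have : ∀ c : Fin M, ∑ b : ZMod 2, (if v ∈ S ∧ c = i then sgn b else 1) =
        2 - if c = i then (2 : ℝ) else 0 := by
      intro c; by_cases hc : c = i <;> simp [hv, hc, sum_sgn]
    refine (sum_congr rfl fun c _ => this c).trans ?_
    simp only [sum_sub_distrib, sum_ite_eq', mem_univ, if_true, hv]
    simp
    field_simp
  · simp [hv]

/-- As for one part, but now a coordinate of `S` is averaged out when it falls into either of two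
distinct parts. -/
theorem sum_part_sign_mul (hM : 0 < M) (S : Finset (Fin n)) {i j : Fin M} (hij : i ≠ j) :
    ∑ h : Fin n → Fin M, ∑ z : Pt n,
      sgn (parity S (restrictPart h z i)) * sgn (parity S (restrictPart h z j)) =
      ((M : ℝ) * 2) ^ n * (1 - 2 / M) ^ S.card := by
  classical
  simp only [sgn_parity_restrictPart, ← prod_mul_distrib]
  rw [sum_partition_prod fun v c b => (if v ∈ S ∧ c = i then sgn b else 1) *
    (if v ∈ S ∧ c = j then sgn b else 1)]
  refine prod_ite_mem_const S _ _ _ fun v => ?_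
  have hM' : (M : ℝ) ≠ 0 := by positivity
  by_cases hv : v ∈ S
  · have : ∀ c : Fin M, ∑ b : ZMod 2, ((if v ∈ S ∧ c = i then sgn b else 1) *
        (if v ∈ S ∧ c = j then sgn b else 1)) =
        2 - (if c = i then (2 : ℝ) else 0) - (if c = j then (2 : ℝ) else 0) := by
      intro c
      by_cases hc : c = i
      · subst hc; simp [hv, hij, sum_sgn]
      · by_cases hc' : c = j
        · subst hc'; simp [hv, hc, sum_sgn]
        · simp [hc, hc']
    refine (sum_congr rfl fun c _ => this c).trans ?_
    simp only [sum_sub_distrib, sum_ite_eq', mem_univ, if_true, hv]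
    simp
    field_simp
    ring
  · simp [hv]

/-- The variance of the sum of the signs of the parts is at most the number of parts. -/
theorem sum_sq_part_sign_le (hM : 2 ≤ M) (S : Finset (Fin n)) :
    ∑ h : Fin n → Fin M, ∑ z : Pt n,
      ((∑ i, sgn (parity S (restrictPart h z i))) - M * (1 - 1 / M) ^ S.card) ^ 2 ≤
      ((M : ℝ) * 2) ^ n * M := by
  classical
  set p : ℝ := (1 - 1 / M) ^ S.card with hp
  set T : ℝ := ((M : ℝ) * 2) ^ n with hT
  have hM0 : 0 < M := by omega
  have hT0 : 0 ≤ T := by positivity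
  have hM2 : (2 : ℝ) ≤ M := by exact_mod_cast hM
  have hsq : ∀ (h : Fin n → Fin M) (z : Pt n),
      ((∑ i, sgn (parity S (restrictPart h z i))) - M * p) ^ 2 =
      (∑ i, ∑ j, sgn (parity S (restrictPart h z i)) * sgn (parity S (restrictPart h z j))) -
      2 * M * p * (∑ i, sgn (parity S (restrictPart h z i))) + (M * p) ^ 2 := by
    intro h z
    rw [← sum_mul_sum]; ring
  have e1 : ∑ h : Fin n → Fin M, ∑ z : Pt n, ∑ i, sgn (parity S (restrictPart h z i)) =
      M * (T * p) := by
    rw [sum_congr rfl fun h _ => sum_comm, sum_comm, sum_congr rfl fun i _ => sum_part_sign hM0 S i]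
    simp [hT, hp]
  have e2 : ∑ h : Fin n → Fin M, ∑ z : Pt n, ∑ i, ∑ j,
      sgn (parity S (restrictPart h z i)) * sgn (parity S (restrictPart h z j)) ≤
      M * (T + M * (T * p ^ 2)) := by
    rw [sum_congr rfl fun h _ => sum_comm, sum_comm]
    have : ∀ i ∈ (univ : Finset (Fin M)), ∑ h : Fin n → Fin M, ∑ z : Pt n, ∑ j,
        sgn (parity S (restrictPart h z i)) * sgn (parity S (restrictPart h z j)) ≤
        T + M * (T * p ^ 2) := by
      intro i _
      rw [sum_congr rfl fun h _ => sum_comm, sum_comm]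
      have h2 : ∀ j ∈ (univ : Finset (Fin M)), ∑ h : Fin n → Fin M, ∑ z : Pt n,
          sgn (parity S (restrictPart h z i)) * sgn (parity S (restrictPart h z j)) ≤
          (if j = i then T else 0) + T * p ^ 2 := by
        intro j _
        by_cases hij : j = i
        · subst hij
          simp only [sgn_mul_self, if_true]
          have : 0 ≤ T * p ^ 2 := by positivity
          simpa [hT, mul_pow] using this
        -- Different parts are negatively correlated, because 1 - 2/M ≤ (1 - 1/M)²; only the
        -- diagonal contributes to the variance bound.
        · rw [sum_part_sign_mul hM0 S (Ne.symm hij), if_neg hij, zero_add, hp, pow_right_comm]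
          refine mul_le_mul_of_nonneg_left (pow_le_pow_left₀ ?_ ?_ _) hT0
          · rw [sub_nonneg, div_le_one (by linarith)]; exact hM2
          · have : (1 - 1 / (M : ℝ)) ^ 2 = 1 - 2 / M + (1 / M) ^ 2 := by ring
            rw [this]; nlinarith [sq_nonneg (1 / (M : ℝ))]
      refine (sum_le_sum h2).trans ?_
      rw [sum_add_distrib]
      simp
    refine (sum_le_sum this).trans ?_
    rw [sum_const, card_univ, nsmul_eq_mul, Fintype.card_fin]
  have e4 : ∑ h : Fin n → Fin M, ∑ z : Pt n,
      2 * M * p * ∑ i, sgn (parity S (restrictPart h z i)) = 2 * M * p * (M * (T * p)) := by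
    rw [← e1]
    simp only [mul_sum]
  simp only [hsq, sum_add_distrib, sum_sub_distrib]
  rw [e4]
  have e3 : ∑ _h : Fin n → Fin M, ∑ _z : Pt n, ((M : ℝ) * p) ^ 2 = T * (M * p) ^ 2 := by
    simp [hT, mul_pow]
    ring
  rw [e3]
  nlinarith

theorem sum_sgn_eq_card {ι : Type*} [Fintype ι] (a : ι → ZMod 2) :
    ∑ i, sgn (a i) = (Fintype.card ι : ℝ) - 2 * (univ.filter fun i => a i = 1).card := by
  have : ∀ i, sgn (a i) = 1 - 2 * if a i = 1 then 1 else 0 := by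
    intro i
    rcases ZMod.two_cases (a i) with h | h <;> norm_num [h, sgn]
  simp only [this, sum_sub_distrib, ← mul_sum]
  simp

/-- More than half as many coordinates as parts give many parts of odd parity. -/
theorem unifProb_few_odd_parts_le {k : ℕ} (hk : 12 ≤ k) (S : Finset (Fin n)) (hS : 8 * k < S.card) :
    unifProb (fun s : (Fin n → Fin (16 * k)) × Pt n =>
      (univ.filter fun i => parity S (restrictPart s.1 s.2 i) = 1).card ≤ k) ≤ 1 / 6 := by
  classical
  have hk' : (12 : ℝ) ≤ k := by exact_mod_cast hk
  have hS' : 8 * (k : ℝ) ≤ S.card := by exact_mod_cast hS.le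
  have hvar := sum_sq_part_sign_le (M := 16 * k) (by omega) S
  set p : ℝ := (1 - 1 / (16 * k : ℕ)) ^ S.card with hp
  -- At least half as many coordinates as parts give exponent 1/2, and e^(1/2) ≥ 1 + 1/2 + 1/8 =
  -- 13/8.
  have hp1 : p ≤ 8 / 13 := by
    have h1 : p ≤ Real.exp (-(1 / (16 * k : ℕ) * S.card)) := by
      refine one_sub_pow_le_exp ?_ _
      rw [div_le_one (by positivity)]
      push_cast; linarith
    have h2 : (1 / 2 : ℝ) ≤ 1 / (16 * k : ℕ) * S.card := by
      rw [one_div_mul_eq_div, le_div_iff₀ (by positivity)]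
      push_cast; linarith
    have h3 : (13 / 8 : ℝ) ≤ Real.exp (1 / 2) := by
      have := Real.quadratic_le_exp_of_nonneg (show (0 : ℝ) ≤ 1 / 2 by norm_num)
      linarith
    have h4 : p ≤ Real.exp (-(1 / 2)) := h1.trans (Real.exp_le_exp.2 (by linarith))
    rw [Real.exp_neg] at h4
    exact h4.trans (by rw [inv_le_comm₀ (by positivity) (by norm_num)]; linarith)
  have hT : ((Fintype.card ((Fin n → Fin (16 * k)) × Pt n) : ℕ) : ℝ) =
      (((16 * k : ℕ) : ℝ) * 2) ^ n := by
    simp [mul_pow]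
  set T : ℝ := (((16 * k : ℕ) : ℝ) * 2) ^ n with hT'
  have hT0 : 0 < T := by positivity
  rw [unifProb, hT, div_le_iff₀ hT0]
  rw [← Fintype.sum_prod_type' (f := fun (h : Fin n → Fin (16 * k)) (z : Pt n) =>
    ((∑ i, sgn (parity S (restrictPart h z i))) - (16 * k : ℕ) * p) ^ 2)] at hvar
  -- Chebyshev: at most k odd parts make the sum of signs at least 14k, while the mean is at most
  -- 16k · 8/13 < 10k, so the deviation is at least 4k.
  have hpt : ∀ s : (Fin n → Fin (16 * k)) × Pt n,
      (if (univ.filter fun i => parity S (restrictPart s.1 s.2 i) = 1).card ≤ k then (1 : ℝ) else 0) *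
        (4 * k) ^ 2 ≤
      ((∑ i, sgn (parity S (restrictPart s.1 s.2 i))) - (16 * k : ℕ) * p) ^ 2 := by
    intro s
    split_ifs with h
    · rw [sum_sgn_eq_card, Fintype.card_fin]
      have h' : ((univ.filter fun i => parity S (restrictPart s.1 s.2 i) = 1).card : ℝ) ≤ k := by
        exact_mod_cast h
      rw [one_mul]
      refine pow_le_pow_left₀ (by positivity) ?_ 2
      push_cast
      nlinarith
    · simpa using sq_nonneg _
  have h5 := (sum_le_sum fun s _ => hpt s).trans hvar
  rw [← sum_mul] at h5
  push_cast at h5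
  have h0 : 0 ≤ ∑ s : (Fin n → Fin (16 * k)) × Pt n,
      if (univ.filter fun i => parity S (restrictPart s.1 s.2 i) = 1).card ≤ k then (1 : ℝ) else 0 :=
    sum_nonneg fun s _ => by split_ifs <;> norm_num
  suffices h : (∑ s : (Fin n → Fin (16 * k)) × Pt n,
      if (univ.filter fun i => parity S (restrictPart s.1 s.2 i) = 1).card ≤ k
      then (1 : ℝ) else 0) ≤ 1 / 6 * T by
    refine le_of_eq_of_le (sum_congr rfl fun s _ => ?_) h
    congr
  generalize (∑ s : (Fin n → Fin (16 * k)) × Pt n,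
      if (univ.filter fun i => parity S (restrictPart s.1 s.2 i) = 1).card ≤ k
      then (1 : ℝ) else 0) = X at h0 h5 ⊢
  -- The variance bound 16k against (4k)² leaves probability 1/k, which is small enough as k ≥ 12.
  have h7 : X * k ≤ T := by
    refine le_of_mul_le_mul_right (a := (k : ℝ)) ?_ (by linarith)
    linarith
  nlinarith

/-- Birthday bound: at most 32k² pairs, each colliding with probability 1/(256k²), give at most 1/8.
-/
theorem unifProb_not_injOn_le {k : ℕ} (hk : 1 ≤ k) (S : Finset (Fin n)) (hS : S.card ≤ 8 * k) :
    unifProb (fun h : Fin n → Fin (256 * k ^ 2) => ¬ Set.InjOn h S) ≤ 1 / 6 := by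
  classical
  have hr : 0 < 256 * k ^ 2 := by positivity
  have : Nonempty (Fin (256 * k ^ 2)) := ⟨⟨0, hr⟩⟩
  have hk' : (1 : ℝ) ≤ k := by exact_mod_cast hk
  refine (unifProb_mono (q := fun h => ∃ P ∈ powersetCard 2 S, ∃ c ∈ (univ : Finset (Fin (256 * k ^ 2))),
    ∀ v ∈ P, h v = c) ?_).trans ((unifProb_exists_le _ _).trans ?_)
  · intro h hh
    simp only [Set.InjOn, not_forall] at hh
    obtain ⟨u, hu, v, hv, huv, hne⟩ := hh
    exact ⟨{u, v}, mem_powersetCard.2 ⟨by simp [insert_subset_iff, mem_coe.1 hu, mem_coe.1 hv],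
      card_pair hne⟩, h v, mem_univ _, by simp [huv]⟩
  · have : ∀ P ∈ powersetCard 2 S, unifProb (fun h : Fin n → Fin (256 * k ^ 2) =>
        ∃ c ∈ (univ : Finset (Fin (256 * k ^ 2))), ∀ v ∈ P, h v = c) ≤ 1 / (256 * k ^ 2 : ℕ) := by
      intro P hP
      refine (unifProb_exists_le _ _).trans (le_of_eq ?_)
      have h2 : ∀ c : Fin (256 * k ^ 2), unifProb (fun h : Fin n → Fin (256 * k ^ 2) =>
          ∀ v ∈ P, h v = c) = (1 / (256 * k ^ 2 : ℕ)) ^ 2 := by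
        intro c
        rw [unifProb_pi_finset P fun _ x => x = c, prod_const, (mem_powersetCard.1 hP).2,
          unifProb_eq_const, Fintype.card_fin]
      rw [sum_congr rfl fun c _ => h2 c, sum_const, card_univ, Fintype.card_fin, nsmul_eq_mul]
      have : ((256 * k ^ 2 : ℕ) : ℝ) ≠ 0 := by positivity
      field_simp
    refine (sum_le_sum this).trans ?_
    rw [sum_const, card_powersetCard, nsmul_eq_mul, mul_one_div, div_le_iff₀ (by positivity),
      Nat.cast_choose_two]
    have h1 : (S.card : ℝ) ≤ 8 * k := by exact_mod_cast hS
    have h0 : (0 : ℝ) ≤ S.card := by positivity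
    push_cast
    nlinarith

end Partition

/-! ### Completeness, soundness and query count of Test-Linear* -/

section TestLinearStar

variable {n k : ℕ}

/-- Self-correction of a parity is exact for every shift. At most |S| parts meet `S`, and
identifying coordinates does not increase their number, so the learner returns a sum of at most `k`
coordinates. -/
theorem testLinearStar_accepts {c₂ ε : ℝ} (L : Learner (256 * k ^ 2))
    (hL : L.ExactlyLearns (kLinearStar (256 * k ^ 2) (8 * k))) {f : BoolFn n}
    (hf : f ∈ kLinearStar n k) (s : (testLinearStar c₂ n k ε L).Seed)
    (xs : Fin (testLinearStar c₂ n k ε L).numSamples → Pt n) :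
    (testLinearStar c₂ n k ε L).Accepts f s xs := by
  classical
  obtain ⟨S, hS, rfl⟩ := mem_kLinearStar_iff.1 hf
  have hself : ∀ w z : Pt n, parity S (w + z) + parity S z = parity S w := fun w z => by
    rw [parity_add, add_assoc, CharTwo.add_self_eq_zero, add_zero]
  refine ⟨fun i => ?_, ?_, ?_, fun i => ?_⟩
  · exact (parity_add S _ _).symm
  · refine (card_le_card (t := S.image s.2.1.1) fun i hi => ?_).trans (card_image_le.trans hS)
    have hi' : parity S (restrictPart s.2.1.1 s.2.1.2.1 i + s.2.1.2.2 i) + parity S (s.2.1.2.2 i) = 1 :=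
      (mem_filter.1 hi).2
    rw [hself] at hi'
    by_contra hni
    refine one_ne_zero (hi'.symm.trans (sum_eq_zero fun v hv => ?_))
    refine if_neg fun h => hni ?_
    exact h ▸ mem_image_of_mem _ hv
  · obtain ⟨T, hT, hT'⟩ := exists_parity_comp S s.2.2.1.1
    have h1 : (fun q => parity S ((fun v => L.query q (s.2.2.1.1 v)) + s.2.2.1.2 q) +
        parity S (s.2.2.1.2 q)) = fun q => parity T (L.query q) := by
      funext q; rw [hself]; exact hT' _
    have h2 : L.output (fun q => parity S ((fun v => L.query q (s.2.2.1.1 v)) + s.2.2.1.2 q) +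
        parity S (s.2.2.1.2 q)) ∈ kLinearStar (256 * k ^ 2) k := by
      rw [h1, hL _ (parity_mem_kLinearStar (by omega))]
      exact parity_mem_kLinearStar (hT.trans hS)
    exact h2
  · exact (hself _ _).symm

/-- The verdict of the second stage as a function of the values of the self-corrected function. -/
def stageVerdict (L : Learner (256 * k ^ 2)) (a : Fin (16 * k) ⊕ L.Q → ZMod 2) : Prop :=
  (univ.filter fun i => a (.inl i) = 1).card ≤ k ∧
    L.output (fun q => a (.inr q)) ∈ kLinearStar (256 * k ^ 2) k

/-- The points at which the second stage asks for the self-corrected function. -/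
def stagePoints (L : Learner (256 * k ^ 2))
    (o : ((Fin n → Fin (16 * k)) × Pt n) × (Fin n → Fin (256 * k ^ 2))) :
    Fin (16 * k) ⊕ L.Q → Pt n :=
  Sum.elim (restrictPart o.1.1 o.1.2) fun q v => L.query q (o.2 v)

/-- The two checks cover complementary ranges: counting odd parts handles |S| > 8k, and for |S| ≤ 8k
a partition injective on `S` lets the learner reveal a parity on exactly |S| > k parts. -/
theorem unifProb_stageVerdict_le (hk : 12 ≤ k) (L : Learner (256 * k ^ 2))
    (hL : L.ExactlyLearns (kLinearStar (256 * k ^ 2) (8 * k))) (S : Finset (Fin n))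
    (hS : k < S.card) :
    unifProb (fun o => stageVerdict L fun q => parity S (stagePoints (n := n) L o q)) ≤ 1 / 6 := by
  classical
  have : Nonempty (Fin (16 * k)) := ⟨⟨0, by omega⟩⟩
  have : Nonempty (Fin (256 * k ^ 2)) := ⟨⟨0, by positivity⟩⟩
  rcases lt_or_ge (8 * k) S.card with h | h
  · refine le_trans (unifProb_mono ?_) ((unifProb_fst _).trans_le (unifProb_few_odd_parts_le hk S h))
    exact fun o ho => ho.1
  · refine le_trans (unifProb_mono fun o ho => ?_)
      ((unifProb_snd _).trans_le (unifProb_not_injOn_le (by omega) S h))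
    intro hinj
    have h1 : (fun q => parity S (stagePoints (n := n) L o (.inr q))) =
        fun q => parity (S.image o.2) (L.query q) := by
      funext q
      simp only [parity, stagePoints, Sum.elim_inr]
      rw [sum_image hinj]
    have h2 := ho.2
    rw [h1, hL _ (parity_mem_kLinearStar (card_image_le.trans h))] at h2
    obtain ⟨T, hT, hT'⟩ := mem_kLinearStar_iff.1 h2
    have h3 := congrArg card (parity_injective hT')
    rw [card_image_of_injOn hinj] at h3
    omega

/-- Rearrangement of the seed of Test-Linear*. -/
def testSeedEquiv (n k m t : ℕ) (Q : Type) : TestSeed n k m t Q ≃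
    (Fin m → Pt n × Pt n) × ((((Fin n → Fin (16 * k)) × Pt n) × (Fin n → Fin (256 * k ^ 2))) ×
      (Fin (16 * k) ⊕ Q → Pt n)) × (Fin t → Pt n) where
  toFun s := (s.1, (((s.2.1.1, s.2.1.2.1), s.2.2.1.1), Sum.elim s.2.1.2.2 s.2.2.1.2), s.2.2.2)
  invFun s := (s.1, (s.2.1.1.1.1, s.2.1.1.1.2, fun i => s.2.1.2 (.inl i)),
    (s.2.1.1.2, fun q => s.2.1.2 (.inr q)), s.2.2)
  left_inv _ := rfl
  right_inv s := by
    obtain ⟨a, ⟨b, c⟩, d⟩ := s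
    have : Sum.elim (fun i => c (.inl i)) (fun q => c (.inr q)) = c := Sum.elim_comp_inl_inr c
    simp [this]

theorem mul_le_blrRounds {c q : ℝ}
    (hq : q ≤ 16 * k + c * (8 * k) * Real.logb 2 (256 * (k : ℝ) ^ 2)) :
    24 * q ≤ blrRounds c k := by
  have h : 2 / blrDistance c k = 24 * (16 * k + c * (8 * k) * Real.logb 2 (256 * (k : ℝ) ^ 2)) := by
    rw [blrDistance]; simp only [div_div_eq_mul_div, div_one]; ring
  have h2 : 2 / blrDistance c k ≤ blrRounds c k := Nat.le_ceil _
  linarith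

theorem testLinearStar_rejects (hk : 12 ≤ k) {c₂ ε : ℝ} (hε : 0 < ε)
    (L : Learner (256 * k ^ 2))
    (hL : L.ExactlyLearns (kLinearStar (256 * k ^ 2) (8 * k)))
    (hQ : (Fintype.card L.Q : ℝ) ≤ c₂ * (8 * k : ℕ) * Real.logb 2 (256 * k ^ 2 : ℕ))
    (D : PMF (Pt n)) (f : BoolFn n) (hf : IsFarFrom D ε f (kLinearStar n k)) :
    2 / 3 ≤ (testLinearStar c₂ n k ε L).rejectProb D f := by
  classical
  have : Nonempty (Fin (16 * k)) := ⟨⟨0, by omega⟩⟩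
  have : Nonempty (Fin (256 * k ^ 2)) := ⟨⟨0, by positivity⟩⟩
  have : Nonempty (testLinearStar c₂ n k ε L).Seed :=
    inferInstanceAs (Nonempty (TestSeed n k (blrRounds c₂ k) (sampleSize ε) L.Q))
  rw [NonAdaptiveTester.rejectProb_eq]
  have ht : 2 ≤ ε * (sampleSize ε : ℕ) := by
    have h : 4 / ε ≤ sampleSize ε := Nat.le_ceil _
    rw [div_le_iff₀ hε] at h
    linarith
  have hcard : Fintype.card (Fin (16 * k) ⊕ L.Q) = 16 * k + Fintype.card L.Q := by simp
  have hm : 24 * Fintype.card (Fin (16 * k) ⊕ L.Q) ≤ blrRounds c₂ k := by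
    have : 24 * ((16 * k + Fintype.card L.Q : ℕ) : ℝ) ≤ blrRounds c₂ k :=
      mul_le_blrRounds (by push_cast at hQ ⊢; linarith)
    rw [hcard]
    exact_mod_cast this
  have hmain := sampleProb_schemeAccepts_le (m := blrRounds c₂ k) (stagePoints (n := n) L)
    (fun _ => stageVerdict L)
    (unifProb_stageVerdict_le hk L hL) (by rw [hcard]; omega) hm hε ht D f hf
  -- Regrouping the seed turns acceptance into the scheme, with the shifts of both checks of the
  -- second stage merged into one family.
  have heq : sampleProb D ((testLinearStar c₂ n k ε L).Accepts f) =
      sampleProb (t := sampleSize ε) D (fun (s : TestSeed n k (blrRounds c₂ k) (sampleSize ε) L.Q) xs =>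
        SchemeAccepts (stagePoints (n := n) L) (fun _ => stageVerdict L) f
          (testSeedEquiv n k _ _ L.Q s) xs) := by
    have hacc : (testLinearStar c₂ n k ε L).Accepts f =
        fun (s : TestSeed n k (blrRounds c₂ k) (sampleSize ε) L.Q) xs =>
        SchemeAccepts (stagePoints (n := n) L) (fun _ => stageVerdict L) f
          (testSeedEquiv n k _ _ L.Q s) xs := by
      funext s xs
      simp only [SchemeAccepts, stageVerdict, and_assoc]
      rfl
    rw [hacc]
    congr!
  rw [heq, sampleProb_equiv D (testSeedEquiv n k _ _ L.Q)]
  linarith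

theorem testLinearStar_queryComplexity_le {ε : ℝ} (hk : 12 ≤ k) (hε : 0 < ε)
    (L : Learner (256 * k ^ 2))
    (hQ : (Fintype.card L.Q : ℝ) ≤ 5 * (8 * k : ℕ) * Real.logb 2 (256 * k ^ 2 : ℕ)) :
    ((testLinearStar 5 n k ε L).queryComplexity : ℝ) ≤ 100000 * (k * Real.log k + 1 / ε) := by
  have hk' : (12 : ℝ) ≤ k := by exact_mod_cast hk
  have hcard : (testLinearStar 5 n k ε L).queryComplexity =
      3 * blrRounds 5 k + 2 * (16 * k) + 2 * Fintype.card L.Q + 3 * sampleSize ε := by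
    have : (testLinearStar 5 n k ε L).queryComplexity =
      Fintype.card (TestQuery k (blrRounds 5 k) (sampleSize ε) L.Q) := rfl
    rw [this]
    simp only [Fintype.card_sum, Fintype.card_prod, Fintype.card_fin, Fintype.card_bool]
    ring
  have hlog : 1 ≤ Real.log k := by
    rw [Real.le_log_iff_exp_le (by linarith)]
    linarith [Real.exp_one_lt_d9]
  -- log₂(256k²) = 8 + 2 log k / log 2, and log 2 > 1/2.
  have hl2 : Real.logb 2 (256 * (k : ℝ) ^ 2) ≤ 8 + 4 * Real.log k := by
    have h2 := Real.log_two_gt_d9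
    rw [Real.logb, div_le_iff₀ (by linarith), Real.log_mul (by norm_num) (by positivity), Real.log_pow,
      show (256 : ℝ) = 2 ^ 8 by norm_num, Real.log_pow]
    push_cast
    nlinarith
  push_cast at hQ
  have hm : (blrRounds 5 k : ℝ) ≤
      24 * (16 * k + 5 * (8 * k) * Real.logb 2 (256 * (k : ℝ) ^ 2)) + 1 := by
    have h : 2 / blrDistance 5 k =
        24 * (16 * k + 5 * (8 * k) * Real.logb 2 (256 * (k : ℝ) ^ 2)) := by
      rw [blrDistance]; simp only [div_div_eq_mul_div, div_one]; ring
    have h0 : 0 ≤ Real.logb 2 (256 * (k : ℝ) ^ 2) :=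
      Real.logb_nonneg (by norm_num) (by nlinarith)
    rw [blrRounds, h]
    exact (Nat.ceil_lt_add_one (by positivity)).le
  have ht : (sampleSize ε : ℝ) ≤ 4 / ε + 1 := (Nat.ceil_lt_add_one (by positivity)).le
  rw [hcard]
  push_cast
  have hε' : 4 / ε = 4 * (1 / ε) := by ring
  have h1 : 0 < 1 / ε := by positivity
  rw [hε'] at ht
  have h3 := mul_le_mul_of_nonneg_left hl2 (by linarith : (0 : ℝ) ≤ k)
  have h4 : (k : ℝ) ≤ k * Real.log k := by nlinarith
  nlinarith

end TestLinearStar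

/-! ### The rank test -/

section RankTest

/-- The number with the given binary digits, most significant digit first. -/
def bitsVal (b : ℕ → ℕ) : ℕ → ℕ
  | 0 => 0
  | s + 1 => bitsVal b s + bitsVal b s + b s

theorem bitsVal_lt {b : ℕ → ℕ} (hb : ∀ s, b s < 2) (s : ℕ) : bitsVal b s < 2 ^ s := by
  induction s with
  | zero => simp [bitsVal]
  | succ s ih => have := hb s; rw [bitsVal, pow_succ]; omega

theorem bitsVal_inj {b b' : ℕ → ℕ} (hb : ∀ s, b s < 2) (hb' : ∀ s, b' s < 2) (s : ℕ) :
    bitsVal b s = bitsVal b' s ↔ ∀ i < s, b i = b' i := by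
  induction s with
  | zero => simp [bitsVal]
  | succ s ih =>
    rw [Nat.forall_lt_succ_right, ← ih, bitsVal, bitsVal]
    have := hb s
    have := hb' s
    omega

theorem bitsVal_congr {b b' : ℕ → ℕ} {s : ℕ} (h : ∀ i < s, b i = b' i) :
    bitsVal b s = bitsVal b' s := by
  induction s with
  | zero => rfl
  | succ s ih => rw [bitsVal, bitsVal, ih fun i hi => h i (by omega), h s (by omega)]

variable {n lam ρ σ k : ℕ}

/-- The group of the coordinate `v`. -/
def groupOf (H : Fin lam → Pt n) (v : Fin n) : ℕ :=
  bitsVal (fun s => if h : s < lam then (H ⟨s, h⟩ v).val else 0) lam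

theorem groupOf_lt (H : Fin lam → Pt n) (v : Fin n) : groupOf H v < 2 ^ lam := by
  refine bitsVal_lt (fun s => ?_) lam
  split_ifs
  · exact ZMod.val_lt _
  · norm_num

theorem groupOf_eq_iff (H : Fin lam → Pt n) (v v' : Fin n) :
    groupOf H v = groupOf H v' ↔ ∀ s, H s v = H s v' := by
  rw [groupOf, groupOf, bitsVal_inj]
  · constructor
    · intro h s
      simpa [(ZMod.val_injective 2).eq_iff] using h s s.2
    · intro h s hs
      simp [hs, h ⟨s, hs⟩]
  all_goals
    intro s
    split_ifs
    · exact ZMod.val_lt _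
    · norm_num

/-- The point with coordinates `A v * B v` on group `l` and zero elsewhere. -/
def groupPoint (H : Fin lam → Pt n) (l : ℕ) (x y : Pt n) : Pt n :=
  fun v => if groupOf H v = l then x v * y v else 0

/-- The members of `S` in group `l`. -/
def groupPart (H : Fin lam → Pt n) (S : Finset (Fin n)) (l : ℕ) : Finset (Fin n) :=
  S.filter fun v => groupOf H v = l

theorem sum_card_groupPart (H : Fin lam → Pt n) (S : Finset (Fin n)) :
    ∑ l : Fin (2 ^ lam), (groupPart H S l).card = S.card := by
  rw [card_eq_sum_card_fiberwise (f := fun v => (⟨groupOf H v, groupOf_lt H v⟩ : Fin (2 ^ lam)))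
    (t := univ) (fun _ _ => mem_coe.2 (mem_univ _))]
  refine sum_congr rfl fun l _ => ?_
  congr 1
  ext v
  simp [groupPart, Fin.ext_iff]

/-- The values of the parity on `S` at the points of a group form a matrix. -/
def groupMatrix (H : Fin lam → Pt n) (A : Fin ρ → Pt n) (B : Fin σ → Pt n) (S : Finset (Fin n))
    (l : ℕ) : Matrix (Fin ρ) (Fin σ) (ZMod 2) :=
  Matrix.of fun i j => parity S (groupPoint H l (A i) (B j))

theorem groupMatrix_apply (H : Fin lam → Pt n) (A : Fin ρ → Pt n) (B : Fin σ → Pt n)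
    (S : Finset (Fin n)) (l : ℕ) (i : Fin ρ) (j : Fin σ) :
    groupMatrix H A B S l i j = ∑ v ∈ groupPart H S l, A i v * B j v := by
  rw [groupMatrix, Matrix.of_apply, parity, groupPart, sum_filter]
  rfl

/-- The matrix factors through the coordinates of `S` in the group, whose number is the inner
dimension of the product. -/
theorem rank_groupMatrix_le (H : Fin lam → Pt n) (A : Fin ρ → Pt n) (B : Fin σ → Pt n)
    (S : Finset (Fin n)) (l : ℕ) : (groupMatrix H A B S l).rank ≤ (groupPart H S l).card := by
  have h : groupMatrix H A B S l =
      (Matrix.of fun i (v : groupPart H S l) => A i v) *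
        (Matrix.of fun (v : groupPart H S l) j => B j v) := by
    ext i j
    rw [groupMatrix_apply, Matrix.mul_apply]
    exact (sum_coe_sort _ fun v => A i v * B j v).symm
  rw [h]
  refine (Matrix.rank_mul_le_left _ _).trans ((Matrix.rank_le_card_width _).trans ?_)
  simp

theorem sum_rank_groupMatrix_le (H : Fin lam → Pt n) (A : Fin ρ → Pt n) (B : Fin σ → Pt n)
    (S : Finset (Fin n)) : ∑ l : Fin (2 ^ lam), (groupMatrix H A B S l).rank ≤ S.card := by
  rw [← sum_card_groupPart H S]
  exact sum_le_sum fun l _ => rank_groupMatrix_le H A B S l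

/-- Let `N` be the matrix of values of `A` at the members of `T` in the group. The first hypothesis
makes its rows independent; the second puts the kernel of the transposed group matrix inside the
kernel of `N`. Rank-nullity then compares the ranks. -/
theorem card_groupPart_le_rank (H : Fin lam → Pt n) (A : Fin ρ → Pt n) (B : Fin σ → Pt n)
    (S T : Finset (Fin n)) (l : ℕ)
    (h₁ : ∀ U ⊆ groupPart H T l, U.Nonempty → ∃ i, parity U (A i) ≠ 0)
    (h₂ : ∀ x : Fin ρ → ZMod 2, (∃ v ∈ groupPart H T l, ∑ i, A i v * x i ≠ 0) →
      ∃ j, ∑ i, groupMatrix H A B S l i j * x i ≠ 0) :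
    (groupPart H T l).card ≤ (groupMatrix H A B S l).rank := by
  classical
  set N : Matrix (groupPart H T l) (Fin ρ) (ZMod 2) := Matrix.of fun v i => A i v with hN
  have hli : LinearIndependent (ZMod 2) N.row := by
    rw [Fintype.linearIndependent_iff]
    intro c hc
    by_contra! hne
    obtain ⟨v, hv⟩ := hne
    -- A linear relation over the field with two elements is a subset whose parities all vanish.
    set U : Finset (Fin n) := (groupPart H T l).filter fun v => ∃ h : v ∈ groupPart H T l, c ⟨v, h⟩ ≠ 0
    obtain ⟨i, hi⟩ := h₁ U (filter_subset _ _)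
      ⟨v.1, mem_filter.2 ⟨v.2, v.2, hv⟩⟩
    apply hi
    have h3 := congrFun hc i
    simp only [Finset.sum_apply, Pi.smul_apply, smul_eq_mul, Pi.zero_apply] at h3
    rw [← h3, parity, sum_filter, ← sum_coe_sort]
    refine sum_congr rfl fun w _ => ?_
    have hone : ∀ a : ZMod 2, a ≠ 0 → a = 1 := by decide
    by_cases hw : c w = 0
    · simp [hw]
    · simp [hone _ hw, hN, Matrix.row]
  have hr := hli.rank_matrix
  rw [Fintype.card_coe] at hr
  rw [← hr, ← Matrix.rank_transpose (groupMatrix H A B S l)]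
  have hker : LinearMap.ker (groupMatrix H A B S l).transpose.mulVecLin ≤ LinearMap.ker N.mulVecLin := by
    intro x hx
    rw [LinearMap.mem_ker, Matrix.mulVecLin_apply] at hx ⊢
    by_contra hne
    obtain ⟨v, hv⟩ := Function.ne_iff.1 hne
    obtain ⟨j, hj⟩ := h₂ x ⟨v.1, v.2, hv⟩
    exact hj (congrFun hx j)
  have e1 := LinearMap.finrank_range_add_finrank_ker (groupMatrix H A B S l).transpose.mulVecLin
  have e2 := LinearMap.finrank_range_add_finrank_ker N.mulVecLin
  have e3 := Submodule.finrank_mono hker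
  unfold Matrix.rank
  omega

theorem unifProb_const_on_le (U : Finset (Fin n)) :
    unifProb (fun x : Pt n => ∀ v ∈ U, ∀ v' ∈ U, x v = x v') ≤ 2 * (1 / 2) ^ U.card := by
  classical
  have h : ∀ c : ZMod 2, unifProb (fun x : Pt n => ∀ v ∈ U, x v = c) = (1 / 2) ^ U.card := by
    intro c
    rw [unifProb_pi_finset U fun _ a => a = c, prod_const, unifProb_eq_const]
    simp
  rw [two_mul]
  nth_rewrite 1 [← h 0]
  rw [← h 1]
  refine le_trans (unifProb_mono fun x hx => ?_) (unifProb_or_le _ _)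
  by_cases h0 : ∀ v ∈ U, x v = 0
  · exact Or.inl h0
  · push Not at h0
    obtain ⟨v, hv, h0⟩ := h0
    have hone : ∀ a : ZMod 2, a ≠ 0 → a = 1 := by decide
    exact Or.inr fun v' hv' => (hx v' hv' v hv).trans (hone _ h0)

/-- First moment over `U`: a nonempty `U` lies in one group with probability at most (2 ·
2^(-|U|))^lam, and independently all its parities vanish with probability 2^(-ρ). The sum of 2^(-lam
|U|) over all subsets is (1 + 2^(-lam))^|T|, whence the exponential. -/
theorem unifProb_dependent_le (T : Finset (Fin n)) :
    unifProb (fun o : (Fin lam → Pt n) × (Fin ρ → Pt n) => ∃ U ∈ T.powerset,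
      (U.Nonempty ∧ ∀ v ∈ U, ∀ v' ∈ U, groupOf o.1 v = groupOf o.1 v') ∧ ∀ i, parity U (o.2 i) = 0) ≤
      2 ^ lam * (1 / 2) ^ ρ * Real.exp (T.card / 2 ^ lam) := by
  classical
  refine (unifProb_exists_le _ _).trans ?_
  -- The trivial power of 1 puts the bound into the form required by the binomial theorem over
  -- subsets.
  have h : ∀ U ∈ T.powerset, unifProb (fun o : (Fin lam → Pt n) × (Fin ρ → Pt n) =>
      (U.Nonempty ∧ ∀ v ∈ U, ∀ v' ∈ U, groupOf o.1 v = groupOf o.1 v') ∧ ∀ i, parity U (o.2 i) = 0) ≤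
      2 ^ lam * (1 / 2) ^ ρ * ((1 / 2 ^ lam) ^ U.card * 1 ^ (T.card - U.card)) := by
    intro U _
    rw [unifProb_and (fun H : Fin lam → Pt n =>
      U.Nonempty ∧ ∀ v ∈ U, ∀ v' ∈ U, groupOf H v = groupOf H v')
      (fun A : Fin ρ → Pt n => ∀ i, parity U (A i) = 0)]
    rcases U.eq_empty_or_nonempty with rfl | hU
    · simp [unifProb]
    · have h1 : unifProb (fun H : Fin lam → Pt n =>
          U.Nonempty ∧ ∀ v ∈ U, ∀ v' ∈ U, groupOf H v = groupOf H v') ≤ (2 * (1 / 2) ^ U.card) ^ lam := by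
        have e := unifProb_pi_const (ι := Fin lam) fun x : Pt n => ∀ v ∈ U, ∀ v' ∈ U, x v = x v'
        rw [Fintype.card_fin] at e
        refine (unifProb_mono fun H hH s v hv v' hv' => ?_).trans
          (e.trans_le (pow_le_pow_left₀ (unifProb_nonneg _) (unifProb_const_on_le U) _))
        exact (groupOf_eq_iff H v v').1 (hH.2 v hv v' hv') s
      have h2 : unifProb (fun A : Fin ρ → Pt n => ∀ i, parity U (A i) = 0) = (1 / 2) ^ ρ := by
        rw [unifProb_pi_const fun x : Pt n => parity U x = 0, parity_eq_half hU, Fintype.card_fin]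
      rw [h2]
      refine (mul_le_mul_of_nonneg_right h1 (by positivity)).trans (le_of_eq ?_)
      rw [mul_pow, one_pow, mul_one, ← pow_mul, mul_comm U.card lam, pow_mul, one_div_pow]
      ring
  refine (sum_le_sum h).trans ?_
  rw [← mul_sum, Finset.sum_pow_mul_eq_add_pow]
  refine mul_le_mul_of_nonneg_left ?_ (by positivity)
  rw [show (T.card : ℝ) / 2 ^ lam = T.card * (1 / 2 ^ lam) by ring, Real.exp_nat_mul]
  refine pow_le_pow_left₀ (by positivity) ?_ _
  exact Real.add_one_le_exp _

/-- A combination of rows of the matrix is again a parity, on the members of `S` in the group that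
`x` does not annihilate; at a random point it is a fair bit as soon as this set is nonempty. -/
theorem sum_groupMatrix_mul (H : Fin lam → Pt n) (A : Fin ρ → Pt n) (B : Fin σ → Pt n)
    (S : Finset (Fin n)) (l : ℕ) (x : Fin ρ → ZMod 2) (j : Fin σ) :
    ∑ i, groupMatrix H A B S l i j * x i =
      parity ((groupPart H S l).filter fun v => ∑ i, A i v * x i ≠ 0) (B j) := by
  simp only [groupMatrix_apply, sum_mul, parity]
  rw [sum_comm, sum_filter]
  refine sum_congr rfl fun v _ => ?_
  have hone : ∀ a : ZMod 2, a ≠ 0 → a = 1 := by decide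
  have : ∑ i, A i v * B j v * x i = (∑ i, A i v * x i) * B j v := by
    rw [sum_mul]
    exact sum_congr rfl fun i _ => by ring
  rw [this]
  by_cases h : ∑ i, A i v * x i = 0
  · simp [h]
  · simp [hone _ h]

/-- Union bound over groups and vectors `x`: a witness in `T` lies in `S`, so each of the σ entries
is an independent fair bit. -/
theorem unifProb_rank_drop_le (H : Fin lam → Pt n) (A : Fin ρ → Pt n) {S T : Finset (Fin n)}
    (hTS : T ⊆ S) :
    unifProb (fun B : Fin σ → Pt n => ∃ l ∈ (univ : Finset (Fin (2 ^ lam))),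
      ∃ x ∈ (univ : Finset (Fin ρ → ZMod 2)), (∃ v ∈ groupPart H T l, ∑ i, A i v * x i ≠ 0) ∧
        ∀ j, ∑ i, groupMatrix H A B S l i j * x i = 0) ≤ 2 ^ lam * 2 ^ ρ * (1 / 2) ^ σ := by
  classical
  have h : ∀ l ∈ (univ : Finset (Fin (2 ^ lam))), unifProb (fun B : Fin σ → Pt n =>
      ∃ x ∈ (univ : Finset (Fin ρ → ZMod 2)), (∃ v ∈ groupPart H T l, ∑ i, A i v * x i ≠ 0) ∧
        ∀ j, ∑ i, groupMatrix H A B S l i j * x i = 0) ≤ 2 ^ ρ * (1 / 2) ^ σ := by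
    intro l _
    refine (unifProb_exists_le _ _).trans ?_
    have h2 : ∀ x ∈ (univ : Finset (Fin ρ → ZMod 2)), unifProb (fun B : Fin σ → Pt n =>
        (∃ v ∈ groupPart H T l, ∑ i, A i v * x i ≠ 0) ∧
        ∀ j, ∑ i, groupMatrix H A B S l i j * x i = 0) ≤ (1 / 2) ^ σ := by
      intro x _
      by_cases hx : ∃ v ∈ groupPart H T l, ∑ i, A i v * x i ≠ 0
      · simp only [hx, true_and, sum_groupMatrix_mul]
        have hne : ((groupPart H S l).filter fun v => ∑ i, A i v * x i ≠ 0).Nonempty := by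
          obtain ⟨v, hv, hv'⟩ := hx
          refine ⟨v, mem_filter.2 ⟨?_, hv'⟩⟩
          exact filter_subset_filter _ hTS hv
        rw [unifProb_pi_const fun y : Pt n =>
          parity ((groupPart H S l).filter fun v => ∑ i, A i v * x i ≠ 0) y = 0,
          parity_eq_half hne, Fintype.card_fin]
      · simp only [hx, false_and]
        simp [unifProb]
    refine (sum_le_sum h2).trans (le_of_eq ?_)
    simp
  refine (unifProb_exists_le _ _).trans ((sum_le_sum h).trans (le_of_eq ?_))
  simp [mul_assoc]

/-- The points at which the rank test asks for the self-corrected function. -/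
def rankPoints (lam ρ σ : ℕ) (o : ((Fin lam → Pt n) × (Fin ρ → Pt n)) × (Fin σ → Pt n))
    (q : Fin (2 ^ lam) × Fin ρ × Fin σ) : Pt n :=
  groupPoint o.1.1 q.1 (o.1.2 q.2.1) (o.2 q.2.2)

/-- The verdict of the rank test: the ranks of the matrices add up to at most `k`. -/
def RankVerdict (k lam ρ σ : ℕ) (a : Fin (2 ^ lam) × Fin ρ × Fin σ → ZMod 2) : Prop :=
  ∑ l, (Matrix.of fun i j => a (l, i, j)).rank ≤ k

theorem rankVerdict_parity {S : Finset (Fin n)} (hS : S.card ≤ k)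
    (o : ((Fin lam → Pt n) × (Fin ρ → Pt n)) × (Fin σ → Pt n)) :
    RankVerdict k lam ρ σ fun q => parity S (rankPoints lam ρ σ o q) :=
  (sum_rank_groupMatrix_le o.1.1 o.1.2 o.2 S).trans hS

/-- Independence of `A` on the chosen set and faithfulness of `B` each fail with probability at most
1/16. Otherwise the ranks sum to at least k + 1. -/
theorem unifProb_rankVerdict_le {κ : ℕ} (hκ : 4 ≤ κ) (h₁ : lam ≤ κ) (h₂ : k + 1 ≤ κ * 2 ^ lam)
    (S : Finset (Fin n)) (hS : k < S.card) :
    unifProb (fun o => RankVerdict k lam (4 * κ) (6 * κ)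
      fun q => parity S (rankPoints lam (4 * κ) (6 * κ) o q)) ≤ 1 / 6 := by
  classical
  -- Passing to exactly k + 1 members keeps the exponential bounded however large `S` is.
  obtain ⟨T, hTS, hT⟩ := exists_subset_card_eq (s := S) (n := k + 1) hS
  have hκ16 : (1 / 2 : ℝ) ^ κ ≤ 1 / 16 := by
    calc (1 / 2 : ℝ) ^ κ ≤ (1 / 2) ^ 4 := pow_le_pow_of_le_one (by norm_num) (by norm_num) hκ
      _ = _ := by norm_num
  have hlam : (2 : ℝ) ^ lam ≤ 2 ^ κ := pow_le_pow_right₀ (by norm_num) h₁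
  have hexp : Real.exp (T.card / 2 ^ lam) ≤ 2 ^ κ * 2 ^ κ := by
    have h : (T.card : ℝ) / 2 ^ lam ≤ κ * 1 := by
      rw [hT, div_le_iff₀ (by positivity), mul_one]
      exact_mod_cast h₂
    refine (Real.exp_le_exp.2 h).trans ?_
    rw [Real.exp_nat_mul, ← mul_pow]
    exact pow_le_pow_left₀ (Real.exp_pos _).le (by linarith [Real.exp_one_lt_d9]) _
  have hcancel : (2 : ℝ) ^ κ * (1 / 2) ^ κ = 1 := by rw [← mul_pow]; norm_num
  -- Exponents: κ for the groups and 2κ for the exponential (e < 4), against ρ = 4κ. In the next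
  -- bound κ + 4κ stands against σ = 6κ. Both leave 2^(-κ) ≤ 1/16.
  have b₁ : (2 : ℝ) ^ lam * (1 / 2) ^ (4 * κ) * Real.exp (T.card / 2 ^ lam) ≤ 1 / 16 := by
    calc (2 : ℝ) ^ lam * (1 / 2) ^ (4 * κ) * Real.exp (T.card / 2 ^ lam) ≤
        2 ^ κ * (1 / 2) ^ (4 * κ) * (2 ^ κ * 2 ^ κ) := by gcongr
      _ = (2 ^ κ * (1 / 2) ^ κ) ^ 3 * (1 / 2) ^ κ := by ring
      _ ≤ 1 / 16 := by rw [hcancel]; simpa using hκ16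
  have b₂ : (2 : ℝ) ^ lam * 2 ^ (4 * κ) * (1 / 2) ^ (6 * κ) ≤ 1 / 16 := by
    calc (2 : ℝ) ^ lam * 2 ^ (4 * κ) * (1 / 2) ^ (6 * κ) ≤
        2 ^ κ * 2 ^ (4 * κ) * (1 / 2) ^ (6 * κ) := by gcongr
      _ = (2 ^ κ * (1 / 2) ^ κ) ^ 5 * (1 / 2) ^ κ := by ring
      _ ≤ 1 / 16 := by rw [hcancel]; simpa using hκ16
  refine (unifProb_prod_le (c := 1 / 16) (by norm_num)
    (q := fun o : (Fin lam → Pt n) × (Fin (4 * κ) → Pt n) => ∃ U ∈ T.powerset,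
      (U.Nonempty ∧ ∀ v ∈ U, ∀ v' ∈ U, groupOf o.1 v = groupOf o.1 v') ∧
        ∀ i, parity U (o.2 i) = 0) ?_).trans ?_
  · rintro ⟨H, A⟩ hind
    refine (unifProb_mono fun B hB => ?_).trans
      ((unifProb_rank_drop_le (σ := 6 * κ) H A hTS).trans b₂)
    by_contra hdrop
    push Not at hdrop hind
    have hr : ∀ l : Fin (2 ^ lam), (groupPart H T l).card ≤ (groupMatrix H A B S l).rank := by
      intro l
      refine card_groupPart_le_rank H A B S T l (fun U hU hne => ?_) fun x hx => ?_
      · refine hind U (mem_powerset.2 (hU.trans (filter_subset _ _))) ⟨hne, fun v hv v' hv' => ?_⟩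
        exact (mem_filter.1 (hU hv)).2.trans (mem_filter.1 (hU hv')).2.symm
      · exact hdrop l (mem_univ _) x (mem_univ _) hx
    have h1 := sum_le_sum fun l (_ : l ∈ univ) => hr l
    rw [sum_card_groupPart, hT] at h1
    have h2 : ∑ l : Fin (2 ^ lam), (groupMatrix H A B S l).rank ≤ k := hB
    omega
  · have := (unifProb_dependent_le (lam := lam) (ρ := 4 * κ) T).trans b₁
    linarith

end RankTest

/-! ### Weakest preconditions and framing for the machine -/

section Semantics

variable {n : ℕ}

/-- Whether some elementary instruction of the program satisfies `φ`. -/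
def Prog.any (φ : Prog → Bool) : Prog → Bool
  | .seq p q => p.any φ || q.any φ
  | .ite _ p q => p.any φ || q.any φ
  | .loop _ p => p.any φ
  | p => φ p

/-- Whether the instruction assigns to register `r`. -/
def Prog.assigns (r : ℕ) : Prog → Bool
  | .const r' _ => r == r'
  | .add r' _ _ => r == r'
  | .sub r' _ _ => r == r'
  | .load r' _ => r == r'
  | .coin r' => r == r'
  | .query r' _ => r == r'
  | _ => false

/-- Whether the program may change register `r`. -/
def Prog.writes (p : Prog) (r : ℕ) : Bool := p.any (Prog.assigns r)

/-- Whether the instruction changes the memory. -/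
def Prog.isStore : Prog → Bool
  | .store _ _ => true
  | .sample _ => true
  | _ => false

/-- Whether the instruction tosses a coin. -/
def Prog.isCoin : Prog → Bool
  | .coin _ => true
  | _ => false

/-- Whether the instruction draws a sample. -/
def Prog.isSample : Prog → Bool
  | .sample _ => true
  | _ => false

/-- Whether the instruction queries the function. -/
def Prog.isQuery : Prog → Bool
  | .query _ _ => true
  | _ => false

/-- The parts of the state that the program cannot change agree. -/
structure Frame (p : Prog) (s s' : MState n) : Prop where
  reg : ∀ r, p.writes r = false → s'.reg r = s.reg r
  mem : p.any Prog.isStore = false → s'.mem = s.mem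
  coins : p.any Prog.isCoin = false → s'.coins = s.coins
  samples : p.any Prog.isSample = false → s'.samples = s.samples
  queries : p.any Prog.isQuery = false → s'.queries = s.queries

theorem Frame.refl (p : Prog) (s : MState n) : Frame p s s :=
  ⟨fun _ _ => rfl, fun _ => rfl, fun _ => rfl, fun _ => rfl, fun _ => rfl⟩

theorem Frame.trans {p : Prog} {s s' s'' : MState n} (h : Frame p s s') (h' : Frame p s' s'') :
    Frame p s s'' :=
  ⟨fun r hr => (h'.reg r hr).trans (h.reg r hr), fun e => (h'.mem e).trans (h.mem e),
    fun e => (h'.coins e).trans (h.coins e), fun e => (h'.samples e).trans (h.samples e),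
    fun e => (h'.queries e).trans (h.queries e)⟩

theorem Frame.mono {p q : Prog} {s s' : MState n} (h : Frame p s s')
    (hpq : ∀ φ, q.any φ = false → p.any φ = false) : Frame q s s' :=
  ⟨fun r hr => h.reg r (hpq _ hr), fun e => h.mem (hpq _ e), fun e => h.coins (hpq _ e),
    fun e => h.samples (hpq _ e), fun e => h.queries (hpq _ e)⟩

variable {f : BoolFn n} {ω : Tape n}

/-- What a program may change is decided syntactically, so preservation of a register, the memory or
a tape counter is later discharged by `rfl`. -/
theorem Exec.frame {p : Prog} {s s' : MState n} {t : ℕ} (h : Exec f ω p s t s') : Frame p s s' := by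
  induction h with
  | seq _ _ ih ih' =>
    exact (ih.mono fun φ h => by simp_all [Prog.any]).trans (ih'.mono fun φ h => by simp_all [Prog.any])
  | ite_true _ _ ih => exact ih.mono fun φ h => by simp_all [Prog.any]
  | ite_false _ _ ih => exact ih.mono fun φ h => by simp_all [Prog.any]
  | loop_stop _ => exact Frame.refl _ _
  | loop_step _ _ _ ih ih' => exact (ih.mono fun φ h => by simpa [Prog.any] using h).trans ih'
  | _ =>
    constructor <;>
    simp +contextual [Prog.writes, Prog.any, Prog.assigns, Prog.isStore, Prog.isCoin,
      Prog.isSample, Prog.isQuery, MState.setReg, MState.setMem, MState.writePt]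

/-- The program halts with the time and the final state satisfying `Q`. -/
def wp (f : BoolFn n) (ω : Tape n) (p : Prog) (Q : ℕ → MState n → Prop) (s : MState n) : Prop :=
  ∃ t s', Exec f ω p s t s' ∧ Q t s'

theorem wp.mono {p : Prog} {Q Q' : ℕ → MState n → Prop} {s : MState n} (h : wp f ω p Q s)
    (hQ : ∀ t s', Frame p s s' → Q t s' → Q' t s') : wp f ω p Q' s := by
  obtain ⟨t, s', he, hq⟩ := h
  exact ⟨t, s', he, hQ t s' he.frame hq⟩

theorem wp_const {r c : ℕ} {Q : ℕ → MState n → Prop} {s : MState n} :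
    wp f ω (.const r c) Q s ↔ Q 1 (s.setReg r c) :=
  ⟨fun ⟨_, _, he, hq⟩ => by cases he; exact hq, fun h => ⟨_, _, .const r c s, h⟩⟩

theorem wp_add {r u v : ℕ} {Q : ℕ → MState n → Prop} {s : MState n} :
    wp f ω (.add r u v) Q s ↔ Q 1 (s.setReg r (s.reg u + s.reg v)) :=
  ⟨fun ⟨_, _, he, hq⟩ => by cases he; exact hq, fun h => ⟨_, _, .add r u v s, h⟩⟩

theorem wp_sub {r u v : ℕ} {Q : ℕ → MState n → Prop} {s : MState n} :
    wp f ω (.sub r u v) Q s ↔ Q 1 (s.setReg r (s.reg u - s.reg v)) :=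
  ⟨fun ⟨_, _, he, hq⟩ => by cases he; exact hq, fun h => ⟨_, _, .sub r u v s, h⟩⟩

theorem wp_load {r u : ℕ} {Q : ℕ → MState n → Prop} {s : MState n} :
    wp f ω (.load r u) Q s ↔ Q 1 (s.setReg r (s.mem (s.reg u))) :=
  ⟨fun ⟨_, _, he, hq⟩ => by cases he; exact hq, fun h => ⟨_, _, .load r u s, h⟩⟩

theorem wp_store {r u : ℕ} {Q : ℕ → MState n → Prop} {s : MState n} :
    wp f ω (.store r u) Q s ↔ Q 1 (s.setMem (s.reg r) (s.reg u)) :=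
  ⟨fun ⟨_, _, he, hq⟩ => by cases he; exact hq, fun h => ⟨_, _, .store r u s, h⟩⟩

theorem wp_coin {r : ℕ} {Q : ℕ → MState n → Prop} {s : MState n} :
    wp f ω (.coin r) Q s ↔
      Q 1 { s.setReg r (if ω.1 s.coins then 1 else 0) with coins := s.coins + 1 } :=
  ⟨fun ⟨_, _, he, hq⟩ => by cases he; exact hq, fun h => ⟨_, _, .coin r s, h⟩⟩

theorem wp_sample {r : ℕ} {Q : ℕ → MState n → Prop} {s : MState n} :
    wp f ω (.sample r) Q s ↔
      Q (n + 1) { s.writePt (s.reg r) (ω.2 s.samples) with samples := s.samples + 1 } :=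
  ⟨fun ⟨_, _, he, hq⟩ => by cases he; exact hq, fun h => ⟨_, _, .sample r s, h⟩⟩

theorem wp_query {r u : ℕ} {Q : ℕ → MState n → Prop} {s : MState n} :
    wp f ω (.query r u) Q s ↔
      Q (n + 1) { s.setReg r (f (s.readPt (s.reg u))).val with
          queries := s.queries ++ [s.readPt (s.reg u)] } :=
  ⟨fun ⟨_, _, he, hq⟩ => by cases he; exact hq, fun h => ⟨_, _, .query r u s, h⟩⟩

theorem wp_seq {p q : Prog} {Q : ℕ → MState n → Prop} {s : MState n} :
    wp f ω (.seq p q) Q s ↔ wp f ω p (fun t s' => wp f ω q (fun t' s'' => Q (t + t') s'') s') s :=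
  ⟨fun ⟨_, _, he, hq⟩ => by cases he with | seq a b => exact ⟨_, _, a, _, _, b, hq⟩,
    fun ⟨_, _, a, _, _, b, hq⟩ => ⟨_, _, .seq a b, hq⟩⟩

theorem wp_ite {r : ℕ} {p q : Prog} {Q : ℕ → MState n → Prop} {s : MState n} :
    wp f ω (.ite r p q) Q s ↔
      (s.reg r ≠ 0 → wp f ω p (fun t s' => Q (t + 1) s') s) ∧
      (s.reg r = 0 → wp f ω q (fun t s' => Q (t + 1) s') s) := by
  constructor
  · rintro ⟨_, _, he, hq⟩
    cases he with
    | ite_true h a => exact ⟨fun _ => ⟨_, _, a, hq⟩, fun h' => absurd h' h⟩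
    | ite_false h a => exact ⟨fun h' => absurd h h', fun _ => ⟨_, _, a, hq⟩⟩
  · rintro ⟨h₁, h₂⟩
    by_cases h : s.reg r = 0
    · obtain ⟨_, _, a, hq⟩ := h₂ h
      exact ⟨_, _, .ite_false h a, hq⟩
    · obtain ⟨_, _, a, hq⟩ := h₁ h
      exact ⟨_, _, .ite_true h a, hq⟩

/-- A loop that runs `N` times. -/
theorem wp_loop {r : ℕ} {p : Prog} {s : MState n} (N T : ℕ) (I : ℕ → MState n → Prop) (h₀ : I 0 s)
    (hend : ∀ s', I N s' → s'.reg r = 0)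
    (step : ∀ i s', i < N → Frame p s s' → I i s' →
      s'.reg r ≠ 0 ∧ wp f ω p (fun t s'' => t ≤ T ∧ I (i + 1) s'') s') :
    wp f ω (.loop r p) (fun t s' => t ≤ N * (T + 1) + 1 ∧ I N s') s := by
  suffices H : ∀ d i s', i + d = N → Frame p s s' → I i s' →
      wp f ω (.loop r p) (fun t s' => t ≤ d * (T + 1) + 1 ∧ I N s') s' from
    H N 0 s (by omega) (Frame.refl _ _) h₀
  intro d
  induction d with
  | zero =>
    intro i s' hi _ hI
    obtain rfl : i = N := by omega
    exact ⟨1, s', by constructor; exact hend s' hI, by omega, hI⟩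
  | succ d ih =>
    intro i s' hi hF hI
    obtain ⟨hr, t, s₁, he, ht, hI'⟩ := step i s' (by omega) hF hI
    obtain ⟨t', s₂, he', ht', hN⟩ := ih (i + 1) s₁ (by omega) (hF.trans he.frame) hI'
    exact ⟨_, _, .loop_step hr he he', by rw [add_mul]; omega, hN⟩

/-- Repeat `p` as often as register `r` says; register 4 must hold 1. -/
def Prog.times (r : ℕ) (p : Prog) : Prog := .loop r (.seq p (.sub r r 4))

/-- The body preserves the counter, and the decrement changes nothing else; therefore the invariant
has to survive an arbitrary value in register `r`. Decrement and loop test account for the 2 in `T +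
2`, the last test for the final 1. -/
theorem wp_times {r : ℕ} {p : Prog} {s : MState n} (N T : ℕ) (I : ℕ → MState n → Prop)
    (hN : s.reg r = N) (h4 : s.reg 4 = 1) (hr : p.writes r = false) (h4' : p.writes 4 = false)
    (hr4 : r ≠ 4) (h₀ : I 0 s)
    (step : ∀ i s', i < N → Frame (.times r p) s s' → I i s' →
      wp f ω p (fun t s'' => t ≤ T ∧ ∀ c, I (i + 1) (s''.setReg r c)) s') :
    wp f ω (.times r p) (fun t s' => t ≤ N * (T + 2) + 1 ∧ I N s') s := by
  have hw : (Prog.seq p (.sub r r 4)).writes 4 = false := by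
    simp only [Prog.writes, Prog.any, Bool.or_eq_false_iff] at h4' ⊢
    exact ⟨h4', by simpa [Prog.assigns] using hr4.symm⟩
  refine (wp_loop N (T + 1) (fun i s' => I i s' ∧ s'.reg r = N - i) ⟨h₀, by simpa using hN⟩
    (fun s' h => by simpa using h.2) ?_).mono fun t s' _ h => ⟨h.1, h.2.1⟩
  intro i s' hi hF hI
  refine ⟨by omega, wp_seq.2 ((step i s' hi (hF.mono fun φ h => h) hI.1).mono ?_)⟩
  rintro t s'' hF' ⟨ht, hI'⟩
  refine wp_sub.2 ⟨by omega, hI' _, ?_⟩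
  simp only [MState.setReg, Function.update_self]
  rw [hF'.reg r hr, hF'.reg 4 h4', hF.reg 4 hw, hI.2, h4]
  omega

/-- The memory after the values `g 0, g 1, …, g (len - 1)` are written from address `base` on. -/
def writeSeg (mem : ℕ → ℕ) (base len : ℕ) (g : ℕ → ℕ) : ℕ → ℕ :=
  fun x => if base ≤ x ∧ x < base + len then g (x - base) else mem x

theorem writeSeg_zero (mem : ℕ → ℕ) (base : ℕ) (g : ℕ → ℕ) : writeSeg mem base 0 g = mem := by
  funext x; exact if_neg (by omega)

theorem update_writeSeg {mem : ℕ → ℕ} {base len a v : ℕ} {g : ℕ → ℕ} (ha : a = base + len)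
    (hv : v = g len) :
    Function.update (writeSeg mem base len g) a v = writeSeg mem base (len + 1) g := by
  subst ha hv
  funext x
  simp only [Function.update_apply, writeSeg]
  split_ifs with h1 h2 h3 h4 h5
  · subst h1; simp
  · omega
  · rfl
  · omega
  · omega
  · rfl

theorem writeSeg_of_lt {mem : ℕ → ℕ} {base len x : ℕ} {g : ℕ → ℕ} (h : x < base) :
    writeSeg mem base len g x = mem x := if_neg (by omega)

theorem writeSeg_of_ge {mem : ℕ → ℕ} {base len x : ℕ} {g : ℕ → ℕ} (h : base + len ≤ x) :
    writeSeg mem base len g x = mem x := if_neg (by omega)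

theorem writeSeg_add {mem : ℕ → ℕ} {base len x : ℕ} {g : ℕ → ℕ} (h : x < len) :
    writeSeg mem base len g (base + x) = g x := by
  rw [writeSeg, if_pos (by omega), Nat.add_sub_cancel_left]

theorem writeSeg_writeSeg (mem : ℕ → ℕ) (base len : ℕ) (g g' : ℕ → ℕ) :
    writeSeg (writeSeg mem base len g) base len g' = writeSeg mem base len g' := by
  funext x
  simp only [writeSeg]
  split_ifs <;> rfl

/-- Nested loops fill memory block by block: after `i` blocks of length `m`, the next block extends
the segment. -/
theorem writeSeg_block {mem : ℕ → ℕ} {base i m : ℕ} {g h : ℕ → ℕ} (hg : ∀ y < m, h y = g (i * m + y)) :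
    writeSeg (writeSeg mem base (i * m) g) (base + i * m) m h = writeSeg mem base ((i + 1) * m) g := by
  funext x
  have e : (i + 1) * m = i * m + m := by ring
  simp only [writeSeg, e]
  split_ifs
  · rw [hg _ (by omega)]; congr 1; omega
  all_goals first | rfl | omega

theorem mul_add_div_of_lt {i m y : ℕ} (h : y < m) : (i * m + y) / m = i := by
  rw [mul_comm, Nat.mul_add_div (by omega), Nat.div_eq_of_lt h, add_zero]

theorem mul_add_mod_of_lt {i m y : ℕ} (h : y < m) : (i * m + y) % m = y := by
  rw [mul_comm, Nat.mul_add_mod, Nat.mod_eq_of_lt h]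

end Semantics

/-! ### One step of Gaussian elimination -/

section Elimination

variable {ρ σ : Type*} [Fintype ρ] [Fintype σ]

/-- Adding the row `P` to all rows with a nonzero entry in column `j`. -/
def elimColumn (M : Matrix ρ σ (ZMod 2)) (P : σ → ZMod 2) (j : σ) : Matrix ρ σ (ZMod 2) :=
  Matrix.of fun i j' => M i j' + M i j * P j'

/-- All new rows vanish in column `j`, so the pivot row is outside their span; the old row space is
the new one plus the line of the pivot row. The pivot row itself becomes zero, so no row exchange is
needed. -/
theorem rank_elimColumn (M : Matrix ρ σ (ZMod 2)) (i₀ : ρ) (j : σ) (h : M i₀ j = 1) :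
    M.rank = (elimColumn M (M i₀) j).rank + 1 := by
  classical
  rw [Matrix.rank_eq_finrank_span_row, Matrix.rank_eq_finrank_span_row]
  set M' := elimColumn M (M i₀) j with hM'
  have hrow : ∀ i, M'.row i = M.row i + M i j • M i₀ := fun i => by
    funext j'; simp [hM', elimColumn, Matrix.row]
  have hnot : M i₀ ∉ Submodule.span (ZMod 2) (Set.range M'.row) := by
    intro hmem
    have hle : Submodule.span (ZMod 2) (Set.range M'.row) ≤ LinearMap.ker (LinearMap.proj j) := by
      rw [Submodule.span_le]
      rintro _ ⟨i, rfl⟩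
      simp only [SetLike.mem_coe, LinearMap.mem_ker, LinearMap.proj_apply, hrow, Pi.add_apply,
        Pi.smul_apply, smul_eq_mul, h, mul_one]
      exact CharTwo.add_self_eq_zero _
    have := hle hmem
    rw [LinearMap.mem_ker, LinearMap.proj_apply, h] at this
    exact one_ne_zero this
  have hsup : Submodule.span (ZMod 2) (Set.range M.row) =
      Submodule.span (ZMod 2) (Set.range M'.row) ⊔ Submodule.span (ZMod 2) {M i₀} := by
    apply le_antisymm
    · rw [Submodule.span_le]
      rintro _ ⟨i, rfl⟩
      have : M.row i = M'.row i + M i j • M i₀ := by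
        rw [hrow, add_assoc, ← add_smul, CharTwo.add_self_eq_zero, zero_smul, add_zero]
      rw [this]
      exact Submodule.add_mem_sup (Submodule.subset_span ⟨i, rfl⟩)
        (Submodule.smul_mem _ _ (Submodule.mem_span_singleton_self _))
    · rw [sup_le_iff, Submodule.span_le, Submodule.span_singleton_le_iff_mem]
      have h0 : M i₀ ∈ Submodule.span (ZMod 2) (Set.range M.row) := Submodule.subset_span ⟨i₀, rfl⟩
      refine ⟨?_, h0⟩
      rintro _ ⟨i, rfl⟩
      rw [hrow]
      exact Submodule.add_mem _ (Submodule.subset_span ⟨i, rfl⟩) (Submodule.smul_mem _ _ h0)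
  rw [hsup]
  exact Submodule.finrank_sup_span_singleton hnot

end Elimination

infixr:60 " ;; " => Prog.seq

/-! ### Writing coins, samples and groups to memory -/

section Setup

variable {n : ℕ} {f : BoolFn n} {ω : Tape n}

/-- The value of a coin as a number. -/
def coinVal (ω : Tape n) (c : ℕ) : ℕ := if ω.1 c then 1 else 0

theorem coinVal_lt (ω : Tape n) (c : ℕ) : coinVal ω c < 2 := by
  unfold coinVal; split_ifs <;> norm_num

/-- Write the outcomes of `R[20] * n` coins to the memory from address `R[15]` on. -/
def progFill : Prog :=
  .times 20 (.add 21 0 26 ;; .times 21 (.coin 24 ;; .store 15 24 ;; .add 15 15 4))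

/-- Conventions kept throughout: register 0 holds `n`, register 4 holds 1, register 26 holds 0 (so
that adding it copies a register), and register 15 points to the first free cell. -/
theorem wp_fill {s : MState n} (cnt : ℕ) (h20 : s.reg 20 = cnt) (h0 : s.reg 0 = n)
    (h4 : s.reg 4 = 1) (h26 : s.reg 26 = 0) :
    wp f ω progFill (fun t s' => t ≤ cnt * (n * 5 + 4) + 1 ∧ s'.reg 15 = s.reg 15 + cnt * n ∧
      s'.coins = s.coins + cnt * n ∧
      s'.mem = writeSeg s.mem (s.reg 15) (cnt * n) fun x => coinVal ω (s.coins + x)) s := by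
  refine wp_times cnt (n * 5 + 2) (fun i s' => s'.reg 15 = s.reg 15 + i * n ∧
      s'.coins = s.coins + i * n ∧
      s'.mem = writeSeg s.mem (s.reg 15) (i * n) fun x => coinVal ω (s.coins + x))
    h20 h4 rfl rfl (by norm_num) (by simp [writeSeg_zero]) ?_
  rintro i s₁ - hF ⟨h15, hc, hm⟩
  have e0 := hF.reg 0 rfl
  have e4 := hF.reg 4 rfl
  have e26 := hF.reg 26 rfl
  rw [wp_seq, wp_add]
  refine (wp_times n 3 (fun j s' => s'.reg 15 = s.reg 15 + (i * n + j) ∧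
      s'.coins = s.coins + (i * n + j) ∧
      s'.mem = writeSeg s.mem (s.reg 15) (i * n + j) fun x => coinVal ω (s.coins + x))
    ?_ ?_ rfl rfl (by norm_num) ?_ ?_).mono ?_
  · simp [MState.setReg, e0, e26, h0, h26]
  · simp [MState.setReg, e4, h4]
  · simp [MState.setReg, h15, hc, hm]
  · rintro j s₂ - hF₂ ⟨h15, hc, hm⟩
    have e4' := hF₂.reg 4 rfl
    simp [wp_seq, wp_coin, wp_store, wp_add, MState.setReg, MState.setMem, h15, hc, hm, e4', e4, h4]
    exact ⟨rfl, rfl, update_writeSeg rfl rfl⟩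
  · rintro t s' - ⟨ht, h15, hc, hm⟩
    refine ⟨by omega, fun c => ⟨?_, ?_, ?_⟩⟩
    · simp [MState.setReg, h15]; ring
    · simp [MState.setReg, hc]; ring
    · simp [MState.setReg, hm, add_mul]

/-- The entries of the samples, listed one sample after the other. -/
def sampleVal (ω : Tape n) (x : ℕ) : ℕ :=
  if h : 0 < n then (ω.2 (x / n) ⟨x % n, Nat.mod_lt _ h⟩).val else 0

theorem sampleVal_mul_add (ω : Tape n) (i : ℕ) (v : Fin n) :
    sampleVal ω (i * n + v) = (ω.2 i v).val := by
  have hn : 0 < n := v.pos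
  have h1 : (i * n + v) / n = i := mul_add_div_of_lt v.2
  have h2 : (i * n + v) % n = v := mul_add_mod_of_lt v.2
  rw [sampleVal, dif_pos hn]
  simp only [h1, h2]

/-- Draw `R[20]` samples to the memory from address `R[15]` on. -/
def progSamples : Prog := .times 20 (.sample 15 ;; .add 15 15 0)

theorem wp_samples {s : MState n} (cnt : ℕ) (h20 : s.reg 20 = cnt) (h0 : s.reg 0 = n)
    (h4 : s.reg 4 = 1) (hs : s.samples = 0) :
    wp f ω progSamples (fun t s' => t ≤ cnt * (n + 4) + 1 ∧ s'.reg 15 = s.reg 15 + cnt * n ∧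
      s'.samples = cnt ∧ s'.mem = writeSeg s.mem (s.reg 15) (cnt * n) (sampleVal ω)) s := by
  refine wp_times cnt (n + 2) (fun i s' => s'.reg 15 = s.reg 15 + i * n ∧
      s'.samples = i ∧ s'.mem = writeSeg s.mem (s.reg 15) (i * n) (sampleVal ω))
    h20 h4 rfl rfl (by norm_num) (by simp [writeSeg_zero, hs]) ?_
  rintro i s₁ - hF ⟨h15, hc, hm⟩
  have e0 := hF.reg 0 rfl
  simp [wp_seq, wp_sample, wp_add, MState.setReg, MState.writePt, h15, hc, hm, e0, h0]
  refine ⟨by ring, ?_⟩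
  funext x
  by_cases hx : s.reg 15 + i * n ≤ x ∧ x - (s.reg 15 + i * n) < n
  · obtain ⟨v, rfl⟩ := Nat.exists_eq_add_of_le hx.1
    have hv : v < n := by omega
    have h1 : (i + 1) * n = i * n + n := by ring
    rw [dif_pos hx, writeSeg, if_pos (by omega)]
    have := sampleVal_mul_add ω i ⟨v, hv⟩
    rw [show s.reg 15 + i * n + v - s.reg 15 = i * n + v by omega, this]
    simp
  · rw [dif_neg hx]
    have h1 : (i + 1) * n = i * n + n := by ring
    unfold writeSeg
    split_ifs <;> first | rfl | omega

/-- Compute in the first `n` memory cells the groups of the coordinates. -/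
def progHash : Prog :=
  .add 20 9 26 ;; .times 20 (.const 27 0 ;; .add 21 0 26 ;;
    .times 21 (.load 24 27 ;; .add 24 24 24 ;; .coin 25 ;; .add 24 24 25 ;; .store 27 24 ;;
      .add 27 27 4))

/-- The group of coordinate `x` as computed from the coins. -/
def hashVal (ω : Tape n) (lam x : ℕ) : ℕ := bitsVal (fun s => coinVal ω (s * n + x)) lam

/-- Each pass doubles the stored numbers and adds a fresh coin, so coin `s * n + x` becomes digit
`s` of the group of coordinate `x`. -/
theorem wp_hash {s : MState n} (lam : ℕ) (h9 : s.reg 9 = lam) (h0 : s.reg 0 = n)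
    (h4 : s.reg 4 = 1) (h26 : s.reg 26 = 0) (hmem : s.mem = fun _ => 0) (hcoins : s.coins = 0) :
    wp f ω progHash (fun t s' => t ≤ lam * (n * 8 + 5) + 2 ∧ s'.coins = lam * n ∧
      s'.mem = writeSeg (fun _ => 0) 0 n (hashVal ω lam)) s := by
  rw [progHash, wp_seq, wp_add]
  refine (wp_times lam (n * 8 + 3) (fun i s' => s'.coins = i * n ∧
      s'.mem = writeSeg (fun _ => 0) 0 n (hashVal ω i)) (by simp [MState.setReg, h9, h26])
    (by simp [MState.setReg, h4]) rfl rfl (by norm_num) ?_ ?_).mono ?_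
  · simp only [MState.setReg, hmem, hcoins, zero_mul, true_and]
    funext x; simp [writeSeg, hashVal, bitsVal]
  · rintro i s₁ - hF ⟨hc, hm⟩
    have e0 := hF.reg 0 rfl
    have e4 := hF.reg 4 rfl
    have e26 := hF.reg 26 rfl
    rw [wp_seq, wp_const, wp_seq, wp_add]
    refine (wp_times n 6 (fun j s' => s'.reg 27 = j ∧ s'.coins = i * n + j ∧
      s'.mem = writeSeg (writeSeg (fun _ => 0) 0 n (hashVal ω i)) 0 j (hashVal ω (i + 1)))
      ?_ ?_ rfl rfl (by norm_num) ?_ ?_).mono ?_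
    · simp [MState.setReg, e0, e26, h0, h26]
    · simp [MState.setReg, e4, h4]
    · simp [MState.setReg, hc, hm, writeSeg_zero]
    · rintro j s₂ hj hF₂ ⟨h27, hc, hm⟩
      have e4' := hF₂.reg 4 rfl
      have hl : writeSeg (writeSeg (fun _ => 0) 0 n (hashVal ω i)) 0 j (hashVal ω (i + 1)) j =
          hashVal ω i j := by
        rw [writeSeg_of_ge (by omega), writeSeg, if_pos (by omega), Nat.sub_zero]
      simp [wp_seq, wp_coin, wp_store, wp_add, wp_load, MState.setReg, MState.setMem, h27, hc, hm,
        e4', e4, h4, hl]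
      exact ⟨rfl, update_writeSeg (by omega) rfl⟩
    · rintro t s' - ⟨ht, h27, hc, hm⟩
      refine ⟨by omega, fun c => ⟨?_, ?_⟩⟩
      · simp [MState.setReg, hc]; ring
      · simp [MState.setReg, hm, writeSeg_writeSeg]
  · rintro t s' - ⟨ht, hc, hm⟩
    exact ⟨by linarith, hc, hm⟩

end Setup

/-! ### Computing the parameters -/

section Parameters

variable {n : ℕ} {f : BoolFn n} {ω : Tape n}

theorem exists_kap (k : ℕ) : ∃ i, k + 1 ≤ 2 ^ (4 + i) :=
  ⟨k, Nat.lt_two_pow_self.trans_le (Nat.pow_le_pow_right (by norm_num) (by omega))⟩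

open Classical in
/-- A number, at least four, of binary digits that suffices for `k`. -/
noncomputable def kapOf (k : ℕ) : ℕ := 4 + Nat.find (exists_kap k)

theorem four_le_kapOf (k : ℕ) : 4 ≤ kapOf k := Nat.le_add_right _ _

theorem kapOf_pos (k : ℕ) : 0 < kapOf k := by have := four_le_kapOf k; omega

theorem le_two_pow_kapOf (k : ℕ) : k + 1 ≤ 2 ^ kapOf k := by
  classical exact Nat.find_spec (exists_kap k)

theorem lt_of_lt_kapOf {k i : ℕ} (h : 4 + i < kapOf k) : 2 ^ (4 + i) < k + 1 := by
  classical exact not_le.1 (Nat.find_min (exists_kap k) (m := i) (by unfold kapOf at h; omega))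

theorem kapOf_le (k : ℕ) : kapOf k ≤ 4 + k := by
  classical
  refine Nat.add_le_add_left (Nat.find_min' _ ?_) _
  exact Nat.lt_two_pow_self.trans_le (Nat.pow_le_pow_right (by norm_num) (by omega))

/-- The least such exponent keeps `κ * 2 ^ lam` of order `k + κ`, so that 24κ² values for each group
amount to O(k log k + 1) in all. -/
theorem exists_lam (k : ℕ) : ∃ i, k + 1 ≤ kapOf k * 2 ^ i :=
  ⟨kapOf k, (le_two_pow_kapOf k).trans (Nat.le_mul_of_pos_left _ (kapOf_pos k))⟩

open Classical in
/-- The binary logarithm of the number of groups. -/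
noncomputable def lamOf (k : ℕ) : ℕ := Nat.find (exists_lam k)

theorem le_kapOf_mul (k : ℕ) : k + 1 ≤ kapOf k * 2 ^ lamOf k := by
  classical exact Nat.find_spec (exists_lam k)

theorem lt_of_lt_lamOf {k i : ℕ} (h : i < lamOf k) : kapOf k * 2 ^ i < k + 1 := by
  classical exact not_le.1 (Nat.find_min (exists_lam k) h)

theorem lamOf_le (k : ℕ) : lamOf k ≤ kapOf k := by
  classical
  exact Nat.find_min' _ ((le_two_pow_kapOf k).trans
    (Nat.le_mul_of_pos_left _ (kapOf_pos k)))

/-- The number of values of the self-corrected function in the rank test. -/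
noncomputable def rankSize (k : ℕ) : ℕ := 2 ^ lamOf k * (4 * kapOf k * (6 * kapOf k))

/-- The number of samples, `2 b / a` rounded up. -/
def sampleCount (a b : ℕ) : ℕ := (2 * b - 1) / a + 1

/-- Identifies the count with the number of subtractions of `a` that bring `2 * b` to zero, which is
how the machine divides. -/
theorem lt_sampleCount_iff {a b i : ℕ} (ha : 0 < a) (hb : 0 < b) :
    i < sampleCount a b ↔ i * a < 2 * b := by
  rw [sampleCount, Nat.lt_succ_iff, Nat.le_div_iff_mul_le ha]
  omega

/-- Compute the number of binary digits. -/
def progKap : Prog :=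
  .const 4 1 ;; .const 5 4 ;; .const 6 16 ;; .add 24 1 4 ;; .sub 7 24 6 ;;
    .loop 7 (.add 6 6 6 ;; .add 5 5 4 ;; .sub 7 24 6)

/-- Register 7 holds the truncated difference of k + 1 and the current power of two, which is
nonzero exactly while that power is too small. -/
theorem wp_kap {s : MState n} {k : ℕ} (h1 : s.reg 1 = k) :
    wp f ω progKap (fun t s' => t ≤ k * 4 + 6 ∧ s'.reg 4 = 1 ∧ s'.reg 5 = kapOf k ∧
      s'.reg 24 = k + 1) s := by
  rw [progKap]
  simp only [wp_seq, wp_const, wp_add, wp_sub]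
  have hk := four_le_kapOf k
  refine (wp_loop (kapOf k - 4) 3 (fun i s' => s'.reg 4 = 1 ∧ s'.reg 5 = 4 + i ∧
    s'.reg 6 = 2 ^ (4 + i) ∧ s'.reg 24 = k + 1 ∧ s'.reg 7 = k + 1 - 2 ^ (4 + i)) ?_ ?_ ?_).mono ?_
  · simp [MState.setReg, h1]
  · rintro s' ⟨-, -, -, -, h7⟩
    rw [h7, Nat.add_sub_cancel' hk, Nat.sub_eq_zero_of_le (le_two_pow_kapOf k)]
  · rintro i s₁ hi - ⟨h4, h5, h6, h24, h7⟩
    have := lt_of_lt_kapOf (k := k) (i := i) (by omega)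
    refine ⟨by omega, ?_⟩
    simp [wp_seq, wp_add, wp_sub, MState.setReg, h4, h5, h6, h24]
    refine ⟨by ring, by ring, ?_⟩
    congr 1; ring
  · rintro t s' - ⟨ht, h4, h5, -, h24, -⟩
    refine ⟨?_, h4, by omega, h24⟩
    have := kapOf_le k
    have : (kapOf k - 4) * (3 + 1) ≤ k * 4 := Nat.mul_le_mul_right _ (by omega)
    omega

/-- Compute the number of groups and its logarithm. -/
def progLam : Prog :=
  .const 8 1 ;; .const 9 0 ;; .add 6 5 9 ;; .sub 7 24 6 ;;
    .loop 7 (.add 6 6 6 ;; .add 8 8 8 ;; .add 9 9 4 ;; .sub 7 24 6)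

theorem wp_lam {s : MState n} {k : ℕ} (h4 : s.reg 4 = 1) (h5 : s.reg 5 = kapOf k)
    (h24 : s.reg 24 = k + 1) :
    wp f ω progLam (fun t s' => t ≤ kapOf k * 5 + 5 ∧ s'.reg 8 = 2 ^ lamOf k ∧
      s'.reg 9 = lamOf k) s := by
  rw [progLam]
  simp only [wp_seq, wp_const, wp_add, wp_sub]
  refine (wp_loop (lamOf k) 4 (fun i s' => s'.reg 4 = 1 ∧ s'.reg 9 = i ∧ s'.reg 8 = 2 ^ i ∧
    s'.reg 6 = kapOf k * 2 ^ i ∧ s'.reg 24 = k + 1 ∧ s'.reg 7 = k + 1 - kapOf k * 2 ^ i) ?_ ?_ ?_).mono ?_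
  · simp [MState.setReg, h4, h5, h24]
  · rintro s' ⟨-, -, -, -, -, h7⟩
    rw [h7, Nat.sub_eq_zero_of_le (le_kapOf_mul k)]
  · rintro i s₁ hi - ⟨h4, h9, h8, h6, h24, h7⟩
    have := lt_of_lt_lamOf hi
    refine ⟨by omega, ?_⟩
    simp [wp_seq, wp_add, wp_sub, MState.setReg, h4, h9, h8, h6, h24]
    refine ⟨by ring, by ring, ?_⟩
    congr 1; ring
  · rintro t s' - ⟨ht, h4, h9, h8, -, -, -⟩
    refine ⟨?_, h8, h9⟩
    have : lamOf k * (4 + 1) ≤ kapOf k * 5 := Nat.mul_le_mul_right _ (lamOf_le k)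
    omega

/-- Compute the dimensions of the matrices and their size. -/
def progDims : Prog :=
  .const 26 0 ;; .add 10 5 5 ;; .add 10 10 10 ;; .add 11 10 5 ;; .add 11 11 5 ;;
  .const 39 0 ;; .add 20 10 26 ;; .times 20 (.add 39 39 11)

theorem wp_dims {s : MState n} {k : ℕ} (h4 : s.reg 4 = 1) (h5 : s.reg 5 = kapOf k) :
    wp f ω progDims (fun t s' => t ≤ 4 * kapOf k * 3 + 8 ∧
      s'.reg 26 = 0 ∧ s'.reg 10 = 4 * kapOf k ∧ s'.reg 11 = 6 * kapOf k ∧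
      s'.reg 39 = 4 * kapOf k * (6 * kapOf k)) s := by
  rw [progDims]
  simp only [wp_seq, wp_const, wp_add]
  refine (wp_times (4 * kapOf k) 1 (fun i s' => s'.reg 39 = i * (6 * kapOf k)) ?_ ?_ rfl rfl
    (by norm_num) ?_ ?_).mono ?_
  · simp [MState.setReg, h5]; ring
  · simp [MState.setReg, h4]
  · simp [MState.setReg]
  · rintro i s₁ - hF h
    have e11 := hF.reg 11 rfl
    simp [wp_add, MState.setReg, h, e11, h5]
    ring
  · rintro t s' hF ⟨ht, h39⟩
    have e10 := hF.reg 10 rfl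
    have e11 := hF.reg 11 rfl
    have e26 := hF.reg 26 rfl
    simp [MState.setReg, h5] at e10 e11 e26
    exact ⟨by omega, e26, by omega, by omega, h39⟩

/-- Compute the number of values in the rank test and of rounds of the linearity test. -/
def progRounds : Prog :=
  .const 12 0 ;; .add 20 8 26 ;; .times 20 (.add 12 12 39) ;;
  .add 13 12 12 ;; .add 13 13 13 ;; .add 13 13 13 ;; .add 13 13 13 ;; .add 13 13 13

/-- Multiplication is repeated addition. Soundness needs 24 rounds for each value; five doublings
give 32. -/
theorem wp_rounds {s : MState n} {k : ℕ} (h4 : s.reg 4 = 1) (h26 : s.reg 26 = 0)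
    (h8 : s.reg 8 = 2 ^ lamOf k) (h39 : s.reg 39 = 4 * kapOf k * (6 * kapOf k)) :
    wp f ω progRounds (fun t s' => t ≤ 2 ^ lamOf k * 3 + 8 ∧ s'.reg 12 = rankSize k ∧
      s'.reg 13 = 32 * rankSize k) s := by
  rw [progRounds]
  simp only [wp_seq, wp_const, wp_add]
  refine (wp_times (2 ^ lamOf k) 1 (fun i s' => s'.reg 12 = i * (4 * kapOf k * (6 * kapOf k))) ?_ ?_
    rfl rfl (by norm_num) ?_ ?_).mono ?_
  · simp [MState.setReg, h8, h26]
  · simp [MState.setReg, h4]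
  · simp [MState.setReg]
  · rintro i s₂ - hF h
    have e39 := hF.reg 39 rfl
    simp [wp_add, MState.setReg, h, e39, h39]
    ring
  · rintro t s' hF ⟨ht, h12⟩
    simp only [MState.setReg, Function.update_self, h12]
    refine ⟨by omega, ?_, ?_⟩
    · simp [h12, rankSize]
    · rw [rankSize]; ring

/-- Compute the number of samples. -/
def progCount : Prog :=
  .const 14 0 ;; .add 7 3 3 ;; .loop 7 (.add 14 14 4 ;; .sub 7 7 2)

theorem wp_count {s : MState n} {a b : ℕ} (ha : 0 < a) (hb : 0 < b) (h2 : s.reg 2 = a)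
    (h3 : s.reg 3 = b) (h4 : s.reg 4 = 1) :
    wp f ω progCount (fun t s' => t ≤ sampleCount a b * 3 + 3 ∧ s'.reg 14 = sampleCount a b) s := by
  rw [progCount]
  simp only [wp_seq, wp_const, wp_add]
  refine (wp_loop (sampleCount a b) 2 (fun i s' => s'.reg 14 = i ∧ s'.reg 7 = 2 * b - i * a)
    ?_ ?_ ?_).mono ?_
  · simp [MState.setReg, h3]; ring
  · rintro s' ⟨-, h7⟩
    rw [h7]
    have := (lt_sampleCount_iff (i := sampleCount a b) ha hb).not.1 (lt_irrefl _)
    omega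
  · rintro i s₃ hi hF ⟨h14, h7⟩
    have e2 := hF.reg 2 rfl
    have e4 := hF.reg 4 rfl
    rw [lt_sampleCount_iff ha hb] at hi
    refine ⟨by omega, ?_⟩
    simp [wp_seq, wp_add, wp_sub, MState.setReg, h14, h7, e2, e4, h2, h4]
    rw [add_mul]; omega
  · rintro t s' hF ⟨ht, h14, -⟩
    exact ⟨by omega, h14⟩

end Parameters

/-! ### Writing the points of the rank test -/

section Points

variable {n : ℕ} {f : BoolFn n} {ω : Tape n}

/-- Write the point that is the product of the points at `R[29]` and `R[30]` on the group `R[28]`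
and zero elsewhere. -/
def progPoint : Prog :=
  .const 27 0 ;; .add 31 29 26 ;; .add 23 0 26 ;; .times 23 (
    .load 24 27 ;; .sub 25 24 28 ;; .sub 24 28 24 ;; .add 24 24 25 ;; .load 25 31 ;; .load 32 30 ;;
    .add 25 25 32 ;; .sub 25 25 4 ;; .sub 25 25 24 ;; .store 15 25 ;; .add 15 15 4 ;;
    .add 27 27 4 ;; .add 31 31 4 ;; .add 30 30 4)

/-- The product of two bits if `h = l` and zero otherwise. -/
def cellVal (h l x y : ℕ) : ℕ := x + y - 1 - (l - h + (h - l))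

/-- For bits, the truncated `x + y - 1` is their product; subtracting the distance between the group
numbers annihilates it off the group. All inputs lie below `top`, so the writes do not disturb them.
Register 30 is left at the next point. -/
theorem wp_point {s : MState n} {l pa pb top : ℕ} (h0 : s.reg 0 = n) (h4 : s.reg 4 = 1)
    (h26 : s.reg 26 = 0) (h28 : s.reg 28 = l) (h29 : s.reg 29 = pa) (h30 : s.reg 30 = pb)
    (h15 : s.reg 15 = top) (hn : n ≤ top) (ha : pa + n ≤ top) (hb : pb + n ≤ top) :
    wp f ω progPoint (fun t s' => t ≤ n * 16 + 4 ∧ s'.reg 15 = top + n ∧ s'.reg 30 = pb + n ∧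
      s'.mem = writeSeg s.mem top n fun v => cellVal (s.mem v) l (s.mem (pa + v)) (s.mem (pb + v))) s := by
  rw [progPoint]
  simp only [wp_seq, wp_const, wp_add]
  refine (wp_times n 14 (fun v s' => s'.reg 27 = v ∧ s'.reg 31 = pa + v ∧ s'.reg 30 = pb + v ∧
    s'.reg 15 = top + v ∧ s'.mem = writeSeg s.mem top v
      fun v => cellVal (s.mem v) l (s.mem (pa + v)) (s.mem (pb + v))) ?_ ?_ rfl rfl (by norm_num)
      ?_ ?_).mono ?_
  · simp [MState.setReg, h0, h26]
  · simp [MState.setReg, h4]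
  · simp [MState.setReg, h26, h29, h30, h15, writeSeg_zero]
  · rintro v s₁ hv hF ⟨h27, h31, h30, h15, hm⟩
    have e4 := hF.reg 4 rfl
    have e28 := hF.reg 28 rfl
    simp [MState.setReg, h4, h28] at e4 e28
    have r1 : s₁.mem v = s.mem v := by rw [hm, writeSeg_of_lt (by omega)]
    have r2 : s₁.mem (pa + v) = s.mem (pa + v) := by rw [hm, writeSeg_of_lt (by omega)]
    have r3 : s₁.mem (pb + v) = s.mem (pb + v) := by rw [hm, writeSeg_of_lt (by omega)]
    simp [wp_seq, wp_store, wp_add, wp_sub, wp_load, MState.setReg, MState.setMem, h27, h31, h30, h15,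
      e4, e28, r1, r2, r3]
    refine ⟨rfl, rfl, rfl, ?_⟩
    rw [hm]
    exact update_writeSeg rfl rfl
  · rintro t s' - ⟨ht, -, -, h30, h15, hm⟩
    exact ⟨by omega, h15, h30, hm⟩

/-- Write the points that belong to a row of a matrix. -/
def progRow : Prog := .add 30 16 26 ;; .add 22 11 26 ;; .times 22 progPoint

theorem wp_row {s : MState n} {l pa pb σ top : ℕ} (h0 : s.reg 0 = n) (h4 : s.reg 4 = 1)
    (h26 : s.reg 26 = 0) (h28 : s.reg 28 = l) (h29 : s.reg 29 = pa) (h16 : s.reg 16 = pb)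
    (h11 : s.reg 11 = σ) (h15 : s.reg 15 = top) (hn : n ≤ top) (ha : pa + n ≤ top)
    (hb : pb + σ * n ≤ top) :
    wp f ω progRow (fun t s' => t ≤ σ * (n * 16 + 6) + 3 ∧ s'.reg 15 = top + σ * n ∧
      s'.mem = writeSeg s.mem top (σ * n) fun x =>
        cellVal (s.mem (x % n)) l (s.mem (pa + x % n)) (s.mem (pb + x))) s := by
  rw [progRow]
  simp only [wp_seq, wp_add]
  refine (wp_times σ (n * 16 + 4) (fun j s' => s'.reg 30 = pb + j * n ∧ s'.reg 15 = top + j * n ∧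
    s'.mem = writeSeg s.mem top (j * n) fun x =>
        cellVal (s.mem (x % n)) l (s.mem (pa + x % n)) (s.mem (pb + x))) ?_ ?_ rfl rfl (by norm_num)
      ?_ ?_).mono ?_
  · simp [MState.setReg, h11, h26]
  · simp [MState.setReg, h4]
  · simp [MState.setReg, h26, h16, h15, writeSeg_zero]
  · rintro j s₁ hj hF ⟨h30, h15, hm⟩
    have e0 := hF.reg 0 rfl
    have e4 := hF.reg 4 rfl
    have e26 := hF.reg 26 rfl
    have e28 := hF.reg 28 rfl
    have e29 := hF.reg 29 rfl
    simp [MState.setReg, h0, h4, h26, h28, h29] at e0 e4 e26 e28 e29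
    have hjn : j * n + n ≤ σ * n := by nlinarith
    refine (wp_point e0 e4 e26 e28 e29 h30 h15 (by omega) (by omega) (by omega)).mono ?_
    rintro t s' - ⟨ht, h15', h30', hm'⟩
    refine ⟨ht, fun c => ⟨?_, ?_, ?_⟩⟩
    · simp [MState.setReg, h30']; ring
    · simp [MState.setReg, h15']; ring
    · simp only [MState.setReg]
      rw [hm', hm]
      refine writeSeg_block fun y hy => ?_
      rw [mul_add_mod_of_lt hy, writeSeg_of_lt (by omega), writeSeg_of_lt (by omega),
        writeSeg_of_lt (by omega), add_assoc]
  · rintro t s' - ⟨ht, -, h15, hm⟩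
    exact ⟨by linarith, h15, hm⟩

/-- Write the points that belong to a matrix. -/
def progMatrix : Prog := .add 29 0 26 ;; .add 21 10 26 ;; .times 21 (progRow ;; .add 29 29 0)

theorem wp_matrix {s : MState n} {l pb ρ σ top : ℕ} (h0 : s.reg 0 = n) (h4 : s.reg 4 = 1)
    (h26 : s.reg 26 = 0) (h28 : s.reg 28 = l) (h16 : s.reg 16 = pb)
    (h10 : s.reg 10 = ρ) (h11 : s.reg 11 = σ) (h15 : s.reg 15 = top) (ha : n + ρ * n ≤ top)
    (hb : pb + σ * n ≤ top) :
    wp f ω progMatrix (fun t s' => t ≤ ρ * (σ * (n * 16 + 6) + 6) + 3 ∧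
      s'.reg 15 = top + ρ * (σ * n) ∧
      s'.mem = writeSeg s.mem top (ρ * (σ * n)) fun x =>
        cellVal (s.mem (x % (σ * n) % n)) l (s.mem (n + (x / (σ * n)) * n + x % (σ * n) % n))
          (s.mem (pb + x % (σ * n)))) s := by
  rw [progMatrix]
  simp only [wp_seq, wp_add]
  refine (wp_times ρ (σ * (n * 16 + 6) + 4) (fun i s' => s'.reg 29 = n + i * n ∧
    s'.reg 15 = top + i * (σ * n) ∧
    s'.mem = writeSeg s.mem top (i * (σ * n)) fun x =>
        cellVal (s.mem (x % (σ * n) % n)) l (s.mem (n + (x / (σ * n)) * n + x % (σ * n) % n))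
          (s.mem (pb + x % (σ * n)))) ?_ ?_ rfl rfl (by norm_num) ?_ ?_).mono ?_
  · simp [MState.setReg, h10, h26]
  · simp [MState.setReg, h4]
  · simp [MState.setReg, h26, h0, h15, writeSeg_zero]
  · rintro i s₁ hi hF ⟨h29, h15, hm⟩
    have e0 := hF.reg 0 rfl
    have e4 := hF.reg 4 rfl
    have e26 := hF.reg 26 rfl
    have e28 := hF.reg 28 rfl
    have e16 := hF.reg 16 rfl
    have e11 := hF.reg 11 rfl
    simp [MState.setReg, h0, h4, h26, h28, h16, h11] at e0 e4 e26 e28 e16 e11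
    have hin : i * n + n ≤ ρ * n := by nlinarith
    rw [wp_seq]
    refine (wp_row e0 e4 e26 e28 h29 e16 e11 h15 (by omega) (by omega) (by omega)).mono ?_
    rintro t s' hF' ⟨ht, h15', hm'⟩
    have e29 := hF'.reg 29 rfl
    have e0' := hF'.reg 0 rfl
    rw [wp_add]
    refine ⟨by omega, fun c => ⟨?_, ?_, ?_⟩⟩
    · simp [MState.setReg, e29, e0', e0, h29]; ring
    · simp [MState.setReg, h15']; ring
    · simp only [MState.setReg]
      rw [hm', hm]
      refine writeSeg_block fun y hy => ?_
      have hn : 0 < n := by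
        rcases Nat.eq_zero_or_pos n with h | h
        · subst h; simp at hy
        · exact h
      have hy' := Nat.mod_lt y hn
      rw [mul_add_mod_of_lt hy, mul_add_div_of_lt hy, writeSeg_of_lt (by omega),
        writeSeg_of_lt (by omega), writeSeg_of_lt (by omega)]
  · rintro t s' - ⟨ht, -, h15, hm⟩
    exact ⟨by linarith, h15, hm⟩

/-- Write the points of the rank test. -/
def progPoints : Prog := .const 28 0 ;; .add 20 8 26 ;; .times 20 (progMatrix ;; .add 28 28 4)

/-- The coordinates of the points of the rank test, listed in the order in which they are written. -/
def pointVal (mem : ℕ → ℕ) (n pb ρ σ x : ℕ) : ℕ :=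
  cellVal (mem (x % (ρ * (σ * n)) % (σ * n) % n)) (x / (ρ * (σ * n)))
    (mem (n + (x % (ρ * (σ * n)) / (σ * n)) * n + x % (ρ * (σ * n)) % (σ * n) % n))
    (mem (pb + x % (ρ * (σ * n)) % (σ * n)))

/-- Decodes the mixed-radix address into group, row, column and coordinate. -/
theorem pointVal_eq (mem : ℕ → ℕ) {n pb ρ σ l i j v : ℕ} (hi : i < ρ) (hj : j < σ) (hv : v < n) :
    pointVal mem n pb ρ σ (((l * ρ + i) * σ + j) * n + v) =
      cellVal (mem v) l (mem (n + i * n + v)) (mem (pb + j * n + v)) := by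
  have h1 : j * n + v < σ * n := by nlinarith
  have h2 : i * (σ * n) + (j * n + v) < ρ * (σ * n) := by
    have : (i + 1) * (σ * n) ≤ ρ * (σ * n) := Nat.mul_le_mul_right _ hi
    rw [add_mul] at this
    omega
  have e : ((l * ρ + i) * σ + j) * n + v = l * (ρ * (σ * n)) + (i * (σ * n) + (j * n + v)) := by ring
  rw [e, pointVal, mul_add_div_of_lt h2, mul_add_mod_of_lt h2, mul_add_div_of_lt h1,
    mul_add_mod_of_lt h1, mul_add_mod_of_lt hv, add_assoc pb]

theorem wp_points {s : MState n} {L pb ρ σ top : ℕ} (h0 : s.reg 0 = n) (h4 : s.reg 4 = 1)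
    (h26 : s.reg 26 = 0) (h8 : s.reg 8 = L) (h16 : s.reg 16 = pb)
    (h10 : s.reg 10 = ρ) (h11 : s.reg 11 = σ) (h15 : s.reg 15 = top) (ha : n + ρ * n ≤ top)
    (hb : pb + σ * n ≤ top) :
    wp f ω progPoints (fun t s' => t ≤ L * (ρ * (σ * (n * 16 + 6) + 6) + 6) + 3 ∧
      s'.reg 15 = top + L * (ρ * (σ * n)) ∧
      s'.mem = writeSeg s.mem top (L * (ρ * (σ * n))) (pointVal s.mem n pb ρ σ)) s := by
  rw [progPoints]
  simp only [wp_seq, wp_add, wp_const]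
  refine (wp_times L (ρ * (σ * (n * 16 + 6) + 6) + 4) (fun l s' => s'.reg 28 = l ∧
    s'.reg 15 = top + l * (ρ * (σ * n)) ∧
    s'.mem = writeSeg s.mem top (l * (ρ * (σ * n))) (pointVal s.mem n pb ρ σ))
    ?_ ?_ rfl rfl (by norm_num) ?_ ?_).mono ?_
  · simp [MState.setReg, h8, h26]
  · simp [MState.setReg, h4]
  · simp [MState.setReg, h15, writeSeg_zero]
  · rintro l s₁ hl hF ⟨h28, h15, hm⟩
    have e0 := hF.reg 0 rfl
    have e4 := hF.reg 4 rfl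
    have e26 := hF.reg 26 rfl
    have e16 := hF.reg 16 rfl
    have e10 := hF.reg 10 rfl
    have e11 := hF.reg 11 rfl
    simp [MState.setReg, h0, h4, h26, h16, h10, h11] at e0 e4 e26 e16 e10 e11
    rw [wp_seq]
    refine (wp_matrix e0 e4 e26 h28 e16 e10 e11 h15 (by omega) (by omega)).mono ?_
    rintro t s' hF' ⟨ht, h15', hm'⟩
    have e28 := hF'.reg 28 rfl
    have e4' := hF'.reg 4 rfl
    rw [wp_add]
    refine ⟨by omega, fun c => ⟨?_, ?_, ?_⟩⟩
    · simp [MState.setReg, e28, e4', e4, h28]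
    · simp [MState.setReg, h15']; ring
    · simp only [MState.setReg]
      rw [hm', hm]
      refine writeSeg_block fun y hy => ?_
      have hn : 0 < n := by
        rcases Nat.eq_zero_or_pos n with h | h
        · subst h; simp at hy
        · exact h
      have hσ : 0 < σ * n := by
        rcases Nat.eq_zero_or_pos (σ * n) with h | h
        · rw [h] at hy; simp at hy
        · exact h
      have h1 : y / (σ * n) < ρ := Nat.div_lt_of_lt_mul (by rwa [mul_comm])
      have h2 : y % (σ * n) < σ * n := Nat.mod_lt y hσ
      have h3 : y % (σ * n) % n < n := Nat.mod_lt _ hn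
      have h4 : y / (σ * n) * n + n ≤ ρ * n := by nlinarith
      rw [pointVal, mul_add_mod_of_lt hy, mul_add_div_of_lt hy, writeSeg_of_lt (by omega),
        writeSeg_of_lt (by omega), writeSeg_of_lt (by omega)]
  · rintro t s' - ⟨ht, -, h15, hm⟩
    exact ⟨by linarith, h15, hm⟩

end Points

/-! ### Performing the queries -/

section Queries

variable {n : ℕ} {f : BoolFn n} {ω : Tape n}

/-- The point stored from address `j` on. -/
def memPt (n : ℕ) (mem : ℕ → ℕ) (j : ℕ) : Pt n := fun i => if mem (j + i) = 0 then 0 else 1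

theorem memPt_congr {mem mem' : ℕ → ℕ} {j : ℕ} (h : ∀ v < n, mem (j + v) = mem' (j + v)) :
    memPt n mem j = memPt n mem' j := by
  funext v; simp only [memPt, h v v.2]

/-- The absolute difference, which is the exclusive or of two bits. -/
def xorVal (x y : ℕ) : ℕ := y - x + (x - y)

theorem xorVal_val (a b : ZMod 2) : xorVal a.val b.val = (a + b).val := by
  revert a b; decide

/-- Replace the point at `R[31]` by its sum with the point at `R[30]`. -/
def progXor : Prog :=
  .add 21 0 26 ;; .times 21 (.load 28 30 ;; .load 29 31 ;; .sub 32 28 29 ;; .sub 28 29 28 ;;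
    .add 28 28 32 ;; .store 31 28 ;; .add 30 30 4 ;; .add 31 31 4)

/-- The sum overwrites the shift in place. This is harmless because each shift is used for one point
only and has already been queried. -/
theorem wp_xor {s : MState n} {pu pz : ℕ} (h0 : s.reg 0 = n) (h4 : s.reg 4 = 1)
    (h26 : s.reg 26 = 0) (h30 : s.reg 30 = pu) (h31 : s.reg 31 = pz) (hle : pu + n ≤ pz) :
    wp f ω progXor (fun t s' => t ≤ n * 10 + 2 ∧ s'.reg 30 = pu + n ∧ s'.reg 31 = pz + n ∧
      s'.mem = writeSeg s.mem pz n fun v => xorVal (s.mem (pu + v)) (s.mem (pz + v))) s := by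
  rw [progXor]
  simp only [wp_seq, wp_add]
  refine (wp_times n 8 (fun v s' => s'.reg 30 = pu + v ∧ s'.reg 31 = pz + v ∧
    s'.mem = writeSeg s.mem pz v fun v => xorVal (s.mem (pu + v)) (s.mem (pz + v)))
      ?_ ?_ rfl rfl (by norm_num) ?_ ?_).mono ?_
  · simp [MState.setReg, h0, h26]
  · simp [MState.setReg, h4]
  · simp [MState.setReg, h30, h31, writeSeg_zero]
  · rintro v s₁ hv hF ⟨h30, h31, hm⟩
    have e4 := hF.reg 4 rfl
    simp [MState.setReg, h4] at e4
    have r1 : s₁.mem (pu + v) = s.mem (pu + v) := by rw [hm, writeSeg_of_lt (by omega)]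
    have r2 : s₁.mem (pz + v) = s.mem (pz + v) := by rw [hm, writeSeg_of_ge (by omega)]
    simp [wp_seq, wp_store, wp_add, wp_sub, wp_load, MState.setReg, MState.setMem, h30, h31, e4, r1, r2]
    refine ⟨rfl, rfl, ?_⟩
    rw [hm]
    exact update_writeSeg rfl rfl
  · rintro t s' - ⟨ht, h30, h31, hm⟩
    exact ⟨by omega, h30, h31, hm⟩

theorem memPt_xor {mem : ℕ → ℕ} {pu pz : ℕ} (hu : ∀ v < n, mem (pu + v) < 2)
    (hz : ∀ v < n, mem (pz + v) < 2) :
    memPt n (writeSeg mem pz n fun v => xorVal (mem (pu + v)) (mem (pz + v))) pz =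
      memPt n mem pu + memPt n mem pz := by
  funext v
  have h1 := hu v v.2
  have h2 := hz v v.2
  simp only [memPt, Pi.add_apply, writeSeg_add v.2]
  have h : (1 + 1 : ZMod 2) = 0 := by decide
  generalize mem (pu + v) = x at *
  generalize mem (pz + v) = y at *
  interval_cases x <;> interval_cases y <;> simp [xorVal, h]

/-- Query a point, a shift and their sum, record the value of the self-corrected function at the
point and count the point if the function differs there from its self-correction. -/
def progTriple : Prog :=
  .query 24 30 ;; .query 25 31 ;; .add 27 31 26 ;; progXor ;; .query 28 27 ;;
  .sub 29 25 28 ;; .sub 25 28 25 ;; .add 25 25 29 ;; .store 15 25 ;; .add 15 15 4 ;;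
  .sub 29 24 25 ;; .sub 25 25 24 ;; .add 25 25 29 ;; .add 34 34 25

/-- The same triple serves as a round of the linearity test, as a consistency check and as a
self-corrected value. Register 34 accumulates the discrepancies; the value is stored for the rank
computation. -/
theorem wp_triple {s : MState n} {pu pz top : ℕ} (h0 : s.reg 0 = n) (h4 : s.reg 4 = 1)
    (h26 : s.reg 26 = 0) (h30 : s.reg 30 = pu) (h31 : s.reg 31 = pz) (h15 : s.reg 15 = top)
    (hle : pu + n ≤ pz)
    (hu : ∀ v < n, s.mem (pu + v) < 2) (hz : ∀ v < n, s.mem (pz + v) < 2) :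
    wp f ω progTriple (fun t s' => t ≤ n * 13 + 15 ∧ s'.reg 30 = pu + n ∧ s'.reg 31 = pz + n ∧
      s'.reg 15 = top + 1 ∧
      s'.reg 34 = s.reg 34 + (f (memPt n s.mem pu) +
        (f (memPt n s.mem pz) + f (memPt n s.mem pu + memPt n s.mem pz))).val ∧
      s'.queries = s.queries ++ [memPt n s.mem pu, memPt n s.mem pz,
        memPt n s.mem pu + memPt n s.mem pz] ∧
      s'.mem = Function.update
        (writeSeg s.mem pz n fun v => xorVal (s.mem (pu + v)) (s.mem (pz + v))) top
        (f (memPt n s.mem pz) + f (memPt n s.mem pu + memPt n s.mem pz)).val) s := by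
  have hread : ∀ (s : MState n) j, s.readPt j = memPt n s.mem j := fun _ _ => rfl
  rw [progTriple]
  simp only [wp_seq, wp_query, wp_add]
  refine (wp_xor (pu := pu) (pz := pz) ?_ ?_ ?_ ?_ ?_ hle).mono ?_
  iterate 5 simp [MState.setReg, h0, h4, h26, h30, h31]
  rintro t s' hF ⟨ht, h30', h31', hm⟩
  have e4 := hF.reg 4 rfl
  have e15 := hF.reg 15 rfl
  have e24 := hF.reg 24 rfl
  have e25 := hF.reg 25 rfl
  have e27 := hF.reg 27 rfl
  have e34 := hF.reg 34 rfl
  have eq := hF.queries rfl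
  simp [MState.setReg, h4, h26, h30, h31, h15, hread] at e4 e15 e24 e25 e27 e34 eq hm
  have hx : memPt n s'.mem pz = memPt n s.mem pu + memPt n s.mem pz := by
    rw [hm]; exact memPt_xor hu hz
  simp only [wp_sub, wp_store, hread, MState.setReg, MState.setMem]
  simp [e4, e15, e24, e25, e27, e34, eq, h30', h31', hx]
  have x1 := xorVal_val (f (memPt n s.mem pz)) (f (memPt n s.mem pu + memPt n s.mem pz))
  have x2 := xorVal_val (f (memPt n s.mem pu))
    (f (memPt n s.mem pz) + f (memPt n s.mem pu + memPt n s.mem pz))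
  refine ⟨by omega, ?_, ?_⟩
  · rw [← x2, ← x1]; rfl
  · rw [hm, ← x1]; rfl

/-- Perform all the queries. -/
def progQueries : Prog :=
  .add 30 17 26 ;; .add 31 18 26 ;; .const 34 0 ;; .add 20 33 26 ;; .times 20 progTriple

/-- The queries of the machine. -/
def queryList (U Z : ℕ → Pt n) : ℕ → List (Pt n)
  | 0 => []
  | i + 1 => queryList U Z i ++ [U i, Z i, U i + Z i]

theorem length_queryList (U Z : ℕ → Pt n) (i : ℕ) : (queryList U Z i).length = 3 * i := by
  induction i with
  | zero => rfl
  | succ i ih => rw [queryList, List.length_append, ih]; simp; ring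

/-- The value of the self-corrected function. -/
def corrected (f : BoolFn n) (u z : Pt n) : ZMod 2 := f z + f (u + z)

theorem wp_queries {s : MState n} {N pu pz top : ℕ} (h0 : s.reg 0 = n) (h4 : s.reg 4 = 1)
    (h26 : s.reg 26 = 0) (h17 : s.reg 17 = pu) (h18 : s.reg 18 = pz) (h15 : s.reg 15 = top)
    (h33 : s.reg 33 = N)
    (hle : pu + N * n ≤ pz) (hle' : pz + N * n ≤ top) (hq : s.queries = [])
    (hu : ∀ x < N * n, s.mem (pu + x) < 2) (hz : ∀ x < N * n, s.mem (pz + x) < 2) :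
    wp f ω progQueries (fun t s' => t ≤ N * (n * 13 + 17) + 5 ∧ s'.reg 15 = top + N ∧
      s'.reg 34 = ∑ i ∈ range N, (f (memPt n s.mem (pu + i * n)) +
        corrected f (memPt n s.mem (pu + i * n)) (memPt n s.mem (pz + i * n))).val ∧
      s'.queries = queryList (fun i => memPt n s.mem (pu + i * n))
        (fun i => memPt n s.mem (pz + i * n)) N ∧
      (∀ i < N, s'.mem (top + i) =
        (corrected f (memPt n s.mem (pu + i * n)) (memPt n s.mem (pz + i * n))).val)) s := by
  rw [progQueries]
  simp only [wp_seq, wp_const, wp_add]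
  -- Since used shifts are overwritten, the invariant preserves only the cells below the shifts and
  -- the shifts not yet reached.
  refine (wp_times N (n * 13 + 15) (fun i s' => s'.reg 30 = pu + i * n ∧ s'.reg 31 = pz + i * n ∧
      s'.reg 15 = top + i ∧
      s'.reg 34 = ∑ i ∈ range i, (f (memPt n s.mem (pu + i * n)) +
        corrected f (memPt n s.mem (pu + i * n)) (memPt n s.mem (pz + i * n))).val ∧
      s'.queries = queryList (fun i => memPt n s.mem (pu + i * n))
        (fun i => memPt n s.mem (pz + i * n)) i ∧
      (∀ x < pz, s'.mem x = s.mem x) ∧ (∀ x, pz + i * n ≤ x → x < top → s'.mem x = s.mem x) ∧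
      (∀ j < i, s'.mem (top + j) =
        (corrected f (memPt n s.mem (pu + j * n)) (memPt n s.mem (pz + j * n))).val))
      ?_ ?_ rfl rfl (by norm_num) ?_ ?_).mono ?_
  · simp [MState.setReg, h33, h26]
  · simp [MState.setReg, h4]
  · simp [MState.setReg, h17, h18, h26, h15, hq, queryList]
  · rintro i s₁ hi hF ⟨h30, h31, h15, h34, hqs, hm1, hm2, hm3⟩
    have e0 := hF.reg 0 rfl
    have e4 := hF.reg 4 rfl
    have e26 := hF.reg 26 rfl
    simp [MState.setReg, h0, h4, h26] at e0 e4 e26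
    have hin : i * n + n ≤ N * n := by nlinarith
    have hU : memPt n s₁.mem (pu + i * n) = memPt n s.mem (pu + i * n) :=
      memPt_congr fun v hv => hm1 _ (by omega)
    have hZ : memPt n s₁.mem (pz + i * n) = memPt n s.mem (pz + i * n) :=
      memPt_congr fun v hv => hm2 _ (by omega) (by omega)
    refine (wp_triple e0 e4 e26 h30 h31 h15 (by omega) (fun v hv => ?_) (fun v hv => ?_)).mono ?_
    · rw [hm1 _ (by omega), add_assoc]; exact hu _ (by omega)
    · rw [hm2 _ (by omega) (by omega), add_assoc]; exact hz _ (by omega)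
    rintro t s' - ⟨ht, h30', h31', h15', h34', hqs', hm'⟩
    rw [hU, hZ] at h34' hqs' hm'
    have hin' : (i + 1) * n = i * n + n := by ring
    refine ⟨ht, fun c => ⟨?_, ?_, ?_, ?_, ?_, ?_, ?_, ?_⟩⟩
    · simp [MState.setReg, h30', hin']; omega
    · simp [MState.setReg, h31', hin']; omega
    · simp [MState.setReg, h15']; omega
    · simp only [MState.setReg]
      rw [sum_range_succ, ← h34]
      exact h34'
    · simp only [MState.setReg]
      rw [hqs', hqs, queryList]
    · intro x hx
      simp only [MState.setReg, hm']
      rw [Function.update_of_ne (by omega), writeSeg_of_lt (by omega), hm1 x hx]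
    · intro x hx hx'
      simp only [MState.setReg, hm']
      rw [Function.update_of_ne (by omega), writeSeg_of_ge (by omega), hm2 x (by omega) hx']
    · intro j hj
      simp only [MState.setReg, hm']
      rcases Nat.lt_succ_iff_lt_or_eq.1 hj with hj | rfl
      · rw [Function.update_of_ne (by omega), writeSeg_of_ge (by omega), hm3 j hj]
      · rw [Function.update_self]; rfl
  · rintro t s' - ⟨ht, -, -, h15, h34, hqs, -, -, hm3⟩
    exact ⟨by linarith, h15, h34, hqs, hm3⟩

end Queries

/-! ### Gaussian elimination on the machine -/

section Rank

variable {n : ℕ} {f : BoolFn n} {ω : Tape n}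

/-- Find a row of the matrix at `R[30]`, if there is one, with a nonzero entry in the column that starts at `R[31]`. -/
def progPivot : Prog :=
  .add 27 30 26 ;; .add 28 30 26 ;; .add 29 31 26 ;; .const 36 0 ;; .add 22 10 26 ;;
    .times 22 (.load 24 29 ;; .ite 24 (.add 27 28 26 ;; .add 36 4 26) (.const 24 0) ;;
      .add 28 28 11 ;; .add 29 29 11)

/-- If the column is zero, register 27 keeps its default, the first row. The rest of the elimination
step then runs as usual but adds only zero multiples, so no case distinction is needed. -/
theorem wp_pivot {s : MState n} {ρ σ pm j : ℕ} (h4 : s.reg 4 = 1) (h26 : s.reg 26 = 0)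
    (h10 : s.reg 10 = ρ) (h11 : s.reg 11 = σ) (h30 : s.reg 30 = pm)
    (h31 : s.reg 31 = pm + j) (hρ : 0 < ρ) :
    wp f ω progPivot (fun t s' => t ≤ ρ * 8 + 6 ∧ ∃ i < ρ, s'.reg 27 = pm + i * σ ∧
      (s.mem (pm + i * σ + j) ≠ 0 ∧ s'.reg 36 = 1 ∨
        (∀ i' < ρ, s.mem (pm + i' * σ + j) = 0) ∧ s'.reg 36 = 0)) s := by
  rw [progPivot]
  simp only [wp_seq, wp_const, wp_add]
  refine (wp_times ρ 6 (fun i s' => s'.reg 28 = pm + i * σ ∧ s'.reg 29 = pm + i * σ + j ∧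
      ∃ i₀ < ρ, s'.reg 27 = pm + i₀ * σ ∧ (s.mem (pm + i₀ * σ + j) ≠ 0 ∧ s'.reg 36 = 1 ∨
        (∀ i' < i, s.mem (pm + i' * σ + j) = 0) ∧ s'.reg 36 = 0))
    ?_ ?_ rfl rfl (by norm_num) ?_ ?_).mono ?_
  · simp [MState.setReg, h10, h26]
  · simp [MState.setReg, h4]
  · simp only [MState.setReg]
    simp [h26, h30, h31]
    exact ⟨0, hρ, Or.inl rfl⟩
  · rintro i s₁ hi hF ⟨h28, h29, hp⟩
    have e4 := hF.reg 4 rfl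
    have e26 := hF.reg 26 rfl
    have e11 := hF.reg 11 rfl
    have em := hF.mem rfl
    simp [MState.setReg, h4, h26, h11] at e4 e26 e11 em
    rw [wp_seq, wp_load, wp_seq, wp_ite]
    have a1 : pm + i * σ + σ = pm + (i + 1) * σ := by ring
    have a2 : pm + i * σ + j + σ = pm + (i + 1) * σ + j := by ring
    constructor
    · intro h
      simp [MState.setReg, h29, em] at h
      simp only [wp_seq, wp_add, MState.setReg]
      refine ⟨by omega, fun c => ⟨?_, ?_, i, hi, ?_, Or.inl ⟨h, ?_⟩⟩⟩
      · simp [h28, e11, a1]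
      · simp [h29, e11, a2]
      · simp [h28, e26]
      · simp [e4, e26]
    · intro h
      simp [MState.setReg, h29, em] at h
      obtain ⟨i₀, hi₀, h27, hp⟩ := hp
      simp only [wp_seq, wp_add, wp_const, MState.setReg]
      refine ⟨by omega, fun c => ⟨?_, ?_, i₀, hi₀, ?_, hp.imp ?_ ?_⟩⟩
      · simp [h28, e11, a1]
      · simp [h29, e11, a2]
      · simp [h27]
      · rintro ⟨h1, h2⟩
        exact ⟨h1, by simp [h2]⟩
      · rintro ⟨h1, h2⟩
        refine ⟨fun i' hi' => ?_, by simp [h2]⟩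
        rcases Nat.lt_succ_iff_lt_or_eq.1 (show i' < i.succ from hi') with hi' | rfl
        · exact h1 i' hi'
        · exact h
  · rintro t s' - ⟨ht, -, -, hp⟩
    exact ⟨by omega, hp⟩

/-- Copy the row at `R[27]` to the buffer. -/
def progCopy : Prog :=
  .add 37 15 26 ;; .add 22 11 26 ;; .times 22 (.load 24 27 ;; .store 37 24 ;; .add 27 27 4 ;;
    .add 37 37 4)

/-- The pivot row is cleared when its own turn comes, so the later rows need a copy of it. -/
theorem wp_copy {s : MState n} {σ top p : ℕ} (h4 : s.reg 4 = 1) (h26 : s.reg 26 = 0)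
    (h11 : s.reg 11 = σ) (h15 : s.reg 15 = top) (h27 : s.reg 27 = p) (hp : p + σ ≤ top) :
    wp f ω progCopy (fun t s' => t ≤ σ * 6 + 3 ∧
      s'.mem = writeSeg s.mem top σ fun x => s.mem (p + x)) s := by
  rw [progCopy]
  simp only [wp_seq, wp_add]
  refine (wp_times σ 4 (fun x s' => s'.reg 27 = p + x ∧ s'.reg 37 = top + x ∧
      s'.mem = writeSeg s.mem top x fun x => s.mem (p + x))
    ?_ ?_ rfl rfl (by norm_num) ?_ ?_).mono ?_
  · simp [MState.setReg, h11, h26]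
  · simp [MState.setReg, h4]
  · simp [MState.setReg, h26, h15, h27, writeSeg_zero]
  · rintro x s₁ hx hF ⟨h27, h37, hm⟩
    have e4 := hF.reg 4 rfl
    simp [MState.setReg, h4] at e4
    have r1 : s₁.mem (p + x) = s.mem (p + x) := by
      rw [hm, writeSeg_of_lt (by omega)]
    simp [wp_seq, wp_store, wp_add, wp_load, MState.setReg, MState.setMem, h27, h37, e4, r1]
    refine ⟨rfl, rfl, ?_⟩
    rw [hm]
    exact update_writeSeg rfl rfl
  · rintro t s' - ⟨ht, -, -, hm⟩
    exact ⟨by omega, hm⟩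

/-- Add `R[38]` times the buffer to the row at `R[28]`. -/
def progAddRow : Prog :=
  .add 37 15 26 ;; .add 23 11 26 ;; .times 23 (.load 24 28 ;; .load 25 37 ;; .add 25 25 38 ;;
    .sub 25 25 4 ;; .sub 32 24 25 ;; .sub 25 25 24 ;; .add 25 25 32 ;; .store 28 25 ;;
    .add 28 28 4 ;; .add 37 37 4)

theorem wp_addRow {s : MState n} {σ top p c : ℕ} (h4 : s.reg 4 = 1) (h26 : s.reg 26 = 0)
    (h11 : s.reg 11 = σ) (h15 : s.reg 15 = top) (h28 : s.reg 28 = p) (h38 : s.reg 38 = c)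
    (hp : p + σ ≤ top) :
    wp f ω progAddRow (fun t s' => t ≤ σ * 12 + 3 ∧ s'.reg 28 = p + σ ∧
      s'.mem = writeSeg s.mem p σ fun x => xorVal (s.mem (p + x)) (s.mem (top + x) + c - 1)) s := by
  rw [progAddRow]
  simp only [wp_seq, wp_add]
  refine (wp_times σ 10 (fun x s' => s'.reg 28 = p + x ∧ s'.reg 37 = top + x ∧
      s'.mem = writeSeg s.mem p x fun x => xorVal (s.mem (p + x)) (s.mem (top + x) + c - 1))
    ?_ ?_ rfl rfl (by norm_num) ?_ ?_).mono ?_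
  · simp [MState.setReg, h11, h26]
  · simp [MState.setReg, h4]
  · simp [MState.setReg, h26, h15, h28, writeSeg_zero]
  · rintro x s₁ hx hF ⟨h28, h37, hm⟩
    have e4 := hF.reg 4 rfl
    have e38 := hF.reg 38 rfl
    simp [MState.setReg, h4, h38] at e4 e38
    have r1 : s₁.mem (p + x) = s.mem (p + x) := by rw [hm, writeSeg_of_ge (by omega)]
    have r2 : s₁.mem (top + x) = s.mem (top + x) := by rw [hm, writeSeg_of_ge (by omega)]
    simp [wp_seq, wp_store, wp_add, wp_sub, wp_load, MState.setReg, MState.setMem, h28, h37, e4, e38,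
      r1, r2]
    refine ⟨rfl, rfl, ?_⟩
    rw [hm]
    exact update_writeSeg rfl rfl
  · rintro t s' - ⟨ht, h28, -, hm⟩
    exact ⟨by omega, h28, hm⟩

/-- Add the buffer to every row with a nonzero entry in the column that starts at `R[31]`. -/
def progAddRows : Prog :=
  .add 28 30 26 ;; .add 29 31 26 ;; .add 22 10 26 ;;
    .times 22 (.load 38 29 ;; progAddRow ;; .add 29 29 11)

/-- The multiplier of a row is its entry in the pivot column, loaded before the row is altered; `x +
c - 1` is again the product of two bits. -/
theorem wp_addRows {s : MState n} {ρ σ pm j top : ℕ} (h4 : s.reg 4 = 1) (h26 : s.reg 26 = 0)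
    (h10 : s.reg 10 = ρ) (h11 : s.reg 11 = σ) (h15 : s.reg 15 = top) (h30 : s.reg 30 = pm)
    (h31 : s.reg 31 = pm + j) (htop : pm + ρ * σ ≤ top) :
    wp f ω progAddRows (fun t s' => t ≤ ρ * (σ * 12 + 7) + 4 ∧
      s'.mem = writeSeg s.mem pm (ρ * σ) fun x => xorVal (s.mem (pm + x))
        (s.mem (top + x % σ) + s.mem (pm + x / σ * σ + j) - 1)) s := by
  rw [progAddRows]
  simp only [wp_seq, wp_add]
  refine (wp_times ρ (σ * 12 + 5) (fun i s' => s'.reg 28 = pm + i * σ ∧ s'.reg 29 = pm + i * σ + j ∧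
      s'.mem = writeSeg s.mem pm (i * σ) fun x => xorVal (s.mem (pm + x))
        (s.mem (top + x % σ) + s.mem (pm + x / σ * σ + j) - 1))
    ?_ ?_ rfl rfl (by norm_num) ?_ ?_).mono ?_
  · simp [MState.setReg, h10, h26]
  · simp [MState.setReg, h4]
  · simp [MState.setReg, h26, h30, h31, writeSeg_zero]
  · rintro i s₁ hi hF ⟨h28, h29, hm⟩
    have e4 := hF.reg 4 rfl
    have e26 := hF.reg 26 rfl
    have e11 := hF.reg 11 rfl
    have e15 := hF.reg 15 rfl
    simp [MState.setReg, h4, h26, h11, h15] at e4 e26 e11 e15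
    have his : i * σ + σ ≤ ρ * σ := by
      have : (i + 1) * σ ≤ ρ * σ := Nat.mul_le_mul_right _ hi
      rw [add_mul] at this; omega
    rw [wp_seq, wp_load, wp_seq]
    refine (wp_addRow (σ := σ) (top := top) (p := pm + i * σ) (c := s.mem (pm + i * σ + j))
      ?_ ?_ ?_ ?_ ?_ ?_ (by omega)).mono ?_
    iterate 5 simp [MState.setReg, e4, e26, e11, e15, h28]
    · simp only [MState.setReg, Function.update_self, h29]
      rw [hm, writeSeg_of_ge (by omega)]
    rintro t s' hF' ⟨ht, h28', hm'⟩
    have e29 := hF'.reg 29 rfl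
    have e11' := hF'.reg 11 rfl
    simp [MState.setReg, h29, e11] at e29 e11' hm'
    rw [wp_add]
    refine ⟨by omega, fun c => ⟨?_, ?_, ?_⟩⟩
    · simp [MState.setReg, h28']; ring
    · simp [MState.setReg, e29, e11']; ring
    · simp only [MState.setReg]
      rw [hm', hm]
      refine writeSeg_block fun y hy => ?_
      rw [mul_add_mod_of_lt hy, mul_add_div_of_lt hy, writeSeg_of_ge (by omega),
        writeSeg_of_ge (by omega), add_assoc pm (i * σ) y]
  · rintro t s' - ⟨ht, -, -, hm⟩
    exact ⟨by linarith, hm⟩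

/-- The matrix stored row by row from address `p` on. -/
def memMatrix (ρ σ : ℕ) (mem : ℕ → ℕ) (p : ℕ) : Matrix (Fin ρ) (Fin σ) (ZMod 2) :=
  Matrix.of fun i j => (mem (p + i * σ + j) : ZMod 2)

theorem memMatrix_congr {ρ σ p : ℕ} {mem mem' : ℕ → ℕ}
    (h : ∀ x < ρ * σ, mem (p + x) = mem' (p + x)) :
    memMatrix ρ σ mem p = memMatrix ρ σ mem' p := by
  ext i j
  have hi : (i + 1) * σ ≤ ρ * σ := Nat.mul_le_mul_right _ i.2
  have hj := j.2
  rw [add_mul] at hi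
  simp only [memMatrix, Matrix.of_apply, add_assoc]
  rw [h _ (by omega)]

theorem cast_xorVal {x y c : ℕ} (hx : x < 2) (hy : y < 2) (hc : c < 2) :
    ((xorVal x (y + c - 1) : ℕ) : ZMod 2) = x + c * y ∧ xorVal x (y + c - 1) < 2 := by
  interval_cases x <;> interval_cases y <;> interval_cases c <;> decide

theorem mul_add_lt_mul {ρ σ i j : ℕ} (hi : i < ρ) (hj : j < σ) : i * σ + j < ρ * σ := by
  have : (i + 1) * σ ≤ ρ * σ := Nat.mul_le_mul_right _ hi
  rw [add_mul] at this
  omega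

/-- The effect of one step of the elimination on the memory. -/
def elimMem (mem : ℕ → ℕ) (ρ σ pm top p j : ℕ) : ℕ → ℕ :=
  writeSeg (writeSeg mem top σ fun x => mem (p + x)) pm (ρ * σ) fun x =>
    xorVal (writeSeg mem top σ (fun x => mem (p + x)) (pm + x))
      (writeSeg mem top σ (fun x => mem (p + x)) (top + x % σ) +
        writeSeg mem top σ (fun x => mem (p + x)) (pm + x / σ * σ + j) - 1)

theorem elimMem_cell {mem : ℕ → ℕ} {ρ σ pm top p i j j' : ℕ} (htop : pm + ρ * σ ≤ top)
    (hi : i < ρ) (hj : j < σ) (hj' : j' < σ) :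
    elimMem mem ρ σ pm top p j (pm + i * σ + j') =
      xorVal (mem (pm + i * σ + j')) (mem (p + j') + mem (pm + i * σ + j) - 1) := by
  have h1 := mul_add_lt_mul hi hj'
  have h2 := mul_add_lt_mul hi hj
  rw [elimMem, add_assoc, writeSeg_add h1, mul_add_mod_of_lt hj', mul_add_div_of_lt hj',
    writeSeg_add hj', writeSeg_of_lt (by omega), writeSeg_of_lt (by omega)]

theorem elimMem_of_lt {mem : ℕ → ℕ} {ρ σ pm top p j x : ℕ} (htop : pm + ρ * σ ≤ top) (hx : x < pm) :
    elimMem mem ρ σ pm top p j x = mem x := by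
  rw [elimMem, writeSeg_of_lt hx, writeSeg_of_lt (by omega)]

theorem elimMem_of_ge {mem : ℕ → ℕ} {ρ σ pm top p j x : ℕ} (hx : pm + ρ * σ ≤ x) (hx' : x < top) :
    elimMem mem ρ σ pm top p j x = mem x := by
  rw [elimMem, writeSeg_of_ge hx, writeSeg_of_lt hx']

theorem memMatrix_elimMem {mem : ℕ → ℕ} {ρ σ pm top j : ℕ} {i₀ : Fin ρ} (htop : pm + ρ * σ ≤ top)
    (hj : j < σ) (hbit : ∀ x < ρ * σ, mem (pm + x) < 2) :
    memMatrix ρ σ (elimMem mem ρ σ pm top (pm + i₀ * σ) j) pm =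
      elimColumn (memMatrix ρ σ mem pm) (memMatrix ρ σ mem pm i₀) ⟨j, hj⟩ ∧
    ∀ x < ρ * σ, elimMem mem ρ σ pm top (pm + i₀ * σ) j (pm + x) < 2 := by
  have hbits : ∀ (i : Fin ρ) (j' : ℕ), j' < σ → mem (pm + i * σ + j') < 2 := fun i j' hj' => by
    rw [add_assoc]; exact hbit _ (mul_add_lt_mul i.2 hj')
  constructor
  · ext i j'
    simp only [memMatrix, elimColumn, Matrix.of_apply]
    rw [elimMem_cell htop i.2 hj j'.2]
    exact (cast_xorVal (hbits i j' j'.2) (hbits i₀ j' j'.2) (hbits i j hj)).1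
  · intro x hx
    have hσ : 0 < σ := by omega
    have h1 : x / σ < ρ := Nat.div_lt_of_lt_mul (by rwa [mul_comm])
    have h2 : x % σ < σ := Nat.mod_lt _ hσ
    have e : pm + x = pm + x / σ * σ + x % σ := by
      rw [add_assoc, mul_comm (x / σ), Nat.div_add_mod]
    rw [e, elimMem_cell htop h1 hj h2]
    exact (cast_xorVal (hbits ⟨_, h1⟩ _ h2) (hbits i₀ _ h2) (hbits ⟨_, h1⟩ j hj)).2

theorem wp_add_frame {r u v : ℕ} {Q : ℕ → MState n → Prop} {s : MState n}
    (h : ∀ s' : MState n, s'.reg r = s.reg u + s.reg v → Frame (.add r u v) s s' → Q 1 s') :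
    wp f ω (.add r u v) Q s :=
  wp_add.2 (h _ (by simp [MState.setReg]) (Exec.add (f := f) (ω := ω) r u v s).frame)

/-- One step of the elimination. -/
def progColumn : Prog := progPivot ;; .add 35 35 36 ;; progCopy ;; progAddRows

theorem wp_column_mem {s : MState n} {ρ σ pm j top : ℕ} (h4 : s.reg 4 = 1) (h26 : s.reg 26 = 0)
    (h10 : s.reg 10 = ρ) (h11 : s.reg 11 = σ) (h15 : s.reg 15 = top) (h30 : s.reg 30 = pm)
    (h31 : s.reg 31 = pm + j) (htop : pm + ρ * σ ≤ top) (hρ : 0 < ρ) :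
    wp f ω progColumn (fun t s' => t ≤ ρ * (σ * 12 + 15) + σ * 6 + 14 ∧ ∃ i < ρ,
      s'.mem = elimMem s.mem ρ σ pm top (pm + i * σ) j ∧
      (s.mem (pm + i * σ + j) ≠ 0 ∧ s'.reg 35 = s.reg 35 + 1 ∨
        (∀ i' < ρ, s.mem (pm + i' * σ + j) = 0) ∧ s'.reg 35 = s.reg 35)) s := by
  rw [progColumn, wp_seq]
  refine (wp_pivot h4 h26 h10 h11 h30 h31 hρ).mono ?_
  rintro t₁ s₁ hF₁ ⟨ht₁, i, hi, h27, hp⟩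
  have m₁ := hF₁.mem rfl
  have e4 := (hF₁.reg 4 rfl).trans h4
  have e26 := (hF₁.reg 26 rfl).trans h26
  have e10 := (hF₁.reg 10 rfl).trans h10
  have e11 := (hF₁.reg 11 rfl).trans h11
  have e15 := (hF₁.reg 15 rfl).trans h15
  have e30 := (hF₁.reg 30 rfl).trans h30
  have e31 := (hF₁.reg 31 rfl).trans h31
  have e35 := hF₁.reg 35 rfl
  have hpiv : pm + i * σ + σ ≤ top := by
    have : (i + 1) * σ ≤ ρ * σ := Nat.mul_le_mul_right _ hi
    rw [add_mul] at this
    omega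
  rw [wp_seq]
  refine wp_add_frame fun u hu35 hFu => ?_
  rw [wp_seq]
  refine (wp_copy ((hFu.reg 4 rfl).trans e4) ((hFu.reg 26 rfl).trans e26)
    ((hFu.reg 11 rfl).trans e11) ((hFu.reg 15 rfl).trans e15)
    ((hFu.reg 27 rfl).trans h27) hpiv).mono ?_
  rintro t₂ s₂ hF₂ ⟨ht₂, m₂⟩
  have hF' := fun r h h' => (hF₂.reg r h).trans (hFu.reg r h')
  refine (wp_addRows ((hF' 4 rfl rfl).trans e4) ((hF' 26 rfl rfl).trans e26)
    ((hF' 10 rfl rfl).trans e10) ((hF' 11 rfl rfl).trans e11) ((hF' 15 rfl rfl).trans e15)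
    ((hF' 30 rfl rfl).trans e30) ((hF' 31 rfl rfl).trans e31) htop).mono ?_
  rintro t₃ s₃ hF₃ ⟨ht₃, m₃⟩
  have c35 : s₃.reg 35 = s₁.reg 35 + s₁.reg 36 :=
    ((hF₃.reg 35 rfl).trans (hF₂.reg 35 rfl)).trans hu35
  rw [hFu.mem rfl, m₁] at m₂
  refine ⟨by nlinarith, i, hi, ?_, hp.imp (fun h => ⟨h.1, ?_⟩) fun h => ⟨h.1, ?_⟩⟩
  · rw [m₃, m₂, elimMem]
  · rw [c35, e35, h.2]
  · rw [c35, e35, h.2, add_zero]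

/-- Register 35 plus the rank of the remaining matrix is conserved: a pivot moves one unit from the
rank to the counter, and a zero column leaves both alone. Columns already cleared stay zero, as
multiples of the pivot row's zero entry are added to them. -/
theorem wp_column {s : MState n} {ρ σ pm j top : ℕ} (h4 : s.reg 4 = 1) (h26 : s.reg 26 = 0)
    (h10 : s.reg 10 = ρ) (h11 : s.reg 11 = σ) (h15 : s.reg 15 = top) (h30 : s.reg 30 = pm)
    (h31 : s.reg 31 = pm + j) (htop : pm + ρ * σ ≤ top) (hj : j < σ) (hρ : 0 < ρ)
    (hbit : ∀ x < ρ * σ, s.mem (pm + x) < 2) :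
    wp f ω progColumn (fun t s' => t ≤ ρ * (σ * 12 + 15) + σ * 6 + 14 ∧
      s'.reg 35 + (memMatrix ρ σ s'.mem pm).rank = s.reg 35 + (memMatrix ρ σ s.mem pm).rank ∧
      (∀ x < ρ * σ, s'.mem (pm + x) < 2) ∧
      (∀ x < pm, s'.mem x = s.mem x) ∧ (∀ x, pm + ρ * σ ≤ x → x < top → s'.mem x = s.mem x) ∧
      (∀ j' : Fin σ, (j'.val = j ∨ ∀ i, memMatrix ρ σ s.mem pm i j' = 0) →
        ∀ i, memMatrix ρ σ s'.mem pm i j' = 0)) s := by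
  refine (wp_column_mem h4 h26 h10 h11 h15 h30 h31 htop hρ).mono ?_
  rintro t s' - ⟨ht, i₀, hi₀, hm, hp⟩
  obtain ⟨hM, hb⟩ := memMatrix_elimMem (i₀ := ⟨i₀, hi₀⟩) htop hj hbit
  rw [hm]
  refine ⟨ht, ?_, hb, fun x hx => elimMem_of_lt htop hx, fun x => elimMem_of_ge, ?_⟩
  all_goals
    rw [hM]
    rcases hp with ⟨hne, h35⟩ | ⟨hz, h35⟩
  · have hpv : memMatrix ρ σ s.mem pm ⟨i₀, hi₀⟩ ⟨j, hj⟩ = 1 := by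
      have := hbit _ (mul_add_lt_mul hi₀ hj)
      rw [← add_assoc] at this
      have h1 : s.mem (pm + i₀ * σ + j) = 1 := by omega
      simp only [memMatrix, Matrix.of_apply, h1, Nat.cast_one]
    rw [rank_elimColumn _ _ _ hpv, h35]; ring
  · have hz' : elimColumn (memMatrix ρ σ s.mem pm) (memMatrix ρ σ s.mem pm ⟨i₀, hi₀⟩) ⟨j, hj⟩ =
        memMatrix ρ σ s.mem pm := by
      ext i j'
      simp [elimColumn, memMatrix, hz i i.2]
    rw [hz', h35]
  · intro j' hj' i
    rw [elimColumn, Matrix.of_apply]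
    rcases hj' with hj' | hj'
    · have hpv : memMatrix ρ σ s.mem pm ⟨i₀, hi₀⟩ ⟨j, hj⟩ = 1 := by
        have := hbit _ (mul_add_lt_mul hi₀ hj)
        rw [← add_assoc] at this
        have h1 : s.mem (pm + i₀ * σ + j) = 1 := by omega
        simp only [memMatrix, Matrix.of_apply, h1, Nat.cast_one]
      obtain rfl : j' = ⟨j, hj⟩ := Fin.ext hj'
      rw [hpv, mul_one, CharTwo.add_self_eq_zero]
    · rw [hj', hj', mul_zero, add_zero]
  · intro j' hj' i
    have hzero : ∀ i : Fin ρ, memMatrix ρ σ s.mem pm i ⟨j, hj⟩ = 0 := fun i => by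
      simp only [memMatrix, Matrix.of_apply, hz i i.2, Nat.cast_zero]
    rw [elimColumn, Matrix.of_apply, hzero, zero_mul, add_zero]
    rcases hj' with hj' | hj'
    · obtain rfl : j' = ⟨j, hj⟩ := Fin.ext hj'
      exact hzero i
    · exact hj' i

/-- Add the rank of the matrix at `R[30]` to `R[35]`. -/
def progElim : Prog := .add 31 30 26 ;; .add 21 11 26 ;; .times 21 (progColumn ;; .add 31 31 4)

theorem wp_elim {s : MState n} {ρ σ pm top : ℕ} (h4 : s.reg 4 = 1) (h26 : s.reg 26 = 0)
    (h10 : s.reg 10 = ρ) (h11 : s.reg 11 = σ) (h15 : s.reg 15 = top) (h30 : s.reg 30 = pm)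
    (htop : pm + ρ * σ ≤ top) (hρ : 0 < ρ) (hbit : ∀ x < ρ * σ, s.mem (pm + x) < 2) :
    wp f ω progElim (fun t s' => t ≤ σ * (ρ * (σ * 12 + 15) + σ * 6 + 17) + 3 ∧
      s'.reg 35 = s.reg 35 + (memMatrix ρ σ s.mem pm).rank ∧
      (∀ x, pm + ρ * σ ≤ x → x < top → s'.mem x = s.mem x)) s := by
  rw [progElim]
  simp only [wp_seq, wp_add]
  refine (wp_times σ (ρ * (σ * 12 + 15) + σ * 6 + 15) (fun j s' => s'.reg 31 = pm + j ∧
    s'.reg 35 + (memMatrix ρ σ s'.mem pm).rank = s.reg 35 + (memMatrix ρ σ s.mem pm).rank ∧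
      (∀ x < ρ * σ, s'.mem (pm + x) < 2) ∧
      (∀ x, pm + ρ * σ ≤ x → x < top → s'.mem x = s.mem x) ∧
      (∀ j' : Fin σ, j'.val < j → ∀ i, memMatrix ρ σ s'.mem pm i j' = 0)) ?_ ?_ rfl rfl (by norm_num)
      ?_ ?_).mono ?_
  · simp [MState.setReg, h11, h26]
  · simp [MState.setReg, h4]
  · refine ⟨by simp [MState.setReg, h30, h26], by simp [MState.setReg], hbit, fun _ _ _ => rfl,
      fun j' hj' => absurd hj' (Nat.not_lt_zero _)⟩
  · rintro j s₁ hj hF ⟨h31, h35, hb, hhi, hz⟩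
    have e4 := hF.reg 4 rfl
    have e26 := hF.reg 26 rfl
    have e10 := hF.reg 10 rfl
    have e11 := hF.reg 11 rfl
    have e15 := hF.reg 15 rfl
    have e30 := hF.reg 30 rfl
    simp [MState.setReg, h4, h26, h10, h11, h15, h30] at e4 e26 e10 e11 e15 e30
    rw [wp_seq]
    refine (wp_column e4 e26 e10 e11 e15 e30 h31 htop hj hρ hb).mono ?_
    rintro t s' hF' ⟨ht, h35', hb', -, hhi', hz'⟩
    have e31 := hF'.reg 31 rfl
    have e4' := hF'.reg 4 rfl
    rw [wp_add]
    refine ⟨by omega, fun c => ⟨?_, ?_, ?_, ?_, ?_⟩⟩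
    · simp [MState.setReg, e31, e4', e4, h31]; omega
    · rw [← h35, ← h35']; simp [MState.setReg]
    · exact hb'
    · exact fun x hx hx' => (hhi' x hx hx').trans (hhi x hx hx')
    · intro j' hj' i
      refine hz' j' ?_ i
      rcases Nat.lt_succ_iff_lt_or_eq.1 (show j'.val < j.succ from hj') with h | h
      · exact Or.inr (hz j' h)
      · exact Or.inl h
  · rintro t s' - ⟨ht, -, h35, -, hhi, hz⟩
    -- Once every column is cleared the matrix is zero, so the whole rank is in register 35.
    have h0 : memMatrix ρ σ s'.mem pm = 0 := by
      ext i j; exact hz j j.2 i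
    rw [h0, Matrix.rank_zero, add_zero] at h35
    exact ⟨by linarith, h35, hhi⟩

/-- Compute the sum of the ranks of the matrices of values. -/
def progRank : Prog :=
  .add 30 19 13 ;; .add 30 30 14 ;; .const 35 0 ;; .add 20 8 26 ;;
    .times 20 (progElim ;; .add 30 30 39)

/-- Elimination destroys its own matrix and the buffer beyond `top`, but not the matrices still to
come. The answers of the linearity test and of the samples precede the matrices, hence the offset in
`hbase`. -/
theorem wp_rank {s : MState n} {L ρ σ base top : ℕ} (h4 : s.reg 4 = 1) (h26 : s.reg 26 = 0)
    (h8 : s.reg 8 = L) (h39 : s.reg 39 = ρ * σ)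
    (h10 : s.reg 10 = ρ) (h11 : s.reg 11 = σ) (h15 : s.reg 15 = top)
    (hbase : s.reg 19 + s.reg 13 + s.reg 14 = base)
    (htop : base + L * (ρ * σ) ≤ top) (hρ : 0 < ρ) (hbit : ∀ x < L * (ρ * σ), s.mem (base + x) < 2) :
    wp f ω progRank (fun t s' => t ≤ L * (σ * (ρ * (σ * 12 + 15) + σ * 6 + 17) + 6) + 5 ∧
      s'.reg 35 = ∑ l ∈ range L, (memMatrix ρ σ s.mem (base + l * (ρ * σ))).rank) s := by
  rw [progRank]
  simp only [wp_seq, wp_add, wp_const]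
  refine (wp_times L (σ * (ρ * (σ * 12 + 15) + σ * 6 + 17) + 4) (fun l s' =>
    s'.reg 30 = base + l * (ρ * σ) ∧
    s'.reg 35 = ∑ l ∈ range l, (memMatrix ρ σ s.mem (base + l * (ρ * σ))).rank ∧
    (∀ x, base + l * (ρ * σ) ≤ x → x < top → s'.mem x = s.mem x)) ?_ ?_ rfl rfl (by norm_num)
      ?_ ?_).mono ?_
  · simp [MState.setReg, h8, h26]
  · simp [MState.setReg, h4]
  · simp [MState.setReg, hbase]
  · rintro l s₁ hl hF ⟨h30, h35, hhi⟩
    have e4 := hF.reg 4 rfl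
    have e26 := hF.reg 26 rfl
    have e10 := hF.reg 10 rfl
    have e11 := hF.reg 11 rfl
    have e15 := hF.reg 15 rfl
    simp [MState.setReg, h4, h26, h10, h11, h15] at e4 e26 e10 e11 e15
    have hle : (l + 1) * (ρ * σ) ≤ L * (ρ * σ) := Nat.mul_le_mul_right _ hl
    have hadd : (l + 1) * (ρ * σ) = l * (ρ * σ) + ρ * σ := by ring
    rw [wp_seq]
    refine (wp_elim e4 e26 e10 e11 e15 h30 (by omega) hρ fun x hx => ?_).mono ?_
    · rw [hhi _ (by omega) (by omega), add_assoc]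
      exact hbit _ (by omega)
    rintro t s' hF' ⟨ht, h35', hhi'⟩
    have e30 := hF'.reg 30 rfl
    have e39 := (hF'.reg 39 rfl).trans (hF.reg 39 rfl)
    simp [MState.setReg, h39] at e39
    rw [wp_add]
    refine ⟨by omega, fun c => ⟨?_, ?_, ?_⟩⟩
    · simp [MState.setReg, e30, e39, h30]; omega
    · simp [MState.setReg]
      rw [h35', h35, sum_range_succ]
      congr 2
      exact memMatrix_congr fun x hx => hhi _ (by omega) (by omega)
    · intro x hx hx'
      exact (hhi' x (by omega) hx').trans (hhi x (by omega) hx')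
  · rintro t s' - ⟨ht, -, h35, -⟩
    exact ⟨by linarith, h35⟩

end Rank

/-! ### Memory layout -/

section SetupMemory

variable {n : ℕ} {f : BoolFn n} {ω : Tape n}

/-- Compute all the parameters. -/
def progParams : Prog := progKap ;; progLam ;; progDims ;; progRounds ;; progCount

theorem wp_params {s : MState n} {k a b : ℕ} (ha : 0 < a) (hb : 0 < b) (h1 : s.reg 1 = k)
    (h2 : s.reg 2 = a) (h3 : s.reg 3 = b) :
    wp f ω progParams (fun t s' =>
      t ≤ k * 4 + kapOf k * 17 + 2 ^ lamOf k * 3 + sampleCount a b * 3 + 30 ∧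
      s'.reg 4 = 1 ∧ s'.reg 26 = 0 ∧ s'.reg 8 = 2 ^ lamOf k ∧ s'.reg 9 = lamOf k ∧
      s'.reg 10 = 4 * kapOf k ∧ s'.reg 11 = 6 * kapOf k ∧
      s'.reg 39 = 4 * kapOf k * (6 * kapOf k) ∧ s'.reg 12 = rankSize k ∧
      s'.reg 13 = 32 * rankSize k ∧ s'.reg 14 = sampleCount a b) s := by
  rw [progParams, wp_seq]
  refine (wp_kap h1).mono ?_
  rintro t₁ s₁ F₁ ⟨ht₁, h4, h5, h24⟩
  rw [wp_seq]
  refine (wp_lam h4 h5 h24).mono ?_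
  rintro t₂ s₂ F₂ ⟨ht₂, h8, h9⟩
  rw [wp_seq]
  have h4₂ := (F₂.reg 4 rfl).trans h4
  refine (wp_dims h4₂ ((F₂.reg 5 rfl).trans h5)).mono ?_
  rintro t₃ s₃ F₃ ⟨ht₃, h26, h10, h11, h39⟩
  rw [wp_seq]
  have h4₃ := (F₃.reg 4 rfl).trans h4₂
  refine (wp_rounds h4₃ h26 ((F₃.reg 8 rfl).trans h8) h39).mono ?_
  rintro t₄ s₄ F₄ ⟨ht₄, h12, h13⟩
  have h4₄ := (F₄.reg 4 rfl).trans h4₃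
  have c : ∀ r, r = 2 ∨ r = 3 → s₄.reg r = s.reg r := by
    rintro r (rfl | rfl) <;>
    exact (F₄.reg _ rfl).trans ((F₃.reg _ rfl).trans ((F₂.reg _ rfl).trans (F₁.reg _ rfl)))
  refine (wp_count ha hb ((c 2 (by simp)).trans h2) ((c 3 (by simp)).trans h3) h4₄).mono ?_
  rintro t₅ s₅ F₅ ⟨ht₅, h14⟩
  exact ⟨by omega, (F₅.reg 4 rfl).trans h4₄, (F₅.reg 26 rfl).trans ((F₄.reg 26 rfl).trans h26),
    (F₅.reg 8 rfl).trans ((F₄.reg 8 rfl).trans ((F₃.reg 8 rfl).trans h8)),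
    (F₅.reg 9 rfl).trans ((F₄.reg 9 rfl).trans ((F₃.reg 9 rfl).trans h9)),
    (F₅.reg 10 rfl).trans ((F₄.reg 10 rfl).trans h10),
    (F₅.reg 11 rfl).trans ((F₄.reg 11 rfl).trans h11),
    (F₅.reg 39 rfl).trans ((F₄.reg 39 rfl).trans h39),
    (F₅.reg 12 rfl).trans h12, (F₅.reg 13 rfl).trans h13, h14⟩

theorem writeSeg_append {mem : ℕ → ℕ} {base base' a b : ℕ} {g h : ℕ → ℕ} (hb : base' = base + a)
    (hg : ∀ y < b, h y = g (a + y)) :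
    writeSeg (writeSeg mem base a g) base' b h = writeSeg mem base (a + b) g := by
  subst hb
  funext x
  simp only [writeSeg]
  split_ifs
  · rw [hg _ (by omega)]; congr 1; omega
  all_goals first | rfl | omega

/-- Fill as many points as register `c` says with coins. -/
def progFillBy (c : ℕ) : Prog := .add 20 c 26 ;; progFill

theorem wp_fillBy {s : MState n} {c : ℕ} (cnt : ℕ) (hc : s.reg c = cnt) (h0 : s.reg 0 = n)
    (h4 : s.reg 4 = 1) (h26 : s.reg 26 = 0) :
    wp f ω (progFillBy c) (fun t s' => t ≤ cnt * (n * 5 + 4) + 2 ∧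
      s'.reg 15 = s.reg 15 + cnt * n ∧ s'.coins = s.coins + cnt * n ∧
      s'.mem = writeSeg s.mem (s.reg 15) (cnt * n) fun x => coinVal ω (s.coins + x)) s := by
  rw [progFillBy, wp_seq]
  refine wp_add_frame fun u hu hF => ?_
  rw [hc, h26, add_zero] at hu
  refine (wp_fill cnt hu ((hF.reg 0 rfl).trans h0) ((hF.reg 4 rfl).trans h4)
    ((hF.reg 26 rfl).trans h26)).mono ?_
  rintro t s' - ⟨ht, h15, hcn, hm⟩
  rw [hF.reg 15 rfl] at h15 hm
  rw [hF.coins rfl] at hcn hm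
  rw [hF.mem rfl] at hm
  exact ⟨by omega, h15, hcn, hm⟩

/-- The memory with the groups, the coin points of the rank test and those of the linearity
test. -/
def coinMem (ω : Tape n) (lam c : ℕ) : ℕ → ℕ :=
  writeSeg (writeSeg (fun _ => 0) 0 n (hashVal ω lam)) n (c * n) fun x => coinVal ω (lam * n + x)

/-- Write the groups and the coin points. -/
def progCoins : Prog :=
  progHash ;; .add 15 0 26 ;; progFillBy 10 ;; .add 16 15 26 ;; progFillBy 11 ;;
    .add 17 15 26 ;; progFillBy 13

theorem wp_coins {s : MState n} {lam ρ σ m : ℕ} (h0 : s.reg 0 = n)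
    (h4 : s.reg 4 = 1) (h26 : s.reg 26 = 0) (h9 : s.reg 9 = lam) (h10 : s.reg 10 = ρ)
    (h11 : s.reg 11 = σ) (h13 : s.reg 13 = m) (hmem : s.mem = fun _ => 0) (hcoins : s.coins = 0) :
    wp f ω progCoins (fun t s' => t ≤ lam * (n * 8 + 5) + (ρ + σ + m) * (n * 5 + 4) + 11 ∧
      s'.coins = (lam + (ρ + σ + m)) * n ∧ s'.mem = coinMem ω lam (ρ + σ + m) ∧
      s'.reg 15 = n + (ρ + σ + m) * n ∧ s'.reg 16 = n + ρ * n ∧ s'.reg 17 = n + (ρ + σ) * n) s := by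
  rw [progCoins, wp_seq]
  refine (wp_hash lam h9 h0 h4 h26 hmem hcoins).mono ?_
  rintro t₁ s₁ F₁ ⟨ht₁, hc₁, hm₁⟩
  rw [wp_seq]
  refine wp_add_frame fun s₂ h15₂ F₂ => ?_
  have k0 := (F₂.reg 0 rfl).trans ((F₁.reg 0 rfl).trans h0)
  have k4 := (F₂.reg 4 rfl).trans ((F₁.reg 4 rfl).trans h4)
  have k26 := (F₂.reg 26 rfl).trans ((F₁.reg 26 rfl).trans h26)
  rw [F₁.reg 0 rfl, h0, F₁.reg 26 rfl, h26, add_zero] at h15₂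
  rw [wp_seq]
  refine (wp_fillBy ρ ((F₂.reg 10 rfl).trans ((F₁.reg 10 rfl).trans h10)) k0 k4 k26).mono ?_
  rintro t₃ s₃ F₃ ⟨ht₃, h15₃, hc₃, hm₃⟩
  rw [F₂.coins rfl, hc₁] at hc₃ hm₃
  rw [h15₂] at h15₃ hm₃
  rw [F₂.mem rfl, hm₁] at hm₃
  rw [wp_seq]
  refine wp_add_frame fun s₄ h16 F₄ => ?_
  have G : ∀ r, r = 0 ∨ r = 4 ∨ r = 26 → s₄.reg r = s₂.reg r := by
    rintro r (rfl | rfl | rfl) <;> exact (F₄.reg _ rfl).trans (F₃.reg _ rfl)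
  rw [F₃.reg 26 rfl, k26, add_zero, h15₃] at h16
  replace k0 := (G 0 (by simp)).trans k0
  replace k4 := (G 4 (by simp)).trans k4
  replace k26 := (G 26 (by simp)).trans k26
  rw [wp_seq]
  refine (wp_fillBy σ ((F₄.reg 11 rfl).trans ((F₃.reg 11 rfl).trans ((F₂.reg 11 rfl).trans
    ((F₁.reg 11 rfl).trans h11)))) k0 k4 k26).mono ?_
  rintro t₅ s₅ F₅ ⟨ht₅, h15₅, hc₅, hm₅⟩
  rw [F₄.coins rfl, hc₃] at hc₅ hm₅
  rw [F₄.reg 15 rfl, h15₃] at h15₅ hm₅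
  rw [F₄.mem rfl, hm₃] at hm₅
  rw [wp_seq]
  refine wp_add_frame fun s₆ h17 F₆ => ?_
  replace G : ∀ r, r = 0 ∨ r = 4 ∨ r = 26 → s₆.reg r = s₄.reg r := by
    rintro r (rfl | rfl | rfl) <;> exact (F₆.reg _ rfl).trans (F₅.reg _ rfl)
  rw [F₅.reg 26 rfl, k26, add_zero, h15₅] at h17
  replace k0 := (G 0 (by simp)).trans k0
  replace k4 := (G 4 (by simp)).trans k4
  replace k26 := (G 26 (by simp)).trans k26
  refine (wp_fillBy m ((F₆.reg 13 rfl).trans ((F₅.reg 13 rfl).trans ((F₄.reg 13 rfl).trans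
    ((F₃.reg 13 rfl).trans ((F₂.reg 13 rfl).trans ((F₁.reg 13 rfl).trans h13)))))) k0 k4 k26).mono ?_
  rintro t₇ s₇ F₇ ⟨ht₇, h15₇, hc₇, hm₇⟩
  rw [F₆.coins rfl, hc₅] at hc₇ hm₇
  rw [F₆.reg 15 rfl, h15₅] at h15₇ hm₇
  rw [F₆.mem rfl, hm₅] at hm₇
  refine ⟨?_, ?_, ?_, ?_, ?_, ?_⟩
  · rw [add_mul, add_mul]; omega
  · rw [hc₇]; ring
  · rw [hm₇, coinMem, writeSeg_append (a := ρ * n) (g := fun x => coinVal ω (lam * n + x)) rfl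
      fun y _ => by simp only [add_assoc], writeSeg_append (a := ρ * n + σ * n) (add_assoc _ _ _)
      fun y _ => by simp only [add_assoc]]
    congr 1; ring
  · rw [h15₇]; ring
  · rw [F₇.reg 16 rfl, F₆.reg 16 rfl, F₅.reg 16 rfl, h16]
  · rw [F₇.reg 17 rfl, h17]; ring

/-- The memory with the samples added. -/
def sampleMem (ω : Tape n) (lam c t : ℕ) : ℕ → ℕ :=
  writeSeg (coinMem ω lam c) (n + c * n) (t * n) (sampleVal ω)

/-- The memory with the points of the rank test added. -/
def pointMem (ω : Tape n) (lam ρ σ m t : ℕ) : ℕ → ℕ :=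
  writeSeg (sampleMem ω lam (ρ + σ + m) t) (n + (ρ + σ + m + t) * n) (2 ^ lam * (ρ * (σ * n)))
    (pointVal (sampleMem ω lam (ρ + σ + m) t) n (n + ρ * n) ρ σ)

/-- The memory with the shifts added. -/
def shiftMem (ω : Tape n) (lam ρ σ m t : ℕ) : ℕ → ℕ :=
  writeSeg (pointMem ω lam ρ σ m t) (n + (ρ + σ + m + t + 2 ^ lam * (ρ * σ)) * n)
    ((m + t + 2 ^ lam * (ρ * σ)) * n) fun x => coinVal ω ((lam + (ρ + σ + m)) * n + x)

/-- Write the samples, the points of the rank test and the shifts. -/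
def progRest : Prog :=
  (.add 20 14 26 ;; progSamples) ;; progPoints ;; .add 18 15 26 ;; .add 33 13 14 ;; .add 33 33 12 ;;
    progFillBy 33 ;; .add 19 15 26

/-- Final layout, in order: groups, the points `A`, the points `B`, linearity points, samples, rank
points, shifts. The three kinds of points to be tested are contiguous from register 17 on, so one
loop of triples handles them all. -/
theorem wp_rest {s : MState n} {lam ρ σ m t : ℕ} (h0 : s.reg 0 = n)
    (h4 : s.reg 4 = 1) (h26 : s.reg 26 = 0) (h8 : s.reg 8 = 2 ^ lam) (h10 : s.reg 10 = ρ)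
    (h11 : s.reg 11 = σ) (h13 : s.reg 13 = m) (h14 : s.reg 14 = t)
    (h12 : s.reg 12 = 2 ^ lam * (ρ * σ)) (hs : s.samples = 0)
    (hc : s.coins = (lam + (ρ + σ + m)) * n) (hm : s.mem = coinMem ω lam (ρ + σ + m))
    (h15 : s.reg 15 = n + (ρ + σ + m) * n) (h16 : s.reg 16 = n + ρ * n) :
    wp f ω progRest (fun T s' => T ≤ t * (n + 4) + 2 ^ lam * (ρ * (σ * (n * 16 + 6) + 6) + 6) +
        (m + t + 2 ^ lam * (ρ * σ)) * (n * 5 + 4) + 11 ∧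
      s'.samples = t ∧ s'.mem = shiftMem ω lam ρ σ m t ∧
      s'.reg 15 = n + (ρ + σ + m + t + 2 ^ lam * (ρ * σ)) * n + (m + t + 2 ^ lam * (ρ * σ)) * n ∧
      s'.reg 19 = s'.reg 15 ∧ s'.reg 33 = m + t + 2 ^ lam * (ρ * σ) ∧
      s'.reg 18 = n + (ρ + σ + m + t + 2 ^ lam * (ρ * σ)) * n) s := by
  rw [progRest, wp_seq, wp_seq]
  refine wp_add_frame fun s₁ h20 F₁ => ?_
  rw [h14, h26, add_zero] at h20
  refine (wp_samples t h20 ((F₁.reg 0 rfl).trans h0) ((F₁.reg 4 rfl).trans h4)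
    ((F₁.samples rfl).trans hs)).mono ?_
  rintro t₂ s₂ F₂ ⟨ht₂, h15₂, hs₂, hm₂⟩
  rw [F₁.reg 15 rfl, h15] at h15₂ hm₂
  rw [F₁.mem rfl, hm] at hm₂
  have G : ∀ r, r = 0 ∨ r = 4 ∨ r = 26 ∨ r = 8 ∨ r = 10 ∨ r = 11 ∨ r = 12 ∨ r = 13 ∨ r = 14 ∨ r = 16 →
      s₂.reg r = s.reg r := by
    rintro r (rfl | rfl | rfl | rfl | rfl | rfl | rfl | rfl | rfl | rfl) <;>
    exact (F₂.reg _ rfl).trans (F₁.reg _ rfl)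
  have g0 := (G 0 (by simp)).trans h0
  have g4 := (G 4 (by simp)).trans h4
  have g26 := (G 26 (by simp)).trans h26
  have g12 := (G 12 (by simp)).trans h12
  have g13 := (G 13 (by simp)).trans h13
  have g14 := (G 14 (by simp)).trans h14
  rw [wp_seq]
  refine (wp_points g0 g4 g26 ((G 8 (by simp)).trans h8) ((G 16 (by simp)).trans h16)
    ((G 10 (by simp)).trans h10) ((G 11 (by simp)).trans h11) h15₂ ?_ ?_).mono ?_
  · rw [add_mul, add_mul]; omega
  · rw [add_mul, add_mul]; omega
  rintro t₃ s₃ F₃ ⟨ht₃, h15₃, hm₃⟩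
  have e₃ : n + (ρ + σ + m) * n + t * n = n + (ρ + σ + m + t) * n := by ring
  rw [hm₂, e₃, ← sampleMem, ← pointMem] at hm₃
  have e₃' : n + (ρ + σ + m) * n + t * n + 2 ^ lam * (ρ * (σ * n)) =
      n + (ρ + σ + m + t + 2 ^ lam * (ρ * σ)) * n := by ring
  rw [e₃'] at h15₃
  rw [wp_seq]
  refine wp_add_frame fun s₄ h18 F₄ => ?_
  rw [F₃.reg 26 rfl, g26, add_zero, h15₃] at h18
  rw [wp_seq]
  refine wp_add_frame fun s₅ h33 F₅ => ?_
  rw [F₄.reg 13 rfl, F₄.reg 14 rfl, F₃.reg 13 rfl, F₃.reg 14 rfl, g13, g14] at h33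
  rw [wp_seq]
  refine wp_add_frame fun s₆ h33₆ F₆ => ?_
  rw [h33, F₅.reg 12 rfl, F₄.reg 12 rfl, F₃.reg 12 rfl, g12] at h33₆
  have G' : ∀ r, r = 0 ∨ r = 4 ∨ r = 26 ∨ r = 15 → s₆.reg r = s₃.reg r := by
    rintro r (rfl | rfl | rfl | rfl) <;>
    exact (F₆.reg _ rfl).trans ((F₅.reg _ rfl).trans (F₄.reg _ rfl))
  have k26 := (G' 26 (by simp)).trans ((F₃.reg 26 rfl).trans g26)
  rw [wp_seq]
  refine (wp_fillBy _ h33₆ ((G' 0 (by simp)).trans ((F₃.reg 0 rfl).trans g0))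
    ((G' 4 (by simp)).trans ((F₃.reg 4 rfl).trans g4)) k26).mono ?_
  rintro t₇ s₇ F₇ ⟨ht₇, h15₇, -, hm₇⟩
  rw [(G' 15 (by simp)), h15₃] at h15₇ hm₇
  rw [F₆.coins rfl, F₅.coins rfl, F₄.coins rfl, F₃.coins rfl, F₂.coins rfl, F₁.coins rfl, hc,
    F₆.mem rfl, F₅.mem rfl, F₄.mem rfl, hm₃] at hm₇
  refine wp_add_frame fun s₈ h19 F₈ => ?_
  rw [F₇.reg 26 rfl, k26, add_zero] at h19
  refine ⟨?_, ?_, ?_, ?_, ?_, ?_, ?_⟩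
  · omega
  · rw [F₈.samples rfl, F₇.samples rfl, F₆.samples rfl, F₅.samples rfl, F₄.samples rfl,
      F₃.samples rfl, hs₂]
  · rw [F₈.mem rfl, hm₇, shiftMem]
  · rw [F₈.reg 15 rfl, h15₇]
  · rw [h19, F₈.reg 15 rfl]
  · rw [F₈.reg 33 rfl, F₇.reg 33 rfl, h33₆]
  · rw [F₈.reg 18 rfl, F₇.reg 18 rfl, F₆.reg 18 rfl, F₅.reg 18 rfl, h18]

end SetupMemory

/-! ### Memory contents as functions of the tapes -/

section TapePoints

variable {n : ℕ}

/-- The `c`-th point given by the coins. -/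
def coinPt (ω : Tape n) (c : ℕ) : Pt n := fun v => if ω.1 (c * n + v) then 1 else 0

theorem coinPt_val (ω : Tape n) (c : ℕ) (v : Fin n) : (coinPt ω c v).val = coinVal ω (c * n + v) := by
  unfold coinPt coinVal; split_ifs <;> rfl

theorem ite_val (x : ZMod 2) : (if x.val = 0 then 0 else 1 : ZMod 2) = x := by
  revert x; decide

theorem memPt_eq {mem : ℕ → ℕ} {j : ℕ} {x : Pt n} (h : ∀ v : Fin n, mem (j + v) = (x v).val) :
    memPt n mem j = x := by
  funext v
  rw [memPt, h, ite_val]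

/-- The random choices of the rank test, read off from the coins. -/
def tapeChoices (ω : Tape n) (lam ρ σ : ℕ) :
    ((Fin lam → Pt n) × (Fin ρ → Pt n)) × (Fin σ → Pt n) :=
  ((fun s => coinPt ω s, fun i => coinPt ω (lam + i)), fun j => coinPt ω (lam + ρ + j))

theorem hashVal_eq_groupOf (ω : Tape n) (lam ρ σ : ℕ) (v : Fin n) :
    hashVal ω lam v = groupOf (tapeChoices ω lam ρ σ).1.1 v :=
  bitsVal_congr fun i hi => by rw [dif_pos hi]; exact (coinPt_val ω i v).symm

theorem val_groupPoint {lam : ℕ} (H : Fin lam → Pt n) (l : ℕ) (x y : Pt n) (v : Fin n) :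
    (groupPoint H l x y v).val = cellVal (groupOf H v) l (x v).val (y v).val := by
  rw [groupPoint, cellVal]
  have hxy : ∀ a b : ZMod 2, (a * b).val = a.val + b.val - 1 ∧ (a * b).val ≤ 1 := by decide
  obtain ⟨h1, h2⟩ := hxy (x v) (y v)
  split_ifs with h
  · rw [h1]; omega
  · rw [ZMod.val_zero]; omega

variable {ω : Tape n} {lam ρ σ m t : ℕ}

theorem coinMem_hash {c : ℕ} (v : Fin n) : coinMem ω lam c v = hashVal ω lam v := by
  rw [coinMem, writeSeg_of_lt v.2]
  have := writeSeg_add (mem := fun _ => 0) (base := 0) (g := hashVal ω lam) v.2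
  rwa [zero_add] at this

theorem coinMem_coin {c i : ℕ} (hi : i < c) {v : ℕ} (hv : v < n) :
    coinMem ω lam c (n + i * n + v) = coinVal ω ((lam + i) * n + v) := by
  rw [coinMem, add_assoc, writeSeg_add (mul_add_lt_mul hi hv), add_mul, add_assoc]

theorem sampleMem_coin {c i : ℕ} (hi : i < c) {v : ℕ} (hv : v < n) :
    sampleMem ω lam c t (n + i * n + v) = coinVal ω ((lam + i) * n + v) := by
  have := mul_add_lt_mul hi hv
  rw [sampleMem, writeSeg_of_lt (by omega), coinMem_coin hi hv]

theorem sampleMem_hash {c : ℕ} (v : Fin n) : sampleMem ω lam c t v = hashVal ω lam v := by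
  have := v.2
  rw [sampleMem, writeSeg_of_lt (by omega), coinMem_hash]

theorem sampleMem_sample {c i : ℕ} (hi : i < t) (v : Fin n) :
    sampleMem ω lam c t (n + (c + i) * n + v) = (ω.2 i v).val := by
  have e : n + (c + i) * n + v = n + c * n + (i * n + v) := by ring
  rw [sampleMem, e, writeSeg_add (mul_add_lt_mul hi v.2), sampleVal_mul_add]

theorem pointMem_of_lt {i : ℕ} (hi : i < ρ + σ + m + t) {v : ℕ} (hv : v < n) :
    pointMem ω lam ρ σ m t (n + i * n + v) =
      sampleMem ω lam (ρ + σ + m) t (n + i * n + v) := by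
  have := mul_add_lt_mul hi hv
  rw [pointMem, writeSeg_of_lt (by omega)]

theorem pointMem_point (q : Fin (2 ^ lam) × Fin ρ × Fin σ) (v : Fin n) :
    pointMem ω lam ρ σ m t (n + (ρ + σ + m + t + ((q.1 * ρ + q.2.1) * σ + q.2.2)) * n + v) =
      (rankPoints lam ρ σ (tapeChoices ω lam ρ σ) q v).val := by
  obtain ⟨l, i, j⟩ := q
  have h1 : (l * ρ + i) * σ + j < 2 ^ lam * ρ * σ := mul_add_lt_mul (mul_add_lt_mul l.2 i.2) j.2
  have h2 := mul_add_lt_mul h1 v.2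
  have e : n + (ρ + σ + m + t + ((l * ρ + i) * σ + j)) * n + v =
    n + (ρ + σ + m + t) * n + (((l * ρ + i) * σ + j) * n + v) := by ring
  have e' : 2 ^ lam * (ρ * (σ * n)) = 2 ^ lam * ρ * σ * n := by ring
  have eb : n + ρ * n + j * n + v = n + (ρ + j) * n + v := by ring
  have hi := i.2
  have hj := j.2
  simp only
  rw [e, pointMem, e', writeSeg_add h2, pointVal_eq _ i.2 j.2 v.2, sampleMem_hash, eb,
    sampleMem_coin (by omega) v.2, sampleMem_coin (by omega) v.2, rankPoints, val_groupPoint,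
    hashVal_eq_groupOf ω lam ρ σ, ← add_assoc lam ρ, ← coinPt_val, ← coinPt_val]
  rfl

/-- The address of the points of the linearity test. -/
abbrev pointBase (n ρ σ : ℕ) : ℕ := n + (ρ + σ) * n

/-- The address of the shifts. -/
abbrev shiftBase (n lam ρ σ m t : ℕ) : ℕ := n + (ρ + σ + m + t + 2 ^ lam * (ρ * σ)) * n

theorem shiftMem_of_lt {i : ℕ} (hi : i < m + t + 2 ^ lam * (ρ * σ)) {v : ℕ} (hv : v < n) :
    shiftMem ω lam ρ σ m t (pointBase n ρ σ + i * n + v) =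
      pointMem ω lam ρ σ m t (n + (ρ + σ + i) * n + v) := by
  have := mul_add_lt_mul (show ρ + σ + i < ρ + σ + m + t + 2 ^ lam * (ρ * σ) by omega) hv
  have e : pointBase n ρ σ + i * n + v = n + (ρ + σ + i) * n + v := by unfold pointBase; ring
  rw [e, shiftMem, writeSeg_of_lt (by omega)]

/-- The points at which the tester compares the function with its self-correction. -/
def tapePoint (ω : Tape n) (lam ρ σ m t : ℕ) (i : ℕ) : Pt n :=
  memPt n (shiftMem ω lam ρ σ m t) (pointBase n ρ σ + i * n)

/-- The shifts of the self-correction. -/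
def tapeShift (ω : Tape n) (lam ρ σ m : ℕ) (i : ℕ) : Pt n := coinPt ω (lam + (ρ + σ + m) + i)

theorem tapePoint_coin {i : ℕ} (hi : i < m) :
    tapePoint ω lam ρ σ m t i = coinPt ω (lam + (ρ + σ) + i) :=
  memPt_eq fun v => by
    rw [shiftMem_of_lt (by omega) v.2, pointMem_of_lt (by omega) v.2,
      sampleMem_coin (by omega) v.2, coinPt_val, add_assoc lam]

theorem tapePoint_sample {i : ℕ} (hi : i < t) : tapePoint ω lam ρ σ m t (m + i) = ω.2 i :=
  memPt_eq fun v => by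
    rw [shiftMem_of_lt (by omega) v.2, pointMem_of_lt (by omega) v.2, ← add_assoc,
      sampleMem_sample hi]

theorem tapePoint_rank (q : Fin (2 ^ lam) × Fin ρ × Fin σ) :
    tapePoint ω lam ρ σ m t (m + t + ((q.1 * ρ + q.2.1) * σ + q.2.2)) =
      rankPoints lam ρ σ (tapeChoices ω lam ρ σ) q :=
  memPt_eq fun v => by
    have h : (q.1 * ρ + q.2.1) * σ + q.2.2 < 2 ^ lam * ρ * σ :=
      mul_add_lt_mul (mul_add_lt_mul q.1.2 q.2.1.2) q.2.2.2
    rw [mul_assoc] at h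
    have e : ∀ x, ρ + σ + (m + t + x) = ρ + σ + m + t + x := fun x => by ring
    rw [shiftMem_of_lt (by omega) v.2, e, pointMem_point]

theorem shiftMem_shift {i : ℕ} (hi : i < m + t + 2 ^ lam * (ρ * σ)) {v : ℕ} (hv : v < n) :
    shiftMem ω lam ρ σ m t (shiftBase n lam ρ σ m t + i * n + v) =
      coinVal ω ((lam + (ρ + σ + m) + i) * n + v) := by
  rw [shiftMem, add_assoc (shiftBase n lam ρ σ m t), writeSeg_add (mul_add_lt_mul hi hv),
    add_mul _ i, ← add_assoc (_ * n)]

theorem memPt_shift {i : ℕ} (hi : i < m + t + 2 ^ lam * (ρ * σ)) :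
    memPt n (shiftMem ω lam ρ σ m t) (shiftBase n lam ρ σ m t + i * n) =
      tapeShift ω lam ρ σ m i :=
  memPt_eq fun v => by rw [shiftMem_shift hi v.2, tapeShift, coinPt_val]

theorem exists_mul_add {N n x : ℕ} (hx : x < N * n) : ∃ i < N, ∃ v < n, x = i * n + v := by
  have hn : 0 < n := Nat.pos_of_ne_zero fun h => by simp [h] at hx
  exact ⟨x / n, Nat.div_lt_of_lt_mul (by rwa [mul_comm]), x % n, Nat.mod_lt _ hn,
    by rw [mul_comm, Nat.div_add_mod]⟩

theorem shiftMem_shift_lt {x : ℕ} (hx : x < (m + t + 2 ^ lam * (ρ * σ)) * n) :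
    shiftMem ω lam ρ σ m t (shiftBase n lam ρ σ m t + x) < 2 := by
  obtain ⟨i, hi, v, hv, rfl⟩ := exists_mul_add hx
  rw [← add_assoc, shiftMem_shift hi hv]
  exact coinVal_lt _ _

theorem exists_rank_index {i : ℕ} (hi : i < 2 ^ lam * (ρ * σ)) :
    ∃ q : Fin (2 ^ lam) × Fin ρ × Fin σ, i = (q.1 * ρ + q.2.1) * σ + q.2.2 := by
  rw [← mul_assoc] at hi
  obtain ⟨x, hx, j, hj, rfl⟩ := exists_mul_add hi
  obtain ⟨l, hl, i, hi', rfl⟩ := exists_mul_add hx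
  exact ⟨(⟨l, hl⟩, ⟨i, hi'⟩, ⟨j, hj⟩), rfl⟩

/-- The index range splits into linearity rounds, samples and rank points, in their order in memory.
-/
theorem forall_index {P : ℕ → Prop} :
    (∀ i < m + t + 2 ^ lam * (ρ * σ), P i) ↔ (∀ i < m, P i) ∧ (∀ i < t, P (m + i)) ∧
      ∀ q : Fin (2 ^ lam) × Fin ρ × Fin σ, P (m + t + ((q.1 * ρ + q.2.1) * σ + q.2.2)) := by
  refine ⟨fun h => ⟨fun i hi => h i (by omega), fun i hi => h _ (by omega), fun q => h _ ?_⟩,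
    fun ⟨h1, h2, h3⟩ i hi => ?_⟩
  · have h : (q.1 * ρ + q.2.1) * σ + q.2.2 < 2 ^ lam * ρ * σ :=
      mul_add_lt_mul (mul_add_lt_mul q.1.2 q.2.1.2) q.2.2.2
    rw [mul_assoc] at h
    omega
  · rcases lt_or_ge i m with him | him
    · exact h1 i him
    · rcases lt_or_ge i (m + t) with hit | hit
      · obtain ⟨j, rfl⟩ := Nat.exists_eq_add_of_le him
        exact h2 j (by omega)
      · obtain ⟨j, rfl⟩ := Nat.exists_eq_add_of_le hit
        obtain ⟨q, rfl⟩ := exists_rank_index (show j < 2 ^ lam * (ρ * σ) by omega)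
        exact h3 q

theorem shiftMem_point_lt {x : ℕ} (hx : x < (m + t + 2 ^ lam * (ρ * σ)) * n) :
    shiftMem ω lam ρ σ m t (pointBase n ρ σ + x) < 2 := by
  obtain ⟨i, hi, v, hv, rfl⟩ := exists_mul_add hx
  rw [← add_assoc, shiftMem_of_lt hi hv]
  clear hx
  revert i
  rw [forall_index (P := fun i => pointMem ω lam ρ σ m t (n + (ρ + σ + i) * n + v) < 2)]
  refine ⟨fun i hi => ?_, fun i hi => ?_, fun q => ?_⟩
  · rw [pointMem_of_lt (by omega) hv, sampleMem_coin (by omega) hv]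
    exact coinVal_lt _ _
  · rw [pointMem_of_lt (by omega) hv, ← add_assoc, sampleMem_sample hi ⟨v, hv⟩]
    exact ZMod.val_lt _
  · have e : ∀ x, ρ + σ + (m + t + x) = ρ + σ + m + t + x := fun x => by ring
    rw [e, pointMem_point q ⟨v, hv⟩]
    exact ZMod.val_lt _

end TapePoints

/-! ### Correctness of the main program -/

section Main

variable {n : ℕ} {f : BoolFn n} {ω : Tape n}

theorem wp_sub_frame {r u v : ℕ} {Q : ℕ → MState n → Prop} {s : MState n}
    (h : ∀ s' : MState n, s'.reg r = s.reg u - s.reg v → Frame (.sub r u v) s s' → Q 1 s') :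
    wp f ω (.sub r u v) Q s :=
  wp_sub.2 (h _ (by simp [MState.setReg]) (Exec.sub (f := f) (ω := ω) r u v s).frame)

/-- The values of the self-corrected function at the points of the rank test. -/
def rankValues (f : BoolFn n) (ω : Tape n) (lam ρ σ m t : ℕ)
    (q : Fin (2 ^ lam) × Fin ρ × Fin σ) : ZMod 2 :=
  corrected f (rankPoints lam ρ σ (tapeChoices ω lam ρ σ) q)
    (tapeShift ω lam ρ σ m (m + t + ((q.1 * ρ + q.2.1) * σ + q.2.2)))

/-- Query the function and compute the ranks. -/
def progAnswers : Prog := progQueries ;; progRank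

theorem wp_answers {s : MState n} {lam ρ σ m t : ℕ} (hρ : 0 < ρ) (h0 : s.reg 0 = n)
    (h4 : s.reg 4 = 1) (h26 : s.reg 26 = 0) (h8 : s.reg 8 = 2 ^ lam) (h10 : s.reg 10 = ρ)
    (h11 : s.reg 11 = σ) (h13 : s.reg 13 = m) (h14 : s.reg 14 = t)
    (h39 : s.reg 39 = ρ * σ) (hm : s.mem = shiftMem ω lam ρ σ m t)
    (h15 : s.reg 15 = shiftBase n lam ρ σ m t + (m + t + 2 ^ lam * (ρ * σ)) * n)
    (h17 : s.reg 17 = pointBase n ρ σ) (h18 : s.reg 18 = shiftBase n lam ρ σ m t)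
    (h19 : s.reg 19 = s.reg 15) (h33 : s.reg 33 = m + t + 2 ^ lam * (ρ * σ)) (hq : s.queries = []) :
    wp f ω progAnswers (fun T s' =>
      T ≤ (m + t + 2 ^ lam * (ρ * σ)) * (n * 13 + 17) +
        2 ^ lam * (σ * (ρ * (σ * 12 + 15) + σ * 6 + 17) + 6) + 10 ∧
      s'.queries = queryList (tapePoint ω lam ρ σ m t) (tapeShift ω lam ρ σ m)
        (m + t + 2 ^ lam * (ρ * σ)) ∧
      (s'.reg 34 = 0 ↔ ∀ i < m + t + 2 ^ lam * (ρ * σ), f (tapePoint ω lam ρ σ m t i) +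
        corrected f (tapePoint ω lam ρ σ m t i) (tapeShift ω lam ρ σ m i) = 0) ∧
      s'.reg 35 = ∑ l : Fin (2 ^ lam), (Matrix.of fun (i : Fin ρ) (j : Fin σ) =>
        rankValues f ω lam ρ σ m t (l, i, j)).rank) s := by
  rw [progAnswers, wp_seq]
  have hle : pointBase n ρ σ + (m + t + 2 ^ lam * (ρ * σ)) * n = shiftBase n lam ρ σ m t := by
    unfold pointBase shiftBase; ring
  refine (wp_queries h0 h4 h26 h17 h18 h15 h33 hle.le le_rfl hq
    (fun x hx => by rw [hm]; exact shiftMem_point_lt hx)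
    (fun x hx => by rw [hm]; exact shiftMem_shift_lt hx)).mono ?_
  rintro t₁ s₁ F₁ ⟨ht₁, h15₁, h34, hq₁, hV⟩
  rw [hm] at h34 hq₁ hV
  set N := m + t + 2 ^ lam * (ρ * σ) with hN
  have hU : ∀ i, memPt n (shiftMem ω lam ρ σ m t) (pointBase n ρ σ + i * n) =
    tapePoint ω lam ρ σ m t i := fun _ => rfl
  have hZ : ∀ i < N, memPt n (shiftMem ω lam ρ σ m t) (shiftBase n lam ρ σ m t + i * n) =
    tapeShift ω lam ρ σ m i := fun i hi => memPt_shift hi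
  -- The shifts are identified only below `N`, so the two lists are compared by induction rather
  -- than by equality of functions.
  have hql : ∀ M ≤ N, queryList (fun i => memPt n (shiftMem ω lam ρ σ m t) (pointBase n ρ σ + i * n))
      (fun i => memPt n (shiftMem ω lam ρ σ m t) (shiftBase n lam ρ σ m t + i * n)) M =
      queryList (tapePoint ω lam ρ σ m t) (tapeShift ω lam ρ σ m) M := by
    intro M
    induction M with
    | zero => exact fun _ => rfl
    | succ M ih => intro h; rw [queryList, queryList, ih (by omega), hZ M (by omega), hU]
  rw [hql N le_rfl] at hq₁
  have hcell : ∀ q : Fin (2 ^ lam) × Fin ρ × Fin σ,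
      s₁.mem (s.reg 15 + (m + t) + ((q.1 * ρ + q.2.1) * σ + q.2.2)) =
      (rankValues f ω lam ρ σ m t q).val := by
    intro q
    have h : (q.1 * ρ + q.2.1) * σ + q.2.2 < 2 ^ lam * ρ * σ :=
      mul_add_lt_mul (mul_add_lt_mul q.1.2 q.2.1.2) q.2.2.2
    rw [mul_assoc] at h
    rw [add_assoc, h15, hV _ (by omega), hZ _ (by omega), hU, tapePoint_rank, rankValues]
  refine (wp_rank (base := s.reg 15 + (m + t)) ((F₁.reg 4 rfl).trans h4) ((F₁.reg 26 rfl).trans h26)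
    ((F₁.reg 8 rfl).trans h8) ((F₁.reg 39 rfl).trans h39) ((F₁.reg 10 rfl).trans h10)
    ((F₁.reg 11 rfl).trans h11) h15₁ ?_ ?_ hρ ?_).mono ?_
  · rw [F₁.reg 19 rfl, F₁.reg 13 rfl, F₁.reg 14 rfl, h13, h14, h19, add_assoc]
  · rw [h15]; omega
  · intro x hx
    obtain ⟨q, rfl⟩ := exists_rank_index hx
    rw [hcell]
    exact ZMod.val_lt _
  rintro t₂ s₂ F₂ ⟨ht₂, h35⟩
  refine ⟨by omega, (F₂.queries rfl).trans hq₁, ?_, ?_⟩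
  · rw [F₂.reg 34 rfl, h34, sum_eq_zero_iff]
    refine forall_congr' fun i => ?_
    rw [mem_range]
    refine forall_congr' fun hi => ?_
    rw [ZMod.val_eq_zero, hZ i hi, hU]
  · rw [h35, ← Fin.sum_univ_eq_sum_range fun l =>
      (memMatrix ρ σ s₁.mem (s.reg 15 + (m + t) + l * (ρ * σ))).rank]
    refine sum_congr rfl fun l _ => congrArg _ ?_
    ext i j
    have e : s.reg 15 + (m + t) + l * (ρ * σ) + i * σ + j =
      s.reg 15 + (m + t) + ((l * ρ + i) * σ + j) := by ring
    rw [memMatrix, Matrix.of_apply, Matrix.of_apply, e, hcell (l, i, j), ZMod.natCast_zmod_val]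

/-- The tester, without the case of distance parameters above one. -/
def progMain : Prog :=
  progParams ;; progCoins ;; progRest ;; progAnswers ;; .sub 0 4 34 ;; .sub 24 35 1 ;; .sub 0 0 24

/-- The acceptance condition of the program. -/
def MachineAccepts (f : BoolFn n) (ω : Tape n) (k lam ρ σ m t : ℕ) : Prop :=
  (∀ i < m + t + 2 ^ lam * (ρ * σ), f (tapePoint ω lam ρ σ m t i) +
    corrected f (tapePoint ω lam ρ σ m t i) (tapeShift ω lam ρ σ m i) = 0) ∧
  RankVerdict k lam ρ σ (rankValues f ω lam ρ σ m t)

/-- A bound for the running time in terms of the parameters. -/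
def mainTime (n k κ lam t : ℕ) : ℕ :=
  let q := 2 ^ lam * (4 * κ * (6 * κ))
  (k * 4 + κ * 17 + 2 ^ lam * 3 + t * 3 + 30) +
  (lam * (n * 8 + 5) + (4 * κ + 6 * κ + 32 * q) * (n * 5 + 4) + 11) +
  (t * (n + 4) + 2 ^ lam * (4 * κ * (6 * κ * (n * 16 + 6) + 6) + 6) +
    (32 * q + t + q) * (n * 5 + 4) + 11) +
  ((32 * q + t + q) * (n * 13 + 17) +
    2 ^ lam * (6 * κ * (4 * κ * (6 * κ * 12 + 15) + 6 * κ * 6 + 17) + 6) + 10) + 3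

theorem wp_main (k : ℕ) {a b : ℕ} (ha : 0 < a) (hb : 0 < b) {s : MState n} (h0 : s.reg 0 = n)
    (h1 : s.reg 1 = k) (h2 : s.reg 2 = a) (h3 : s.reg 3 = b) (hmem : s.mem = fun _ => 0)
    (hcoins : s.coins = 0) (hsamples : s.samples = 0) (hqueries : s.queries = []) :
    wp f ω progMain (fun T s' => T ≤ mainTime n k (kapOf k) (lamOf k) (sampleCount a b) ∧
      s'.samples = sampleCount a b ∧
      s'.queries = queryList
        (tapePoint ω (lamOf k) (4 * kapOf k) (6 * kapOf k) (32 * rankSize k) (sampleCount a b))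
        (tapeShift ω (lamOf k) (4 * kapOf k) (6 * kapOf k) (32 * rankSize k))
        (32 * rankSize k + sampleCount a b + rankSize k) ∧
      (s'.reg 0 ≠ 0 ↔ MachineAccepts f ω k (lamOf k) (4 * kapOf k) (6 * kapOf k)
        (32 * rankSize k) (sampleCount a b))) s := by
  rw [progMain, wp_seq]
  refine (wp_params ha hb h1 h2 h3).mono ?_
  rintro t₁ s₁ F₁ ⟨ht₁, h4, h26, h8, h9, h10, h11, h39, h12, h13, h14⟩
  have h0₁ := (F₁.reg 0 rfl).trans h0
  rw [wp_seq]
  refine (wp_coins h0₁ h4 h26 h9 h10 h11 h13 ((F₁.mem rfl).trans hmem)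
    ((F₁.coins rfl).trans hcoins)).mono ?_
  rintro t₂ s₂ F₂ ⟨ht₂, hc₂, hm₂, h15₂, h16₂, h17₂⟩
  rw [wp_seq]
  refine (wp_rest ((F₂.reg 0 rfl).trans h0₁) ((F₂.reg 4 rfl).trans h4) ((F₂.reg 26 rfl).trans h26)
    ((F₂.reg 8 rfl).trans h8) ((F₂.reg 10 rfl).trans h10) ((F₂.reg 11 rfl).trans h11)
    ((F₂.reg 13 rfl).trans h13) ((F₂.reg 14 rfl).trans h14) ((F₂.reg 12 rfl).trans h12)
    ((F₂.samples rfl).trans ((F₁.samples rfl).trans hsamples)) hc₂ hm₂ h15₂ h16₂).mono ?_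
  rintro t₃ s₃ F₃ ⟨ht₃, hs₃, hm₃, h15₃, h19₃, h33₃, h18₃⟩
  rw [wp_seq]
  have hκ := kapOf_pos k
  have h4₃ := (F₃.reg 4 rfl).trans ((F₂.reg 4 rfl).trans h4)
  refine (wp_answers (by omega) ((F₃.reg 0 rfl).trans ((F₂.reg 0 rfl).trans h0₁)) h4₃
    ((F₃.reg 26 rfl).trans ((F₂.reg 26 rfl).trans h26))
    ((F₃.reg 8 rfl).trans ((F₂.reg 8 rfl).trans h8))
    ((F₃.reg 10 rfl).trans ((F₂.reg 10 rfl).trans h10))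
    ((F₃.reg 11 rfl).trans ((F₂.reg 11 rfl).trans h11))
    ((F₃.reg 13 rfl).trans ((F₂.reg 13 rfl).trans h13))
    ((F₃.reg 14 rfl).trans ((F₂.reg 14 rfl).trans h14))
    ((F₃.reg 39 rfl).trans ((F₂.reg 39 rfl).trans h39)) hm₃ h15₃
    ((F₃.reg 17 rfl).trans h17₂) h18₃ h19₃ h33₃
    ((F₃.queries rfl).trans ((F₂.queries rfl).trans ((F₁.queries rfl).trans hqueries)))).mono ?_
  rintro t₄ s₄ F₄ ⟨ht₄, hq₄, h34, h35⟩
  rw [wp_seq]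
  refine wp_sub_frame fun s₅ h0₅ F₅ => ?_
  rw [wp_seq]
  refine wp_sub_frame fun s₆ h24₆ F₆ => ?_
  refine wp_sub_frame fun s₇ h0₇ F₇ => ?_
  have h1₅ : s₅.reg 1 = k := by
    rw [F₅.reg 1 rfl, F₄.reg 1 rfl, F₃.reg 1 rfl, F₂.reg 1 rfl, F₁.reg 1 rfl, h1]
  refine ⟨?_, ?_, ?_, ?_⟩
  · rw [mainTime]; simp only [rankSize] at *; omega
  · rw [F₇.samples rfl, F₆.samples rfl, F₅.samples rfl, F₄.samples rfl, hs₃]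
  · rw [F₇.queries rfl, F₆.queries rfl, F₅.queries rfl, hq₄]; rfl
  -- With truncated subtraction this is nonzero exactly when no discrepancy was counted and the rank
  -- sum is at most k.
  · have e : s₇.reg 0 = 1 - s₄.reg 34 - (s₄.reg 35 - k) := by
      rw [h0₇, F₆.reg 0 rfl, h0₅, h24₆, F₅.reg 35 rfl, h1₅, F₄.reg 4 rfl, h4₃]
    have e' : s₇.reg 0 ≠ 0 ↔ s₄.reg 34 = 0 ∧ s₄.reg 35 ≤ k := by omega
    rw [e', h34, h35, MachineAccepts, RankVerdict]

/-- The tester: it accepts at once when the distance parameter exceeds one. -/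
def testerProgram : Prog := .sub 24 2 3 ;; .ite 24 (.const 0 1) progMain

end Main

/-! ### The law of finitely many points on the tapes -/

section TapeMeasure

/-- Distinct coordinates of an infinite product are independent: the event is a cylinder over the
image of `idx`, and injectivity leaves one condition for each coordinate. -/
theorem infinitePi_forall_mem {X κ : Type*} [MeasurableSpace X] [Fintype κ] (μ : Measure X)
    [IsProbabilityMeasure μ] {idx : κ → ℕ} (hidx : Function.Injective idx) {B : κ → Set X}
    (hB : ∀ p, MeasurableSet (B p)) :
    Measure.infinitePi (fun _ : ℕ => μ) {b | ∀ p, b (idx p) ∈ B p} = ∏ p, μ (B p) := by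
  classical
  have e : {b : ℕ → X | ∀ p, b (idx p) ∈ B p} =
      Set.pi (univ.image idx : Finset ℕ) fun j => ⋂ p, ⋂ _ : idx p = j, B p := by
    ext b
    simp only [Set.mem_ofPred_eq, Set.mem_pi, coe_image, coe_univ, Set.image_univ, Set.mem_range,
      Set.mem_iInter, forall_exists_index]
    exact ⟨fun h j q _ p hp => hp ▸ h p, fun h p => h _ p rfl p rfl⟩
  rw [e, Measure.infinitePi_pi _ fun j _ => .iInter fun p => .iInter fun _ => hB p,
    prod_image fun p _ q _ h => hidx h]
  refine prod_congr rfl fun p _ => congrArg _ ?_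
  ext x
  simp only [Set.mem_iInter]
  exact ⟨fun h => h p rfl, fun h q hq => hidx hq ▸ h⟩

variable {n t : ℕ}

instance (D : PMF (Pt n)) : IsProbabilityMeasure (tapeMeasure D) := by
  unfold tapeMeasure; infer_instance

theorem tapeMeasure_fiber (D : PMF (Pt n)) {ι : Type*} [Fintype ι] [DecidableEq ι] {c : ι → ℕ}
    (hc : Function.Injective c) (s : ι → Pt n) (xs : Fin t → Pt n) :
    tapeMeasure D {ω | (∀ i, coinPt ω (c i) = s i) ∧ ∀ i : Fin t, ω.2 i = xs i} =
      ENNReal.ofReal (1 / (Fintype.card (ι → Pt n) : ℝ) * ∏ i, (D (xs i)).toReal) := by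
  classical
  have e : {ω : Tape n | (∀ i, coinPt ω (c i) = s i) ∧ ∀ i : Fin t, ω.2 i = xs i} =
      {b : ℕ → Bool | ∀ p : ι × Fin n, b (c p.1 * n + p.2) ∈
        {β : Bool | (if β then 1 else 0) = s p.1 p.2}} ×ˢ
      {y : ℕ → Pt n | ∀ i : Fin t, y i ∈ {x | x = xs i}} := by
    ext ω
    simp only [Set.mem_ofPred_eq, Set.mem_prod, funext_iff, coinPt, Prod.forall]
  -- Quotient and remainder by `n` recover the point and the coordinate, so no coin serves two bits.
  have hidx : Function.Injective fun p : ι × Fin n => c p.1 * n + p.2 := by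
    rintro ⟨i, v⟩ ⟨j, w⟩ h
    have h1 : c i = c j := by
      rw [← mul_add_div_of_lt (i := c i) v.2, ← mul_add_div_of_lt (i := c j) w.2]
      exact congrArg (· / n) h
    have h2 : (v : ℕ) = w := by
      rw [← mul_add_mod_of_lt (i := c i) v.2, ← mul_add_mod_of_lt (i := c j) w.2]
      exact congrArg (· % n) h
    rw [hc h1, Fin.ext h2]
  have hcoin : ∀ x : ZMod 2, (PMF.uniformOfFintype Bool).toMeasure {β : Bool | (if β then 1 else 0) = x} =
      2⁻¹ := by
    intro x
    have hx : ∃ β₀ : Bool, {β : Bool | (if β then 1 else 0) = x} = {β₀} := by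
      have : x = 0 ∨ x = 1 := by revert x; decide
      rcases this with rfl | rfl
      · exact ⟨false, by ext β; cases β <;> simp⟩
      · exact ⟨true, by ext β; cases β <;> simp⟩
    obtain ⟨β₀, h⟩ := hx
    rw [h, PMF.toMeasure_apply_singleton _ _ (measurableSet_singleton _)]
    simp
  rw [e, tapeMeasure, Measure.prod_prod, infinitePi_forall_mem _ hidx fun _ => .of_discrete,
    infinitePi_forall_mem _ Fin.val_injective fun _ => measurableSet_Pt _,
    ENNReal.ofReal_mul (by positivity), ENNReal.ofReal_prod_of_nonneg fun _ _ => ENNReal.toReal_nonneg]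
  congr 1
  · rw [prod_congr rfl fun p _ => hcoin _, prod_const, card_univ, Fintype.card_prod]
    simp only [Fintype.card_fin, Fintype.card_pi, ZMod.card, prod_const, card_univ]
    rw [one_div, ENNReal.ofReal_inv_of_pos (by positivity)]
    simp [ENNReal.inv_pow, pow_mul', ENNReal.ofReal_pow]
  · refine prod_congr rfl fun i _ => ?_
    rw [ENNReal.ofReal_toReal (D.apply_ne_top _), Set.ofPred_eq_eq_singleton,
      PMF.toMeasure_apply_singleton _ _ (measurableSet_Pt _)]

theorem measurableSet_tapeFiber {ι : Type*} [Fintype ι] (c : ι → ℕ) (s : ι → Pt n)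
    (xs : Fin t → Pt n) :
    MeasurableSet {ω : Tape n | (∀ i, coinPt ω (c i) = s i) ∧ ∀ i : Fin t, ω.2 i = xs i} := by
  simp only [funext_iff, coinPt, Set.ofPred_and, Set.ofPred_forall]
  refine .inter (.iInter fun i => .iInter fun v => ?_) (.iInter fun i => .iInter fun v => ?_)
  · have : Measurable fun ω : Tape n => ω.1 (c i * n + v) := by fun_prop
    exact this (t := {β : Bool | (if β then 1 else 0) = s i v}) .of_discrete
  · have : Measurable fun ω : Tape n => ω.2 i := by fun_prop
    exact this (measurableSet_Pt {x | x v = xs i v})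

/-- The law of finitely many points read off from the tapes. -/
theorem tapeMeasure_real_eq (D : PMF (Pt n)) {ι : Type*} [Fintype ι] [DecidableEq ι] {c : ι → ℕ}
    (hc : Function.Injective c) (A : (ι → Pt n) → (Fin t → Pt n) → Prop) :
    (tapeMeasure D).real {ω | A (fun i => coinPt ω (c i)) fun i => ω.2 i} = sampleProb D A := by
  classical
  -- The event is a finite disjoint union of fibres over the values of the seed and of the sample.
  have e : {ω : Tape n | A (fun i => coinPt ω (c i)) fun i => ω.2 i} =
      ⋃ p ∈ (univ.filter fun p : (ι → Pt n) × (Fin t → Pt n) => A p.1 p.2),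
        {ω | (∀ i, coinPt ω (c i) = p.1 i) ∧ ∀ i : Fin t, ω.2 i = p.2 i} := by
    ext ω
    simp only [Set.mem_ofPred_eq, Set.mem_iUnion, mem_filter, mem_univ, true_and, exists_prop,
      Prod.exists, ← funext_iff (f := fun i => coinPt ω (c i)), ← funext_iff (f := fun i : Fin t => ω.2 i)]
    constructor
    · exact fun h => ⟨_, _, h, rfl, rfl⟩
    · rintro ⟨_, _, h, rfl, rfl⟩; exact h
  rw [e, measureReal_biUnion_finset]
  · rw [sum_filter, Fintype.sum_prod_type, sampleProb]
    refine sum_congr rfl fun s _ => sum_congr rfl fun xs _ => ?_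
    rw [Measure.real, tapeMeasure_fiber D hc, ENNReal.toReal_ofReal
      (mul_nonneg (by positivity) (prod_nonneg fun _ _ => ENNReal.toReal_nonneg))]
    split_ifs <;> simp
  · rintro p - q - hpq
    refine Set.disjoint_left.2 fun ω hp hq => hpq (Prod.ext ?_ ?_)
    · exact funext fun i => (hp.1 i).symm.trans (hq.1 i)
    · exact funext fun i => (hp.2 i).symm.trans (hq.2 i)
  · exact fun p _ => measurableSet_tapeFiber c p.1 p.2

end TapeMeasure

/-! ### The random choices of the machine as a seed of the scheme -/

section Seed

variable {n lam ρ σ m t k : ℕ} {ω : Tape n} {f : BoolFn n}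

/-- The places of the random points of the tester. -/
abbrev SeedIndex (lam ρ σ m t : ℕ) : Type :=
  (Fin m ⊕ Fin m) ⊕ ((((Fin lam ⊕ Fin ρ) ⊕ Fin σ) ⊕ (Fin (2 ^ lam) × Fin ρ × Fin σ)) ⊕ Fin t)

/-- The position on the coin tape. -/
def seedPosition : SeedIndex lam ρ σ m t → ℕ
  | .inl (.inl i) => lam + (ρ + σ) + i
  | .inl (.inr i) => lam + (ρ + σ + m) + i
  | .inr (.inl (.inl (.inl (.inl s)))) => s
  | .inr (.inl (.inl (.inl (.inr i)))) => lam + i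
  | .inr (.inl (.inl (.inr j))) => lam + ρ + j
  | .inr (.inl (.inr q)) => lam + (ρ + σ + m) + (m + t + ((q.1 * ρ + q.2.1) * σ + q.2.2))
  | .inr (.inr i) => lam + (ρ + σ + m) + (m + i)

theorem rankIndex_injective {q q' : Fin (2 ^ lam) × Fin ρ × Fin σ}
    (h : ((q.1 * ρ + q.2.1) * σ + q.2.2 : ℕ) = (q'.1 * ρ + q'.2.1) * σ + q'.2.2) : q = q' := by
  obtain ⟨l, i, j⟩ := q
  obtain ⟨l', i', j'⟩ := q'
  simp only at h
  have h1 := congrArg (· / σ) h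
  have h2 := congrArg (· % σ) h
  simp only [mul_add_div_of_lt j.2, mul_add_div_of_lt j'.2, mul_add_mod_of_lt j.2,
    mul_add_mod_of_lt j'.2] at h1 h2
  have h3 := congrArg (· / ρ) h1
  have h4 := congrArg (· % ρ) h1
  simp only [mul_add_div_of_lt i.2, mul_add_div_of_lt i'.2, mul_add_mod_of_lt i.2,
    mul_add_mod_of_lt i'.2] at h3 h4
  rw [Fin.ext h3, Fin.ext h4, Fin.ext h2]

/-- The shift of a linearity round plays the role of its second point `y`; all places read lie in
disjoint stretches of the coin tape, which yields independence. -/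
theorem seedPosition_injective :
    Function.Injective (seedPosition : SeedIndex lam ρ σ m t → ℕ) := by
  rintro ((i | i) | ((((i | i) | i) | q) | i)) ((j | j) | ((((j | j) | j) | q') | j)) h <;>
    simp only [seedPosition] at h
  case inr.inl.inr.inr.inl.inr => rw [rankIndex_injective (q := q) (q' := q') (by omega)]
  all_goals first
    | (exfalso; omega)
    | (obtain rfl : i = j := Fin.ext (by omega); rfl)

/-- The random choices of the scheme from the random points. -/
def seedEquiv : (SeedIndex lam ρ σ m t → Pt n) ≃ (Fin m → Pt n × Pt n) ×
    ((((Fin lam → Pt n) × (Fin ρ → Pt n)) × (Fin σ → Pt n)) ×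
      (Fin (2 ^ lam) × Fin ρ × Fin σ → Pt n)) × (Fin t → Pt n) where
  toFun g := (fun i => (g (.inl (.inl i)), g (.inl (.inr i))),
    (((fun s => g (.inr (.inl (.inl (.inl (.inl s))))), fun i => g (.inr (.inl (.inl (.inl (.inr i)))))),
      fun j => g (.inr (.inl (.inl (.inr j))))), fun q => g (.inr (.inl (.inr q)))),
    fun i => g (.inr (.inr i)))
  invFun s
    | .inl (.inl i) => (s.1 i).1
    | .inl (.inr i) => (s.1 i).2
    | .inr (.inl (.inl (.inl (.inl i)))) => s.2.1.1.1.1 i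
    | .inr (.inl (.inl (.inl (.inr i)))) => s.2.1.1.1.2 i
    | .inr (.inl (.inl (.inr i))) => s.2.1.1.2 i
    | .inr (.inl (.inr q)) => s.2.1.2 q
    | .inr (.inr i) => s.2.2 i
  left_inv g := by
    funext x
    rcases x with (i | i) | ((((i | i) | i) | q) | i) <;> rfl
  right_inv _ := rfl

/-- Only this implication is used: the machine also compares `f` with its self-correction at the
rank points, which can only add rejections and never affects a parity. -/
theorem MachineAccepts.schemeAccepts (h : MachineAccepts f ω k lam ρ σ m t) :
    SchemeAccepts (rankPoints lam ρ σ) (fun _ => RankVerdict k lam ρ σ) f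
      (seedEquiv fun i : SeedIndex lam ρ σ m t => coinPt ω (seedPosition i)) fun i => ω.2 i := by
  obtain ⟨h, hV⟩ := h
  rw [forall_index] at h
  obtain ⟨h1, h2, -⟩ := h
  have h2z : ∀ x y z : ZMod 2, x + (y + z) = 0 → x + y = z ∧ x = z + y := by decide
  refine ⟨fun i => ?_, ?_, fun i => ?_⟩
  · have := h1 i i.2
    rw [tapePoint_coin i.2] at this
    exact (h2z _ _ _ this).1
  · have e : rankValues f ω lam ρ σ m t = fun q => f (rankPoints lam ρ σ (tapeChoices ω lam ρ σ) q +
        tapeShift ω lam ρ σ m (m + t + ((q.1 * ρ + q.2.1) * σ + q.2.2))) +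
        f (tapeShift ω lam ρ σ m (m + t + ((q.1 * ρ + q.2.1) * σ + q.2.2))) :=
      funext fun q => add_comm _ _
    rw [e] at hV
    exact hV
  · have := h2 i i.2
    rw [tapePoint_sample i.2] at this
    exact (h2z _ _ _ this).2

theorem tapeMeasure_not_machineAccepts (hm : 24 * (2 ^ lam * (ρ * σ)) ≤ m) {κ : ℕ} (hκ : 4 ≤ κ)
    (hρ : ρ = 4 * κ) (hσ : σ = 6 * κ) (h₁ : lam ≤ κ) (h₂ : k + 1 ≤ κ * 2 ^ lam)
    {ε : ℝ} (hε : 0 < ε) (ht : 2 ≤ ε * t) (D : PMF (Pt n)) (hf : IsFarFrom D ε f (kLinearStar n k)) :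
    2 / 3 ≤ (tapeMeasure D).real {ω | ¬ MachineAccepts f ω k lam ρ σ m t} := by
  classical
  subst hρ hσ
  have hcard : Fintype.card (Fin (2 ^ lam) × Fin (4 * κ) × Fin (6 * κ)) =
      2 ^ lam * (4 * κ * (6 * κ)) := by simp
  have h := sampleProb_schemeAccepts_le (k := k) (m := m) (t := t) (rankPoints lam (4 * κ) (6 * κ))
    (fun _ => RankVerdict k lam (4 * κ) (6 * κ)) (fun S hS => unifProb_rankVerdict_le hκ h₁ h₂ S hS)
    (by rw [hcard]; exact Nat.one_le_iff_ne_zero.2 (by positivity)) (by rw [hcard]; exact hm)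
    hε ht D f hf
  have e := tapeMeasure_real_eq D (seedPosition_injective (lam := lam) (ρ := 4 * κ) (σ := 6 * κ)
    (m := m) (t := t)) fun s xs => ¬ SchemeAccepts (rankPoints lam (4 * κ) (6 * κ))
      (fun _ => RankVerdict k lam (4 * κ) (6 * κ)) f (seedEquiv s) xs
  rw [sampleProb_not, sampleProb_equiv D seedEquiv] at e
  have h' := (show (2 / 3 : ℝ) ≤ _ by linarith).trans_eq e.symm
  -- Monotonicity holds for arbitrary sets, so measurability of the acceptance event is not an
  -- issue.
  exact h'.trans (measureReal_mono fun ω hω hA => absurd hA.schemeAccepts hω)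

end Seed

/-! ### Bounds on queries, samples and time -/

section Bounds

/-- By minimality of the exponent, the product is at most 2k unless the exponent is zero. -/
theorem kapOf_mul_two_pow_le (k : ℕ) : kapOf k * 2 ^ lamOf k ≤ kapOf k + 2 * k := by
  rcases Nat.eq_zero_or_pos (lamOf k) with h | h
  · rw [h]; omega
  · obtain ⟨i, hi⟩ := Nat.exists_eq_add_of_lt h
    have := lt_of_lt_lamOf (k := k) (i := i) (by omega)
    rw [hi, zero_add, pow_succ, ← mul_assoc]
    omega

theorem kapOf_le_log {k : ℕ} (hk : 2 ≤ k) : (kapOf k : ℝ) ≤ 8 * Real.log k := by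
  have h2 : Real.log 2 ≤ Real.log k := Real.log_le_log (by norm_num) (by exact_mod_cast hk)
  have hl := Real.log_two_gt_d9
  rcases (four_le_kapOf k).eq_or_lt with h | h
  · rw [← h]; norm_num; linarith
  · have h1 := lt_of_lt_kapOf (k := k) (i := kapOf k - 5) (by omega)
    rw [show 4 + (kapOf k - 5) = kapOf k - 1 by omega] at h1
    have h3 : ((2 : ℝ) ^ (kapOf k - 1)) ≤ k := by exact_mod_cast Nat.lt_succ_iff.1 h1
    have h4 := Real.log_le_log (by positivity) h3
    rw [Real.log_pow, Nat.cast_sub (by omega), Nat.cast_one] at h4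
    have h5 : (1 : ℝ) ≤ kapOf k := by exact_mod_cast kapOf_pos k
    nlinarith

theorem rankSize_le (k : ℕ) : rankSize k ≤ 24 * (kapOf k * (kapOf k + 2 * k)) := by
  calc rankSize k = 24 * (kapOf k * (kapOf k * 2 ^ lamOf k)) := by rw [rankSize]; ring
    _ ≤ _ := by gcongr; exact kapOf_mul_two_pow_le k

theorem rankSize_le_log (k : ℕ) : (rankSize k : ℝ) ≤ 960 * (k * Real.log k) + 840 := by
  have h : (rankSize k : ℝ) ≤ 24 * (kapOf k * (kapOf k + 2 * k)) := by exact_mod_cast rankSize_le k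
  have hκ : (kapOf k : ℝ) ≤ 4 + k := by exact_mod_cast kapOf_le k
  have h0 : (0 : ℝ) ≤ kapOf k := by positivity
  -- For k ≤ 1, κ ≤ 5 gives the additive constant 24 · 5 · 7 = 840. For k ≥ 2, κ + 2k ≤ 5k and κ ≤ 8
  -- log k give 24 · 40 = 960.
  rcases lt_or_ge k 2 with hk | hk
  · have hk' : (k : ℝ) ≤ 1 := by exact_mod_cast Nat.lt_succ_iff.1 hk
    have hlog : 0 ≤ (k : ℝ) * Real.log k := mul_nonneg (by positivity) (Real.log_natCast_nonneg k)
    nlinarith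
  · have hk' : (2 : ℝ) ≤ k := by exact_mod_cast hk
    have hl := kapOf_le_log hk
    have : (kapOf k : ℝ) * (kapOf k + 2 * k) ≤ 8 * Real.log k * (5 * k) := by
      gcongr; linarith
    nlinarith

theorem two_mul_le_sampleCount_mul {a b : ℕ} (ha : 0 < a) (hb : 0 < b) :
    2 * b ≤ sampleCount a b * a :=
  not_lt.1 ((lt_sampleCount_iff ha hb).not.1 (lt_irrefl _))

theorem sampleCount_mul_le {a b : ℕ} (ha : 0 < a) (hb : 0 < b) :
    sampleCount a b * a ≤ 2 * b + a := by
  have h := (lt_sampleCount_iff (i := sampleCount a b - 1) ha hb).1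
    (Nat.sub_lt (Nat.succ_pos _) one_pos)
  rw [Nat.sub_mul] at h
  omega

theorem sampleCount_le {a b : ℕ} (ha : 0 < a) (hb : 0 < b) {ε : ℝ} (hε : 0 < ε)
    (h : ε / 2 ≤ (a : ℝ) / b) : (sampleCount a b : ℝ) ≤ 4 * (1 / ε) + 1 := by
  have ha' : (0 : ℝ) < a := by exact_mod_cast ha
  have hb' : (0 : ℝ) < b := by exact_mod_cast hb
  have h1 : (sampleCount a b : ℝ) * a ≤ 2 * b + a := by exact_mod_cast sampleCount_mul_le ha hb
  rw [div_le_div_iff₀ (by norm_num) hb'] at h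
  have h2 : (sampleCount a b - 1 : ℝ) * ε ≤ 4 := by
    rcases le_or_gt (sampleCount a b - 1 : ℝ) 0 with h0 | h0
    · nlinarith
    · have : (sampleCount a b - 1 : ℝ) * ε * b ≤ 4 * b := by nlinarith
      exact le_of_mul_le_mul_right this hb'
  rw [mul_one_div, ← sub_le_iff_le_add, le_div_iff₀ hε]
  exact h2

theorem two_le_mul_sampleCount {a b : ℕ} (ha : 0 < a) (hb : 0 < b) {ε : ℝ}
    (h : (a : ℝ) / b ≤ ε) : 2 ≤ ε * sampleCount a b := by
  have hb' : (0 : ℝ) < b := by exact_mod_cast hb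
  have h1 : (2 * b : ℝ) ≤ sampleCount a b * a := by exact_mod_cast two_mul_le_sampleCount_mul ha hb
  rw [div_le_iff₀ hb'] at h
  have : (2 * b : ℝ) ≤ ε * sampleCount a b * b := by
    have h0 : (0 : ℝ) ≤ sampleCount a b := by positivity
    nlinarith
  exact le_of_mul_le_mul_right this hb'

theorem mainTime_le (n k t : ℕ) :
    mainTime n k (kapOf k) (lamOf k) t + 2 ≤ 100000 * (n + k + t + 4) ^ 4 := by
  obtain ⟨Y, hY⟩ : ∃ Y, Y = n + k + t + 4 := ⟨_, rfl⟩
  have hκ : kapOf k ≤ Y := (kapOf_le k).trans (by omega)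
  have hlam : lamOf k ≤ Y := (lamOf_le k).trans hκ
  have hL : 2 ^ lamOf k ≤ 2 * Y := by
    have h1 := kapOf_mul_two_pow_le k
    have h2 := four_le_kapOf k
    have h3 : 2 ^ lamOf k ≤ k + 1 := by
      by_contra! h
      nlinarith
    omega
  have hn : n ≤ Y := by omega
  have hk : k ≤ Y := by omega
  have ht : t ≤ Y := by omega
  have hY1 : 1 ≤ Y := by omega
  rw [← hY, mainTime]
  generalize kapOf k = κ at *
  generalize lamOf k = lam at *
  generalize 2 ^ lam = L at *
  have hq : L * (4 * κ * (6 * κ)) ≤ 48 * Y ^ 3 :=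
    calc L * (4 * κ * (6 * κ)) ≤ 2 * Y * (4 * Y * (6 * Y)) := by gcongr
      _ = _ := by ring
  generalize L * (4 * κ * (6 * κ)) = q at *
  calc _ ≤ (Y * 4 + Y * 17 + 2 * Y * 3 + Y * 3 + 30) +
      (Y * (Y * 8 + 5) + (4 * Y + 6 * Y + 32 * (48 * Y ^ 3)) * (Y * 5 + 4) + 11) +
      (Y * (Y + 4) + 2 * Y * (4 * Y * (6 * Y * (Y * 16 + 6) + 6) + 6) +
        (32 * (48 * Y ^ 3) + Y + 48 * Y ^ 3) * (Y * 5 + 4) + 11) +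
      ((32 * (48 * Y ^ 3) + Y + 48 * Y ^ 3) * (Y * 13 + 17) +
        2 * Y * (6 * Y * (4 * Y * (6 * Y * 12 + 15) + 6 * Y * 6 + 17) + 6) + 10) + 3 + 2 := by
        gcongr
    _ ≤ 100000 * Y ^ 4 := by
      have h3 : Y ^ 3 ≤ Y ^ 4 := Nat.pow_le_pow_right hY1 (by norm_num)
      have h2 : Y ^ 2 ≤ Y ^ 4 := Nat.pow_le_pow_right hY1 (by norm_num)
      have h1 : Y ≤ Y ^ 4 := Nat.le_self_pow (by norm_num) Y
      ring_nf
      omega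

end Bounds

/-! ### The uniform tester -/

section Program

variable {n k a b : ℕ} {f : BoolFn n} {ω : Tape n}

theorem wp_testerProgram_of_lt (h : b < a) :
    wp f ω testerProgram (fun T s => T = 3 ∧ s.samples = 0 ∧ s.queries = [] ∧ s.reg 0 ≠ 0)
      (MState.init n k a b) := by
  rw [testerProgram, wp_seq, wp_sub, wp_ite]
  refine ⟨fun _ => wp_const.2 ⟨rfl, rfl, rfl, by simp [MState.setReg]⟩, fun h' => ?_⟩
  simp [MState.setReg, MState.init] at h'
  omega

theorem wp_testerProgram_of_le (ha : 0 < a) (h : a ≤ b) :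
    wp f ω testerProgram (fun T s => T ≤ mainTime n k (kapOf k) (lamOf k) (sampleCount a b) + 2 ∧
      s.samples = sampleCount a b ∧
      s.queries = queryList
        (tapePoint ω (lamOf k) (4 * kapOf k) (6 * kapOf k) (32 * rankSize k) (sampleCount a b))
        (tapeShift ω (lamOf k) (4 * kapOf k) (6 * kapOf k) (32 * rankSize k))
        (32 * rankSize k + sampleCount a b + rankSize k) ∧
      (s.reg 0 ≠ 0 ↔ MachineAccepts f ω k (lamOf k) (4 * kapOf k) (6 * kapOf k)
        (32 * rankSize k) (sampleCount a b))) (MState.init n k a b) := by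
  rw [testerProgram, wp_seq]
  refine wp_sub_frame fun s hs hF => ?_
  have h24 : s.reg 24 = 0 := by
    rw [hs]; simp [MState.init]; omega
  rw [wp_ite]
  refine ⟨fun h' => absurd h24 h', fun _ => (wp_main k ha (ha.trans_le h) (hF.reg 0 rfl)
    (hF.reg 1 rfl) (hF.reg 2 rfl) (hF.reg 3 rfl) (hF.mem rfl) (hF.coins rfl) (hF.samples rfl)
    (hF.queries rfl)).mono ?_⟩
  rintro t s' - ⟨h1, h2⟩
  exact ⟨by omega, h2⟩

theorem machineAccepts_of_mem {lam ρ σ m t : ℕ} (hf : f ∈ kLinearStar n k) :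
    MachineAccepts f ω k lam ρ σ m t := by
  obtain ⟨S, hS, rfl⟩ := mem_kLinearStar_iff.1 hf
  have hc : ∀ u z, corrected (parity S) u z = parity S u := fun u z => by
    rw [corrected, parity_add, add_left_comm, CharTwo.add_self_eq_zero, add_zero]
  refine ⟨fun i _ => ?_, ?_⟩
  · rw [hc, CharTwo.add_self_eq_zero]
  · have := rankVerdict_parity hS (tapeChoices ω lam ρ σ)
    unfold rankValues
    simp only [hc]
    exact this

/-- The query list established by the preconditions does not mention `f`, and runs are
deterministic. -/
theorem testerProgram_isNonAdaptive (ha : 0 < a) : testerProgram.IsNonAdaptive n k a b := by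
  intro ω f f' t t' s s' h h'
  rcases lt_or_ge b a with hab | hab
  · obtain ⟨T, r, he, -, -, hq, -⟩ := wp_testerProgram_of_lt (n := n) (k := k) (f := f) (ω := ω) hab
    obtain ⟨T', r', he', -, -, hq', -⟩ :=
      wp_testerProgram_of_lt (n := n) (k := k) (f := f') (ω := ω) hab
    rw [(h.deterministic he).2, (h'.deterministic he').2, hq, hq']
  · obtain ⟨T, r, he, -, -, hq, -⟩ :=
      wp_testerProgram_of_le (n := n) (k := k) (f := f) (ω := ω) ha hab
    obtain ⟨T', r', he', -, -, hq', -⟩ :=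
      wp_testerProgram_of_le (n := n) (k := k) (f := f') (ω := ω) ha hab
    rw [(h.deterministic he).2, (h'.deterministic he').2, hq, hq']

theorem testerProgram_isOneSidedTester (ha : 0 < a) (hb : 0 < b) {ε : ℝ} (hε : 0 < ε)
    (h : (a : ℝ) / b ≤ ε) : testerProgram.IsOneSidedTester n k a b ε (kLinearStar n k) := by
  have hb' : (0 : ℝ) < b := by exact_mod_cast hb
  constructor
  · intro f hf ω
    rcases lt_or_ge b a with hab | hab
    · obtain ⟨T, r, he, -, -, -, hr⟩ :=
        wp_testerProgram_of_lt (n := n) (k := k) (f := f) (ω := ω) hab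
      exact ⟨T, r, he, hr⟩
    · obtain ⟨T, r, he, -, -, -, hr⟩ :=
        wp_testerProgram_of_le (n := n) (k := k) (f := f) (ω := ω) ha hab
      exact ⟨T, r, he, hr.2 (machineAccepts_of_mem hf)⟩
  · intro D f hf
    rcases lt_or_ge b a with hab | hab
    -- For ε > 1 nothing is ε-far, as even the zero function is at distance at most 1; accepting
    -- without queries is sound.
    · have h1 : (1 : ℝ) < ε := ((one_lt_div hb').2 (by exact_mod_cast hab)).trans_le h
      have h2 := hf _ (parity_mem_kLinearStar (S := ∅) (by simp))
      exact absurd (h2.trans measureReal_le_one) (not_le.2 h1)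
    · have hq : rankSize k = 2 ^ lamOf k * (4 * kapOf k * (6 * kapOf k)) := rfl
      refine (tapeMeasure_not_machineAccepts (lam := lamOf k) (m := 32 * rankSize k)
        (t := sampleCount a b) (by omega) (four_le_kapOf k) rfl rfl
        (lamOf_le k) (le_kapOf_mul k) hε (two_le_mul_sampleCount ha hb h) D hf).trans
        (measureReal_mono fun ω hω => ?_)
      obtain ⟨T, r, he, -, -, -, hr⟩ :=
        wp_testerProgram_of_le (n := n) (k := k) (f := f) (ω := ω) ha hab
      exact ⟨T, r, he, not_not.1 fun h0 => absurd (hr.1 h0) hω⟩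

theorem testerProgram_runsWithin (ha : 0 < a) (hb : 0 < b) {ε : ℝ} (hε : 0 < ε)
    (h : ε / 2 ≤ (a : ℝ) / b) :
    testerProgram.RunsWithin n k a b (100000000 * (n + k + 1 / ε + 1) ^ 4)
      (100000000 * (k * Real.log k + 1 / ε)) := by
  intro f ω
  have hb' : (0 : ℝ) < b := by exact_mod_cast hb
  have hi : 0 < 1 / ε := by positivity
  have hlog : 0 ≤ (k : ℝ) * Real.log k := mul_nonneg (by positivity) (Real.log_natCast_nonneg k)
  have hX : (1 : ℝ) ≤ n + k + 1 / ε + 1 := by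
    have : (0 : ℝ) ≤ n + k := by positivity
    linarith
  rcases lt_or_ge b a with hab | hab
  · obtain ⟨T, r, he, hT, hs, hq, -⟩ :=
      wp_testerProgram_of_lt (n := n) (k := k) (f := f) (ω := ω) hab
    refine ⟨T, r, he, ?_, ?_⟩
    · have := one_le_pow₀ hX (n := 4)
      rw [hT]; push_cast; linarith
    · rw [hs, hq]; simp only [List.length_nil, Nat.cast_zero, add_zero]; positivity
  · obtain ⟨T, r, he, hT, hs, hq, -⟩ :=
      wp_testerProgram_of_le (n := n) (k := k) (f := f) (ω := ω) ha hab
    have ht := sampleCount_le ha hb hε h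
    refine ⟨T, r, he, ?_, ?_⟩
    · have h1 : (T : ℝ) ≤ 100000 * ((n : ℝ) + k + sampleCount a b + 4) ^ 4 := by
        exact_mod_cast hT.trans (mainTime_le n k _)
      have hn : (0 : ℝ) ≤ n := by positivity
      have hk : (0 : ℝ) ≤ k := by positivity
      have h2 : (n : ℝ) + k + sampleCount a b + 4 ≤ 5 * (n + k + 1 / ε + 1) := by linarith
      have h3 := pow_le_pow_left₀ (by positivity) h2 4
      rw [mul_pow] at h3
      have := one_le_pow₀ hX (n := 4)
      linarith
    -- Here ε / 2 ≤ a / b ≤ 1, so 1/ε ≥ 1/2 absorbs the additive constants. This matters for k ≤ 1,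
    -- where k log k vanishes, and is why the case a > b is answered without queries.
    · have h1 : (1 : ℝ) / 2 ≤ 1 / ε := by
        have : (a : ℝ) / b ≤ 1 := (div_le_one hb').2 (by exact_mod_cast hab)
        exact one_div_le_one_div_of_le hε (by linarith)
      have h2 := rankSize_le_log k
      rw [hs, hq, length_queryList]
      push_cast
      linarith

theorem exists_testerProgram : ∃ (P : Prog) (C : ℝ) (d : ℕ), 0 < C ∧
      ∀ (n k : ℕ) (ε : ℝ) (a b : ℕ), 0 < ε → 0 < b → ε / 2 ≤ (a : ℝ) / b → (a : ℝ) / b ≤ ε →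
        P.RunsWithin n k a b (C * (n + k + 1 / ε + 1) ^ d) (C * (k * Real.log k + 1 / ε)) ∧
        P.IsNonAdaptive n k a b ∧
        P.IsOneSidedTester n k a b ε (kLinearStar n k) := by
  refine ⟨testerProgram, 100000000, 4, by norm_num, fun n k ε a b hε hb h h' => ?_⟩
  have ha : 0 < a := by
    rcases Nat.eq_zero_or_pos a with rfl | ha
    · rw [Nat.cast_zero, zero_div] at h; linarith
    · exact ha
  exact ⟨testerProgram_runsWithin ha hb hε h, testerProgram_isNonAdaptive ha,
    testerProgram_isOneSidedTester ha hb hε h'⟩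

end Program

/-- There is a family of efficient exact learners. -/
theorem exists_learnerFamily : ∃ H : (N K : ℕ) → Learner N, ∀ N K : ℕ, 2 ≤ N → 1 ≤ K →
    (H N K).ExactlyLearns (kLinearStar N K) ∧
      (Fintype.card (H N K).Q : ℝ) ≤ 5 * K * Real.logb 2 N := by
  classical
  refine ⟨fun N K => if h : 2 ≤ N ∧ 1 ≤ K then (exists_learner N K h.1 h.2).choose else
    -- Outside the required range any learner will do.
    { Q := Empty, query := fun q => q.elim, output := fun _ _ => 0 }, fun N K hN hK => ?_⟩
  simp only [dif_pos (⟨hN, hK⟩ : 2 ≤ N ∧ 1 ≤ K)]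
  exact (exists_learner N K hN hK).choose_spec

theorem mainTheorem2 :
    -- Test-Linear*, built on a deterministic non-adaptive exact learner
    (∃ c₂ : ℝ, 0 < c₂ ∧ ∃ H : (N K : ℕ) → Learner N,
      (∀ N K : ℕ, 2 ≤ N → 1 ≤ K →
        (H N K).ExactlyLearns (kLinearStar N K) ∧
        (Fintype.card (H N K).Q : ℝ) ≤ c₂ * K * Real.logb 2 N) ∧
      ∃ C : ℝ, 0 < C ∧ ∀ (n k : ℕ) (ε : ℝ), 12 ≤ k → 0 < ε →
        (testLinearStar c₂ n k ε (H (256 * k ^ 2) (8 * k))).IsOneSidedTester ε (kLinearStar n k) ∧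
        ((testLinearStar c₂ n k ε (H (256 * k ^ 2) (8 * k))).queryComplexity : ℝ) ≤
          C * (k * Real.log k + 1 / ε)) ∧
    -- a uniform polynomial-time tester for all parameters; the program is given `ε` as a fraction
    -- `a / b`, which may be `ε` itself or, for irrational `ε`, any fraction in `[ε / 2, ε]`
    (∃ (P : Prog) (C : ℝ) (d : ℕ), 0 < C ∧
      ∀ (n k : ℕ) (ε : ℝ) (a b : ℕ), 0 < ε → 0 < b → ε / 2 ≤ (a : ℝ) / b → (a : ℝ) / b ≤ ε →
        P.RunsWithin n k a b (C * (n + k + 1 / ε + 1) ^ d) (C * (k * Real.log k + 1 / ε)) ∧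
        P.IsNonAdaptive n k a b ∧
        P.IsOneSidedTester n k a b ε (kLinearStar n k)) := by
  refine ⟨?_, exists_testerProgram⟩
  obtain ⟨H, hH⟩ := exists_learnerFamily
  refine ⟨5, by norm_num, H, hH, 100000, by norm_num, fun n k ε hk hε => ?_⟩
  obtain ⟨hL, hQ⟩ := hH (256 * k ^ 2) (8 * k) (by nlinarith) (by omega)
  exact ⟨⟨fun f hf s xs => testLinearStar_accepts _ hL hf s xs,
    fun D f hf => testLinearStar_rejects hk hε _ hL hQ D f hf⟩,
    testLinearStar_queryComplexity_le hk hε _ hQ⟩
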